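/- There is a single algorithm, together with absolute constants $c,K>0$ and $a,b\in\mathbb N$, with the following guarantee. Setting. Let $(D,\mu)$ be a probability space (for instance a domain with its uniform measure), and let $T=\{\chi_1,\dots,\chi_n\}$ be a finite set of "Fourier characters": measurable functions $\chi_j:D\to\mathbb C$ that are orthonormal in $L^2(\mu)$ and satisfy $|\chi_j|\le 1$. Write $\widehat h(\chi_j)=\mathbb E_{x\sim\mu}[h(x)\overline{\chi_j(x)}]$ and $\mathrm{supp}(\widehat h)=\{\chi\in T:\widehat h(\chi)\ne 0\}$. Let $k\in\mathbb N$, $\gamma\in(0,1)$, $\delta\in(0,1/2]$, $\eta>0$ and $0\le\varepsilon\le c\,\eta\,\delta$. Let $f\in\mathrm{span}(T)$ with $|\mathrm{supp}(\widehat f)|\le k$ and $|\widehat f(\chi)|\ge\eta$ for every $\chi\in\mathrm{supp}(\widehat f)$. Access. The algorithm is a program of a real RAM (exact real arithmetic, square roots and comparisons at unit cost, indirect addressing by natural-number registers, no rounding). It receives $n=|T|$, $k,\gamma,\delta,\eta$ (but neither $f$ nor $\varepsilon$). It can draw random points $x_1,x_2,\dots\in D$, independent with law $\mu$; for each drawn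 $x_i$ it can read the values $\chi_1(x_i),\dots,\chi_n(x_i)$ and the answer $y_i\in\mathbb C$ of an oracle for $f$ with $(\tfrac12-\delta,\varepsilon)$ random outlier noise; each draw counts as one query. Here random outlier noise means: each observation is, independently of the points and of the other observations, designated an outlier with probability at most $\tfrac12-\delta$; if it is not an outlier then $|y_i-f(x_i)|\le\varepsilon$, and otherwise the values $y_i$ are arbitrary (adversarial: they may depend on all points and all outlier locations), subject only to $|y_i|\le B$ for all $i$, where the bound $B$ is not known to the algorithm. Conclusion. Put $Q=k^2\,\log(|T|+1)\,\log(2/\gamma)/\delta^2$. The algorithm always halts, makes at most $K\,Q\,(\log(2+Q))^a$ queries (that is, $\tilde O(k^2\log|T|\log\frac1\gamma/\delta^2)$), runs in time at most $K\,\bigl(|T|+\tfrac1\delta+\tfrac1\eta+\log\tfrac1\gamma+B\bigr)^b$ (in particular in time $\mathrm{poly}(|T|,1/\delta,1/\eta,\log\frac1\gamma)$ when $B$ is polynomially bounded in $|T|$), and with probability at least $1-\gamma$ it outputs the coefficients of a function $g\in\mathrm{span}(T)$ such that $$\mathrm{supp}(\widehat g)=\mathrm{supp}(\widehat f),\qquad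 \mathbb E_{x\sim\mu}\bigl[|g(x)-f(x)|\bigr]\le K\,\frac{\varepsilon}{\delta},\qquad |\widehat g(\chi)-\widehat f(\chi)|\le K\,\frac{\varepsilon}{\delta}\ \text{ for every }\chi\in T .$$ -/

import Mathlib

universe u v

/-! ## A real random access machine with access to noisy random examples

Programs of a structured language over a memory that consists of registers holding natural numbers
and of cells holding real numbers.  Cells are addressed indirectly, through expressions in the
registers.  Arithmetic operations, square roots and comparisons of real numbers are exact and have
unit cost; there is no rounding and no conversion from reals to naturals.  The only source of
randomness is the instruction `Prog.draw`. -/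

namespace RealRAM

/-- What the machine sees of one random example `x`: the observation of the noisy oracle at `x`,
and the values at `x` of the candidate characters. -/
structure Example where
  obs : ℂ
  char : ℕ → ℂ

structure State where
  /-- registers -/
  nat : ℕ → ℕ
  /-- memory cells -/
  real : ℕ → ℝ
  /-- the example drawn last -/
  cur : Example
  /-- number of examples drawn (that is, of oracle queries made) so far -/
  queries : ℕ

/-- Expressions with a value in the natural numbers; `reg i` is the content of register `i`. -/
inductive NatExpr where
  | const (c : ℕ)
  | reg (i : ℕ)
  | add (a b : NatExpr)
  | sub (a b : NatExpr)
  | mul (a b : NatExpr)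

namespace NatExpr

def eval (s : State) : NatExpr → ℕ
  | const c => c
  | reg i => s.nat i
  | add a b => a.eval s + b.eval s
  | sub a b => a.eval s - b.eval s
  | mul a b => a.eval s * b.eval s

/-- The number of operations in an expression, a read access counting as one. -/
def cost : NatExpr → ℕ
  | const _ => 1
  | reg _ => 1
  | add a b => a.cost + b.cost + 1
  | sub a b => a.cost + b.cost + 1
  | mul a b => a.cost + b.cost + 1

end NatExpr

/-- Expressions with a value in the reals.  `cell a` is the content of the cell with address `a`;
`obsRe`, `obsIm`, `charRe j`, `charIm j` read the current example. -/
inductive RealExpr where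
  | ofNat (a : NatExpr)
  | cell (a : NatExpr)
  | obsRe
  | obsIm
  | charRe (j : NatExpr)
  | charIm (j : NatExpr)
  | add (a b : RealExpr)
  | sub (a b : RealExpr)
  | mul (a b : RealExpr)
  | div (a b : RealExpr)
  | sqrt (a : RealExpr)

namespace RealExpr

noncomputable def eval (s : State) : RealExpr → ℝ
  | ofNat a => (a.eval s : ℝ)
  | cell a => s.real (a.eval s)
  | obsRe => s.cur.obs.re
  | obsIm => s.cur.obs.im
  | charRe j => (s.cur.char (j.eval s)).re
  | charIm j => (s.cur.char (j.eval s)).im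
  | add a b => a.eval s + b.eval s
  | sub a b => a.eval s - b.eval s
  | mul a b => a.eval s * b.eval s
  | div a b => a.eval s / b.eval s
  | sqrt a => Real.sqrt (a.eval s)

def cost : RealExpr → ℕ
  | ofNat a => a.cost + 1
  | cell a => a.cost + 1
  | obsRe => 1
  | obsIm => 1
  | charRe j => j.cost + 1
  | charIm j => j.cost + 1
  | add a b => a.cost + b.cost + 1
  | sub a b => a.cost + b.cost + 1
  | mul a b => a.cost + b.cost + 1
  | div a b => a.cost + b.cost + 1
  | sqrt a => a.cost + 1

end RealExpr

inductive Test where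
  | natLt (a b : NatExpr)
  | realLt (a b : RealExpr)

namespace Test

def Holds (s : State) : Test → Prop
  | natLt a b => a.eval s < b.eval s
  | realLt a b => a.eval s < b.eval s

def cost : Test → ℕ
  | natLt a b => a.cost + b.cost + 1
  | realLt a b => a.cost + b.cost + 1

end Test

inductive Prog where
  | skip
  /-- assign to register `i` -/
  | setNat (i : ℕ) (e : NatExpr)
  /-- assign to the cell with address `a` -/
  | setReal (a : NatExpr) (e : RealExpr)
  /-- draw a fresh random point of the domain and query the oracle at this point -/
  | draw
  | seq (p q : Prog)
  | ite (t : Test) (p q : Prog)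
  /-- repeat `p` as long as the test `t` succeeds -/
  | loop (t : Test) (p : Prog)

/-- `Exec o p s t s'`: given the sequence `o` of examples, the program `p`, started in the state
`s`, halts after `t` steps in the state `s'`. -/
inductive Exec (o : ℕ → Example) : Prog → State → ℕ → State → Prop where
  | skip (s : State) : Exec o .skip s 1 s
  | setNat (s : State) (i : ℕ) (e : NatExpr) :
      Exec o (.setNat i e) s (e.cost + 1) { s with nat := Function.update s.nat i (e.eval s) }
  | setReal (s : State) (a : NatExpr) (e : RealExpr) :
      Exec o (.setReal a e) s (a.cost + e.cost + 1)
        { s with real := Function.update s.real (a.eval s) (e.eval s) }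
  | draw (s : State) :
      Exec o .draw s 1 { s with cur := o s.queries, queries := s.queries + 1 }
  | seq {p q : Prog} {s s' s'' : State} {t t' : ℕ} :
      Exec o p s t s' → Exec o q s' t' s'' → Exec o (.seq p q) s (t + t' + 1) s''
  | ite_true {c : Test} {p q : Prog} {s s' : State} {t : ℕ} :
      c.Holds s → Exec o p s t s' → Exec o (.ite c p q) s (c.cost + t + 1) s'
  | ite_false {c : Test} {p q : Prog} {s s' : State} {t : ℕ} :
      ¬ c.Holds s → Exec o q s t s' → Exec o (.ite c p q) s (c.cost + t + 1) s'
  | loop_stop {c : Test} {p : Prog} {s : State} :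
      ¬ c.Holds s → Exec o (.loop c p) s (c.cost + 1) s
  | loop_step {c : Test} {p : Prog} {s s' s'' : State} {t t' : ℕ} :
      c.Holds s → Exec o p s t s' → Exec o (.loop c p) s' t' s'' →
        Exec o (.loop c p) s (c.cost + t + t' + 1) s''

/-- The machine is deterministic once the sequence of examples is fixed. -/
theorem Exec.unique {o : ℕ → Example} {p : Prog} {s s₁ s₂ : State} {t₁ t₂ : ℕ}
    (h₁ : Exec o p s t₁ s₁) (h₂ : Exec o p s t₂ s₂) : t₁ = t₂ ∧ s₁ = s₂ := by
  induction h₁ generalizing t₂ s₂ with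
  | skip s => cases h₂; exact ⟨rfl, rfl⟩
  | setNat s i e => cases h₂; exact ⟨rfl, rfl⟩
  | setReal s a e => cases h₂; exact ⟨rfl, rfl⟩
  | draw s => cases h₂; exact ⟨rfl, rfl⟩
  | seq _ _ ih ih' =>
    cases h₂ with
    | seq g g' =>
      obtain ⟨rfl, rfl⟩ := ih g
      obtain ⟨rfl, rfl⟩ := ih' g'
      exact ⟨rfl, rfl⟩
  | ite_true hc _ ih =>
    cases h₂ with
    | ite_true _ g => obtain ⟨rfl, rfl⟩ := ih g; exact ⟨rfl, rfl⟩
    | ite_false hc' _ => exact absurd hc hc'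
  | ite_false hc _ ih =>
    cases h₂ with
    | ite_true hc' _ => exact absurd hc' hc
    | ite_false _ g => obtain ⟨rfl, rfl⟩ := ih g; exact ⟨rfl, rfl⟩
  | loop_stop hc =>
    cases h₂ with
    | loop_stop _ => exact ⟨rfl, rfl⟩
    | loop_step hc' _ _ => exact absurd hc' hc
  | loop_step hc _ _ ih ih' =>
    cases h₂ with
    | loop_stop hc' => exact absurd hc hc'
    | loop_step _ g g' =>
      obtain ⟨rfl, rfl⟩ := ih g
      obtain ⟨rfl, rfl⟩ := ih' g'
      exact ⟨rfl, rfl⟩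

/-- Initial state: register `0` holds the number `n` of candidate characters, register `1` the
sparsity `k`; the cells `0`, `1`, `2` hold `γ`, `δ`, `η`; everything else is zero. -/
def initState (n k : ℕ) (γ δ η : ℝ) : State where
  nat := fun i => match i with
    | 0 => n
    | 1 => k
    | _ => 0
  real := fun i => match i with
    | 0 => γ
    | 1 => δ
    | 2 => η
    | _ => 0
  cur := ⟨0, fun _ => 0⟩
  queries := 0

/-- The output: the `j`-th coefficient has real part in cell `2j` and imaginary part in cell
`2j+1`. -/
def State.outCoeff (s : State) (j : ℕ) : ℂ := ⟨s.real (2 * j), s.real (2 * j + 1)⟩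

end RealRAM

open MeasureTheory ProbabilityTheory

/-- A finite set of Fourier characters over the probability space `(D, μ)`: functions that are
orthonormal with respect to `μ` and bounded by `1` (so their sup-norm is equal to `1`). -/
structure IsCharacterFamily {D : Type u} [MeasurableSpace D] (μ : Measure D) {n : ℕ}
    (χ : Fin n → D → ℂ) : Prop where
  measurable : ∀ j, Measurable (χ j)
  norm_le_one : ∀ j x, ‖χ j x‖ ≤ 1
  orthonormal : ∀ i j, ∫ x, χ i x * (starRingEnd ℂ) (χ j x) ∂μ = if i = j then 1 else 0

/-- The Fourier coefficient of `h` at the `j`-th character. -/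
noncomputable def charCoeff {D : Type u} [MeasurableSpace D] (μ : Measure D) {n : ℕ}
    (χ : Fin n → D → ℂ) (h : D → ℂ) (j : Fin n) : ℂ :=
  ∫ x, h x * (starRingEnd ℂ) (χ j x) ∂μ

/-- The support of the Fourier transform. -/
def charSupport {D : Type u} [MeasurableSpace D] (μ : Measure D) {n : ℕ}
    (χ : Fin n → D → ℂ) (h : D → ℂ) : Set (Fin n) :=
  {j | charCoeff μ χ h j ≠ 0}

/-- `x i` are independent random points of `D` with law `μ`, and `y i` is the observation that an
oracle for `f` with `(ρ, ε)` random outlier noise returns at `x i`.  Every observation is flagged as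
an outlier with probability at most `ρ`, independently of the points and of the other observations;
an observation that is not flagged has error at most `ε`.  Otherwise the values `y i` are arbitrary:
they may depend on all points, on all flags and on further randomness. -/
def IsRandomOutlierOracle {D : Type u} [MeasurableSpace D] (μ : Measure D)
    {Ω : Type v} [MeasurableSpace Ω] (P : Measure Ω) (f : D → ℂ) (ρ ε : ℝ)
    (x : ℕ → Ω → D) (y : ℕ → Ω → ℂ) : Prop :=
  (∀ i, Measurable (x i)) ∧ (∀ i, P.map (x i) = μ) ∧
  ∃ outlier : ℕ → Ω → Bool,
    (∀ i, Measurable (outlier i)) ∧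
    (∀ i, P {ω | outlier i ω = true} ≤ ENNReal.ofReal ρ) ∧
    (∀ i, IndepFun (x i) (outlier i) P) ∧
    iIndepFun (fun i ω => (x i ω, outlier i ω)) P ∧
    ∀ i ω, outlier i ω = false → ‖y i ω - f (x i ω)‖ ≤ ε

/-- The examples shown to the machine at the sample point `ω`. -/
def exampleSeq {D : Type u} {n : ℕ} (χ : Fin n → D → ℂ) {Ω : Type v}
    (x : ℕ → Ω → D) (y : ℕ → Ω → ℂ) (ω : Ω) (i : ℕ) : RealRAM.Example where
  obs := y i ω
  char := fun j => if h : j < n then χ ⟨j, h⟩ (x i ω) else 0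

/-- The function `∑ j < n, b_j χ_j` whose coefficients are the output in the final state `s`. -/
noncomputable def outputFun {D : Type u} {n : ℕ} (χ : Fin n → D → ℂ) (s : RealRAM.State) : D → ℂ :=
  fun z => ∑ j : Fin n, s.outCoeff j * χ j z

/-- The quantity `k² log|T| log(1/γ) / δ²`, with `|T| + 1` and `2/γ` inside the logarithms so that
it does not degenerate for `|T| = 1` or `γ` close to `1`. -/
noncomputable def queryScale (n k : ℕ) (γ δ : ℝ) : ℝ :=
  (k : ℝ) ^ 2 * Real.log (n + 1) * Real.log (2 / γ) / δ ^ 2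

namespace RealRAM

/-! ### Cells as tagged arrays -/

/-- The entry with index `i` of the array with tag `a`. -/
def State.arr (s : State) (a i : ℕ) : ℝ := s.real (64 * i + a)

def State.setArr (s : State) (a i : ℕ) (v : ℝ) : State :=
  { s with real := Function.update s.real (64 * i + a) v }

def State.setReg (s : State) (i v : ℕ) : State :=
  { s with nat := Function.update s.nat i v }

/-- Address of the entry with index `idx` of the array with tag `a`. -/
def loc (a : ℕ) (idx : NatExpr) : NatExpr := .add (.mul (.const 64) idx) (.const a)

def rd (a : ℕ) (idx : NatExpr) : RealExpr := .cell (loc a idx)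

def wr (a : ℕ) (idx : NatExpr) (e : RealExpr) : Prog := .setReal (loc a idx) e

@[simp] theorem rd_eval (s : State) (a : ℕ) (idx : NatExpr) :
    (rd a idx).eval s = s.arr a (idx.eval s) := rfl

theorem State.arr_setArr (s : State) {a b : ℕ} (ha : a < 64) (hb : b < 64) (i j : ℕ) (v : ℝ) :
    (s.setArr a i v).arr b j = if b = a ∧ j = i then v else s.arr b j := by
  unfold State.arr State.setArr
  by_cases h : b = a ∧ j = i
  · obtain ⟨rfl, rfl⟩ := h; simp
  · rw [if_neg h]
    exact Function.update_of_ne (by omega) _ _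

@[simp] theorem State.arr_setReg (s : State) (i v : ℕ) : (s.setReg i v).arr = s.arr := rfl
@[simp] theorem State.nat_setArr (s : State) (a i : ℕ) (v : ℝ) : (s.setArr a i v).nat = s.nat := rfl
@[simp] theorem State.cur_setArr (s : State) (a i : ℕ) (v : ℝ) : (s.setArr a i v).cur = s.cur := rfl
@[simp] theorem State.cur_setReg (s : State) (i v : ℕ) : (s.setReg i v).cur = s.cur := rfl
@[simp] theorem State.queries_setArr (s : State) (a i : ℕ) (v : ℝ) :
    (s.setArr a i v).queries = s.queries := rfl
@[simp] theorem State.queries_setReg (s : State) (i v : ℕ) :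
    (s.setReg i v).queries = s.queries := rfl
theorem State.nat_setReg (s : State) (i v j : ℕ) :
    (s.setReg i v).nat j = if j = i then v else s.nat j := by
  simp [State.setReg, Function.update_apply]

/-! ### Frames -/

namespace Prog

/-- `p.writesTag a = false` guarantees that `p` does not change the array with tag `a`. -/
def writesTag : Prog → ℕ → Bool
  | skip, _ => false
  | setNat _ _, _ => false
  | setReal (.add (.mul (.const c) _) (.const b)) _, a => c != 64 || b % 64 == a % 64
  | setReal _ _, _ => true
  | draw, _ => false
  | seq p q, a => p.writesTag a || q.writesTag a
  | ite _ p q, a => p.writesTag a || q.writesTag a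
  | loop _ p, a => p.writesTag a

def writesReg : Prog → ℕ → Bool
  | skip, _ => false
  | setNat i _, r => i == r
  | setReal _ _, _ => false
  | draw, _ => false
  | seq p q, a => p.writesReg a || q.writesReg a
  | ite _ p q, a => p.writesReg a || q.writesReg a
  | loop _ p, a => p.writesReg a

def draws : Prog → Bool
  | skip => false
  | setNat _ _ => false
  | setReal _ _ => false
  | draw => true
  | seq p q => p.draws || q.draws
  | ite _ p q => p.draws || q.draws
  | loop _ p => p.draws

/-- Coefficient and degree of a bound on the running time of `p` as a function of a bound on the
number of iterations of each of its loops. -/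
def coeff : Prog → ℕ
  | skip => 1
  | setNat _ e => e.cost + 1
  | setReal a e => a.cost + e.cost + 1
  | draw => 1
  | seq p q => p.coeff + q.coeff + 1
  | ite c p q => c.cost + p.coeff + q.coeff + 1
  | loop c p => 2 * (c.cost + p.coeff + 1)

def deg : Prog → ℕ
  | skip => 0
  | setNat _ _ => 0
  | setReal _ _ => 0
  | draw => 0
  | seq p q => max p.deg q.deg
  | ite _ p q => max p.deg q.deg
  | loop _ p => p.deg + 1

end Prog

/-- The state `s'` agrees with `s` on everything that `p` does not write. -/
structure Frame (p : Prog) (s s' : State) : Prop where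
  arr : ∀ a, p.writesTag a = false → s'.arr a = s.arr a
  nat : ∀ r, p.writesReg r = false → s'.nat r = s.nat r
  cur : p.draws = false → s'.cur = s.cur
  queries : p.draws = false → s'.queries = s.queries

theorem Frame.refl (p : Prog) (s : State) : Frame p s s :=
  ⟨fun _ _ => rfl, fun _ _ => rfl, fun _ => rfl, fun _ => rfl⟩

theorem Frame.trans {p : Prog} {s s' s'' : State} (h : Frame p s s') (h' : Frame p s' s'') :
    Frame p s s'' :=
  ⟨fun a ha => (h'.arr a ha).trans (h.arr a ha), fun a ha => (h'.nat a ha).trans (h.nat a ha),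
    fun ha => (h'.cur ha).trans (h.cur ha), fun ha => (h'.queries ha).trans (h.queries ha)⟩

theorem Frame.mono {p q : Prog} {s s' : State} (h : Frame p s s')
    (ht : ∀ a, q.writesTag a = false → p.writesTag a = false)
    (hr : ∀ a, q.writesReg a = false → p.writesReg a = false)
    (hd : q.draws = false → p.draws = false) : Frame q s s' :=
  ⟨fun a ha => h.arr a (ht a ha), fun a ha => h.nat a (hr a ha),
    fun ha => h.cur (hd ha), fun ha => h.queries (hd ha)⟩

theorem Frame.seq_left {p q : Prog} {s s' : State} (h : Frame p s s') : Frame (.seq p q) s s' :=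
  h.mono (by simp +contextual [Prog.writesTag]) (by simp +contextual [Prog.writesReg])
    (by simp +contextual [Prog.draws])

theorem Frame.seq_right {p q : Prog} {s s' : State} (h : Frame q s s') : Frame (.seq p q) s s' :=
  h.mono (by simp +contextual [Prog.writesTag]) (by simp +contextual [Prog.writesReg])
    (by simp +contextual [Prog.draws])

theorem Frame.ite_left {c : Test} {p q : Prog} {s s' : State} (h : Frame p s s') :
    Frame (.ite c p q) s s' :=
  h.mono (by simp +contextual [Prog.writesTag]) (by simp +contextual [Prog.writesReg])
    (by simp +contextual [Prog.draws])

theorem Frame.ite_right {c : Test} {p q : Prog} {s s' : State} (h : Frame q s s') :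
    Frame (.ite c p q) s s' :=
  h.mono (by simp +contextual [Prog.writesTag]) (by simp +contextual [Prog.writesReg])
    (by simp +contextual [Prog.draws])

theorem Frame.loop {c : Test} {p : Prog} {s s' : State} (h : Frame p s s') :
    Frame (.loop c p) s s' :=
  h.mono (by simp [Prog.writesTag]) (by simp [Prog.writesReg]) (by simp [Prog.draws])

theorem Exec.frame {o : ℕ → Example} {p : Prog} {s s' : State} {t : ℕ} (h : Exec o p s t s') :
    Frame p s s' := by
  induction h with
  | skip s => exact Frame.refl _ _
  | setNat s i e =>
    refine ⟨fun _ _ => rfl, fun r hr => ?_, fun _ => rfl, fun _ => rfl⟩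
    have : i ≠ r := by simpa [Prog.writesReg] using hr
    exact Function.update_of_ne this.symm _ _
  | setReal s a e =>
    refine ⟨fun b hb => ?_, fun _ _ => rfl, fun _ => rfl, fun _ => rfl⟩
    unfold Prog.writesTag at hb
    split at hb
    · simp at *
    · simp at *
    · rename_i c idx b' e' heq
      cases heq
      simp only [Bool.or_eq_false_iff, bne_eq_false_iff_eq, beq_eq_false_iff_ne] at hb
      obtain ⟨rfl, hb⟩ := hb
      funext i
      refine Function.update_of_ne ?_ _ _
      simp only [NatExpr.eval]
      omega
    · simp at hb
    all_goals simp at *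
  | draw s =>
    exact ⟨fun _ _ => rfl, fun _ _ => rfl, by simp [Prog.draws], by simp [Prog.draws]⟩
  | seq _ _ ih ih' => exact ih.seq_left.trans ih'.seq_right
  | ite_true _ _ ih => exact ih.ite_left
  | ite_false _ _ ih => exact ih.ite_right
  | loop_stop _ => exact Frame.refl _ _
  | loop_step _ _ _ ih ih' => exact ih.loop.trans ih'

/-! ### Total correctness with a time bound -/

/-- The program halts in the state `s'`, in the time that is due when no loop is iterated more than
`Y` times. -/
def Runs (o : ℕ → Example) (Y : ℕ) (p : Prog) (s s' : State) : Prop :=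
  ∃ t, Exec o p s t s' ∧ t ≤ p.coeff * Y ^ p.deg

variable {o : ℕ → Example} {Y : ℕ}

theorem Runs.frame {p : Prog} {s s' : State} (h : Runs o Y p s s') : Frame p s s' :=
  h.choose_spec.1.frame

theorem Runs.skip (s : State) : Runs o Y .skip s s := ⟨1, .skip s, by simp [Prog.coeff, Prog.deg]⟩

theorem Runs.setNat (s : State) (i : ℕ) (e : NatExpr) :
    Runs o Y (.setNat i e) s (s.setReg i (e.eval s)) :=
  ⟨_, .setNat s i e, by simp [Prog.coeff, Prog.deg]⟩

theorem Runs.wr (s : State) (a : ℕ) (idx : NatExpr) (e : RealExpr) :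
    Runs o Y (wr a idx e) s (s.setArr a (idx.eval s) (e.eval s)) :=
  ⟨_, .setReal s (loc a idx) e, by simp [RealRAM.wr, Prog.coeff, Prog.deg]⟩

theorem Runs.setReal (s : State) (a : NatExpr) (e : RealExpr) :
    Runs o Y (.setReal a e) s { s with real := Function.update s.real (a.eval s) (e.eval s) } :=
  ⟨_, .setReal s a e, by simp [Prog.coeff, Prog.deg]⟩

theorem Runs.draw (s : State) :
    Runs o Y .draw s { s with cur := o s.queries, queries := s.queries + 1 } :=
  ⟨_, .draw s, by simp [Prog.coeff, Prog.deg]⟩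

theorem Runs.seq {p q : Prog} {s s' s'' : State} (hY : 1 ≤ Y) (h : Runs o Y p s s')
    (h' : Runs o Y q s' s'') : Runs o Y (.seq p q) s s'' := by
  obtain ⟨t, ht, hb⟩ := h
  obtain ⟨t', ht', hb'⟩ := h'
  refine ⟨_, .seq ht ht', ?_⟩
  have h1 : Y ^ p.deg ≤ Y ^ (max p.deg q.deg) := Nat.pow_le_pow_right hY (le_max_left _ _)
  have h2 : Y ^ q.deg ≤ Y ^ (max p.deg q.deg) := Nat.pow_le_pow_right hY (le_max_right _ _)
  have h3 : 1 ≤ Y ^ (max p.deg q.deg) := Nat.one_le_pow _ _ hY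
  simp only [Prog.coeff, Prog.deg]
  have := Nat.mul_le_mul_left p.coeff h1
  have := Nat.mul_le_mul_left q.coeff h2
  linarith

theorem Runs.ite_true {c : Test} {p q : Prog} {s s' : State} (hY : 1 ≤ Y) (hc : c.Holds s)
    (h : Runs o Y p s s') : Runs o Y (.ite c p q) s s' := by
  obtain ⟨t, ht, hb⟩ := h
  refine ⟨_, .ite_true hc ht, ?_⟩
  have h1 : Y ^ p.deg ≤ Y ^ (max p.deg q.deg) := Nat.pow_le_pow_right hY (le_max_left _ _)
  have h3 : 1 ≤ Y ^ (max p.deg q.deg) := Nat.one_le_pow _ _ hY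
  simp only [Prog.coeff, Prog.deg]
  have := Nat.mul_le_mul_left p.coeff h1
  have := Nat.mul_le_mul_left c.cost h3
  have := Nat.zero_le (q.coeff * Y ^ (max p.deg q.deg))
  linarith

theorem Runs.ite_false {c : Test} {p q : Prog} {s s' : State} (hY : 1 ≤ Y) (hc : ¬ c.Holds s)
    (h : Runs o Y q s s') : Runs o Y (.ite c p q) s s' := by
  obtain ⟨t, ht, hb⟩ := h
  refine ⟨_, .ite_false hc ht, ?_⟩
  have h1 : Y ^ q.deg ≤ Y ^ (max p.deg q.deg) := Nat.pow_le_pow_right hY (le_max_right _ _)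
  have h3 : 1 ≤ Y ^ (max p.deg q.deg) := Nat.one_le_pow _ _ hY
  simp only [Prog.coeff, Prog.deg]
  have := Nat.mul_le_mul_left q.coeff h1
  have := Nat.mul_le_mul_left c.cost h3
  have := Nat.zero_le (p.coeff * Y ^ (max p.deg q.deg))
  linarith

theorem exists_runs_loop {c : Test} {p : Prog} (hY : 1 ≤ Y) (I : ℕ → State → Prop) {b : ℕ}
    (hb : b ≤ Y) {s : State} (h0 : I 0 s)
    (step : ∀ i < b, ∀ s, I i s → c.Holds s ∧ ∃ s', Runs o Y p s s' ∧ I (i + 1) s')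
    (halt : ∀ s, I b s → ¬ c.Holds s) : ∃ s', Runs o Y (.loop c p) s s' ∧ I b s' := by
  have key : ∀ j ≤ b, ∀ s, I (b - j) s → ∃ s' t, Exec o (.loop c p) s t s' ∧
      t ≤ (j + 1) * ((c.cost + p.coeff + 1) * Y ^ p.deg) ∧ I b s' := by
    have h1 : 1 ≤ Y ^ p.deg := Nat.one_le_pow _ _ hY
    intro j
    induction j with
    | zero =>
      intro _ s hs
      refine ⟨s, _, Exec.loop_stop (halt s hs), ?_, hs⟩
      have := Nat.mul_le_mul_left (c.cost + 1) h1
      have := Nat.zero_le (p.coeff * Y ^ p.deg)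
      linarith
    | succ j ih =>
      intro hj s hs
      obtain ⟨hc, s', ⟨t, ht, htb⟩, hI⟩ := step (b - (j + 1)) (by omega) s hs
      rw [show b - (j + 1) + 1 = b - j by omega] at hI
      obtain ⟨s'', t', ht', htb', hI'⟩ := ih (by omega) s' hI
      refine ⟨s'', _, .loop_step hc ht ht', ?_, hI'⟩
      have := Nat.mul_le_mul_left (c.cost + 1) h1
      linarith
  obtain ⟨s', t, ht, htb, hI⟩ := key b le_rfl s (by simpa using h0)
  refine ⟨s', ⟨t, ht, htb.trans ?_⟩, hI⟩
  simp only [Prog.coeff, Prog.deg, pow_succ]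
  calc (b + 1) * ((c.cost + p.coeff + 1) * Y ^ p.deg)
      ≤ (2 * Y) * ((c.cost + p.coeff + 1) * Y ^ p.deg) := Nat.mul_le_mul_right _ (by omega)
    _ = _ := by ring

/-- `for r < bnd do p` -/
def forLoop (r : ℕ) (bnd : NatExpr) (p : Prog) : Prog :=
  .seq (.setNat r (.const 0))
    (.loop (.natLt (.reg r) bnd) (.seq p (.setNat r (.add (.reg r) (.const 1)))))

theorem exists_runs_forLoop {r : ℕ} {bnd : NatExpr} {p : Prog} (hY : 1 ≤ Y)
    (I : ℕ → State → Prop) (hI : ∀ i s v, I i s → I i (s.setReg r v)) {b : ℕ} (hb : b ≤ Y)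
    {s : State} (hp : p.writesReg r = false)
    (hbnd : ∀ s', Frame (forLoop r bnd p) s s' → bnd.eval s' = b) (h0 : I 0 s)
    (step : ∀ i < b, ∀ s', Frame (forLoop r bnd p) s s' → s'.nat r = i → I i s' →
      ∃ s'', Runs o Y p s' s'' ∧ I (i + 1) s'') :
    ∃ s', Runs o Y (forLoop r bnd p) s s' ∧ I b s' := by
  have hr : ∀ s v, Frame (forLoop r bnd p) s (s.setReg r v) := by
    intro s v
    refine ⟨fun _ _ => rfl, fun r' hr' => ?_, fun _ => rfl, fun _ => rfl⟩
    rw [State.nat_setReg, if_neg]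
    rintro rfl
    simp [forLoop, Prog.writesReg] at hr'
  obtain ⟨s', hs', -, h2, h3⟩ := exists_runs_loop (o := o) (c := .natLt (.reg r) bnd)
    (p := .seq p (.setNat r (.add (.reg r) (.const 1)))) hY
    (fun i s' => Frame (forLoop r bnd p) s s' ∧ s'.nat r = i ∧ I i s') hb
    (s := s.setReg r 0) ⟨hr s 0, by simp [State.nat_setReg], hI _ _ _ h0⟩
    (by
      rintro i hi s' ⟨hf, hn, hi'⟩
      refine ⟨by simp [Test.Holds, NatExpr.eval, hn, hbnd s' hf, hi], ?_⟩
      obtain ⟨s'', hs'', hI'⟩ := step i hi s' hf hn hi'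
      refine ⟨_, hs''.seq hY (Runs.setNat s'' r _), ?_, ?_, hI _ _ _ hI'⟩
      · refine hf.trans (Frame.trans ?_ (hr _ _))
        exact hs''.frame.seq_left.loop.seq_right
      · rw [State.nat_setReg, if_pos rfl]
        simp [NatExpr.eval, hs''.frame.nat r hp, hn])
    (by
      rintro s' ⟨hf, hn, hi'⟩
      simp [Test.Holds, NatExpr.eval, hn, hbnd s' hf])
  exact ⟨s', (Runs.setNat s r (.const 0)).seq hY hs', h3⟩

/-- `acc := ∑ r < bnd, e` -/
def sumLoop (r : ℕ) (bnd : NatExpr) (acc : ℕ) (e : RealExpr) : Prog :=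
  .seq (wr acc (.const 0) (.ofNat (.const 0)))
    (forLoop r bnd (wr acc (.const 0) (.add (rd acc (.const 0)) e)))

theorem exists_runs_sumLoop {r : ℕ} {bnd : NatExpr} {acc : ℕ} {e : RealExpr} (hY : 1 ≤ Y)
    (s : State) (v : ℕ → ℝ) {b : ℕ} (hb : b ≤ Y) (hacc : acc < 64)
    (hbnd : ∀ s', Frame (sumLoop r bnd acc e) s s' → bnd.eval s' = b)
    (he : ∀ i < b, ∀ s', Frame (sumLoop r bnd acc e) s s' → s'.nat r = i → e.eval s' = v i) :
    ∃ s', Runs o Y (sumLoop r bnd acc e) s s' ∧ s'.arr acc 0 = ∑ i ∈ Finset.range b, v i := by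
  have h1 := Runs.wr (o := o) (Y := Y) s acc (.const 0) (.ofNat (.const 0))
  have hz : Frame (sumLoop r bnd acc e) s (s.setArr acc 0 0) := by
    simpa [NatExpr.eval, RealExpr.eval, sumLoop] using h1.frame.seq_left
      (q := forLoop r bnd (wr acc (.const 0) (.add (rd acc (.const 0)) e)))
  obtain ⟨s', hs', hI⟩ := exists_runs_forLoop (o := o) (r := r) (bnd := bnd)
    (p := wr acc (.const 0) (.add (rd acc (.const 0)) e)) hY
    (fun i s' => s'.arr acc 0 = ∑ i ∈ Finset.range i, v i) (fun _ _ _ h => h) hb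
    (s := s.setArr acc 0 0) rfl
    (fun s' hf => hbnd s' (hz.trans hf.seq_right))
    (by simp [State.arr_setArr _ hacc hacc])
    (by
      intro i hi s' hf hr hI
      refine ⟨_, Runs.wr s' _ _ _, ?_⟩
      have hf' : Frame (sumLoop r bnd acc e) s s' :=
        hz.trans hf.seq_right
      simp [State.arr_setArr _ hacc hacc, NatExpr.eval, RealExpr.eval, he i hi s' hf' hr, hI,
        Finset.sum_range_succ])
  refine ⟨s', h1.seq hY (by simpa [NatExpr.eval, RealExpr.eval] using hs'), hI⟩

/-- `for r < bnd do a[idx] := e` -/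
def mapLoop (r : ℕ) (bnd : NatExpr) (a : ℕ) (idx : NatExpr) (e : RealExpr) : Prog :=
  forLoop r bnd (wr a idx e)

theorem exists_runs_mapLoop {r : ℕ} {bnd : NatExpr} {a : ℕ} {idx : NatExpr} {e : RealExpr}
    (hY : 1 ≤ Y) (s : State) (ix : ℕ → ℕ) (v : ℕ → ℝ) {b : ℕ} (hb : b ≤ Y) (ha : a < 64)
    (hinj : ∀ i < b, ∀ j < b, ix i = ix j → i = j)
    (hbnd : ∀ s', Frame (mapLoop r bnd a idx e) s s' → bnd.eval s' = b)
    (hidx : ∀ i < b, ∀ s', Frame (mapLoop r bnd a idx e) s s' → s'.nat r = i →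
      idx.eval s' = ix i)
    (he : ∀ i < b, ∀ s', Frame (mapLoop r bnd a idx e) s s' → s'.nat r = i →
      (∀ j, (∀ i' < i, j ≠ ix i') → s'.arr a j = s.arr a j) → e.eval s' = v i) :
    ∃ s', Runs o Y (mapLoop r bnd a idx e) s s' ∧ (∀ i < b, s'.arr a (ix i) = v i) ∧
      ∀ j, (∀ i < b, j ≠ ix i) → s'.arr a j = s.arr a j := by
  refine exists_runs_forLoop (o := o) hY
    (fun i s' => (∀ i' < i, s'.arr a (ix i') = v i') ∧
      ∀ j, (∀ i' < i, j ≠ ix i') → s'.arr a j = s.arr a j) (fun _ _ _ h => h) hb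
    (s := s) rfl hbnd ⟨by simp, by simp⟩ ?_
  rintro i hi s' hf hr ⟨h1, h2⟩
  refine ⟨_, Runs.wr s' _ _ _, ?_, ?_⟩
  · intro i' hi'
    rw [State.arr_setArr _ ha ha, hidx i hi s' hf hr, he i hi s' hf hr h2]
    rcases Nat.lt_succ_iff_lt_or_eq.mp hi' with h | rfl
    · rw [if_neg, h1 i' h]
      rintro ⟨-, h'⟩
      exact absurd (hinj i' (h.trans hi) i hi h') h.ne
    · simp
  · intro j hj
    rw [State.arr_setArr _ ha ha, hidx i hi s' hf hr, if_neg, h2 j fun i' hi' => hj i' (by omega)]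
    rintro ⟨-, h'⟩
    exact hj i (by omega) h'

/-- `r := ⌈e⌉` -/
def ceilLoop (r : ℕ) (e : RealExpr) : Prog :=
  .seq (.setNat r (.const 0))
    (.loop (.realLt (.ofNat (.reg r)) e) (.setNat r (.add (.reg r) (.const 1))))

theorem exists_runs_ceilLoop {r : ℕ} {e : RealExpr} (hY : 1 ≤ Y) (s : State) (v : ℝ)
    (hb : ⌈v⌉₊ ≤ Y) (he : ∀ s', Frame (ceilLoop r e) s s' → e.eval s' = v) :
    ∃ s', Runs o Y (ceilLoop r e) s s' ∧ s'.nat r = ⌈v⌉₊ := by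
  have hr : ∀ s v, Frame (ceilLoop r e) s (s.setReg r v) := by
    intro s v
    refine ⟨fun _ _ => rfl, fun r' hr' => ?_, fun _ => rfl, fun _ => rfl⟩
    rw [State.nat_setReg, if_neg]
    rintro rfl
    simp [ceilLoop, Prog.writesReg] at hr'
  obtain ⟨s', hs', -, h2⟩ := exists_runs_loop (o := o)
    (c := .realLt (.ofNat (.reg r)) e) (p := .setNat r (.add (.reg r) (.const 1))) hY
    (fun i s' => Frame (ceilLoop r e) s s' ∧ s'.nat r = i) hb (s := s.setReg r 0)
    ⟨hr s 0, by simp [State.nat_setReg]⟩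
    (by
      rintro i hi s' ⟨hf, hn⟩
      refine ⟨?_, _, Runs.setNat s' r _, hf.trans (hr _ _), ?_⟩
      · simpa [Test.Holds, RealExpr.eval, NatExpr.eval, hn, he s' hf] using Nat.lt_ceil.mp hi
      · simp [State.nat_setReg, NatExpr.eval, hn])
    (by
      rintro s' ⟨hf, hn⟩
      simpa [Test.Holds, RealExpr.eval, NatExpr.eval, hn, he s' hf] using Nat.le_ceil v)
  exact ⟨s', (Runs.setNat s r (.const 0)).seq hY hs', h2⟩

end RealRAM

/-! ## Robust regression over the reals -/

namespace RobustRegression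

open Finset

/-- The sign of `x`. -/
noncomputable def sgn (x : ℝ) : ℝ := x / |x|

theorem sgn_mul_self (x : ℝ) : sgn x * x = |x| := by
  unfold sgn
  rcases eq_or_ne x 0 with rfl | hx
  · simp
  · have : |x| ≠ 0 := abs_ne_zero.mpr hx
    field_simp
    exact (sq_abs x).symm

theorem abs_sgn_le (x : ℝ) : |sgn x| ≤ 1 := by
  unfold sgn
  rw [abs_div, abs_abs]
  exact div_self_le_one _

theorem abs_add_sgn_mul_le (x z : ℝ) : |x| + sgn x * (z - x) ≤ |z| := by
  have h1 := sgn_mul_self x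
  have h2 : sgn x * z ≤ |z| := by
    calc sgn x * z ≤ |sgn x * z| := le_abs_self _
      _ = |sgn x| * |z| := abs_mul _ _
      _ ≤ 1 * |z| := mul_le_mul_of_nonneg_right (abs_sgn_le x) (abs_nonneg z)
      _ = |z| := one_mul _
  linarith [mul_sub (sgn x) z x]

/-- The value at the sample `r` of the function with coefficients `c`. -/
def rowVal (d : ℕ) (A : ℕ → ℕ → ℝ) (c : ℕ → ℝ) (r : ℕ) : ℝ := ∑ l ∈ range d, A r l * c l

def l1 (d : ℕ) (c : ℕ → ℝ) : ℝ := ∑ l ∈ range d, |c l|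

/-- The penalized least absolute deviation. -/
noncomputable def obj (m d : ℕ) (N lam : ℝ) (A : ℕ → ℕ → ℝ) (y : ℕ → ℝ) (c : ℕ → ℝ) : ℝ :=
  (∑ r ∈ range m, |rowVal d A c r - y r|) / N + lam * l1 d c

noncomputable def grad (m d : ℕ) (N lam : ℝ) (A : ℕ → ℕ → ℝ) (y : ℕ → ℝ) (c : ℕ → ℝ) (l : ℕ) : ℝ :=
  (∑ r ∈ range m, A r l * sgn (rowVal d A c r - y r)) / N + lam * sgn (c l)

theorem rowVal_congr {d : ℕ} {A A' : ℕ → ℕ → ℝ} {c c' : ℕ → ℝ} {r : ℕ}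
    (h : ∀ l < d, A r l * c l = A' r l * c' l) : rowVal d A c r = rowVal d A' c' r :=
  sum_congr rfl fun l hl => h l (mem_range.mp hl)

theorem rowVal_sub (d : ℕ) (A : ℕ → ℕ → ℝ) (c c' : ℕ → ℝ) (r : ℕ) :
    rowVal d A (fun l => c l - c' l) r = rowVal d A c r - rowVal d A c' r := by
  simp [rowVal, mul_sub]

theorem rowVal_sub_rowVal (d : ℕ) (A : ℕ → ℕ → ℝ) (c c' : ℕ → ℝ) (r : ℕ) :
    rowVal d A c r - rowVal d A c' r = ∑ l ∈ range d, A r l * (c l - c' l) :=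
  (rowVal_sub d A c c' r).symm

theorem abs_rowVal_le {d : ℕ} {A : ℕ → ℕ → ℝ} {c : ℕ → ℝ} {r : ℕ} (hA : ∀ l < d, |A r l| ≤ 1) :
    |rowVal d A c r| ≤ l1 d c := by
  refine (abs_sum_le_sum_abs _ _).trans (sum_le_sum fun l hl => ?_)
  rw [abs_mul]
  exact mul_le_of_le_one_left (abs_nonneg _) (hA l (mem_range.mp hl))

section Subgradient

variable {m d : ℕ} {N lam : ℝ} {A : ℕ → ℕ → ℝ} {y : ℕ → ℝ}

theorem obj_add_grad_le (hN : 0 ≤ N) (hlam : 0 ≤ lam) (c f : ℕ → ℝ) :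
    obj m d N lam A y c + ∑ l ∈ range d, grad m d N lam A y c l * (f l - c l) ≤
      obj m d N lam A y f := by
  have h1 : ∑ l ∈ range d, grad m d N lam A y c l * (f l - c l) =
      (∑ r ∈ range m, sgn (rowVal d A c r - y r) * (rowVal d A f r - rowVal d A c r)) / N +
        lam * ∑ l ∈ range d, sgn (c l) * (f l - c l) := by
    simp only [grad, add_mul, sum_add_distrib]
    congr 1
    · simp only [rowVal_sub_rowVal d A f c, mul_sum, sum_div, sum_mul]
      rw [sum_comm]
      refine sum_congr rfl fun r _ => sum_congr rfl fun l _ => by ring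
    · rw [mul_sum]
      exact sum_congr rfl fun l _ => by ring
  rw [h1]
  unfold obj
  have h2 : (∑ r ∈ range m, |rowVal d A c r - y r|) / N +
      (∑ r ∈ range m, sgn (rowVal d A c r - y r) * (rowVal d A f r - rowVal d A c r)) / N ≤
      (∑ r ∈ range m, |rowVal d A f r - y r|) / N := by
    rw [← add_div, ← sum_add_distrib]
    refine div_le_div_of_nonneg_right (sum_le_sum fun r _ => ?_) hN
    have := abs_add_sgn_mul_le (rowVal d A c r - y r) (rowVal d A f r - y r)
    simpa using this
  have h3 : lam * l1 d c + lam * ∑ l ∈ range d, sgn (c l) * (f l - c l) ≤ lam * l1 d f := by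
    rw [← mul_add]
    refine mul_le_mul_of_nonneg_left ?_ hlam
    unfold l1
    rw [← sum_add_distrib]
    exact sum_le_sum fun l _ => abs_add_sgn_mul_le _ _
  linarith

theorem abs_grad_le (hN : 0 < N) (hm : (m : ℝ) = 2 * N) (hlam : 0 ≤ lam) (hlam' : lam ≤ 1)
    (c : ℕ → ℝ) {l : ℕ} (hA : ∀ r < m, |A r l| ≤ 1) : |grad m d N lam A y c l| ≤ 3 := by
  have h1 : |∑ r ∈ range m, A r l * sgn (rowVal d A c r - y r)| ≤ m := by
    refine (abs_sum_le_sum_abs _ _).trans ?_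
    calc _ ≤ ∑ r ∈ range m, (1 : ℝ) := sum_le_sum fun r hr => by
          rw [abs_mul]
          exact mul_le_one₀ (hA r (mem_range.mp hr)) (abs_nonneg _) (abs_sgn_le _)
      _ = m := by simp
  have h2 : |(∑ r ∈ range m, A r l * sgn (rowVal d A c r - y r)) / N| ≤ 2 := by
    rw [abs_div, abs_of_pos hN, div_le_iff₀ hN]
    linarith
  have h3 : |lam * sgn (c l)| ≤ 1 := by
    rw [abs_mul, abs_of_nonneg hlam]
    exact mul_le_one₀ hlam' (abs_nonneg _) (abs_sgn_le _)
  exact (abs_add_le _ _).trans (by linarith)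

/-- The current point of a subgradient descent, the best point seen so far and its objective. -/
structure Descent where
  cur : ℕ → ℝ
  best : ℕ → ℝ
  val : ℝ

variable (m d N lam A y) in
open Classical in
noncomputable def descentStep (step : ℝ) (x : Descent) : Descent where
  cur := fun l => x.cur l - step * grad m d N lam A y x.cur l
  best := if obj m d N lam A y x.cur < x.val then x.cur else x.best
  val := if obj m d N lam A y x.cur < x.val then obj m d N lam A y x.cur else x.val

variable (m d N lam A y) in
noncomputable def descent (step : ℝ) (x : Descent) (T : ℕ) : Descent :=
  (descentStep m d N lam A y step)^[T] x

variable (step : ℝ) (x : Descent)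

theorem descent_succ (T : ℕ) : descent m d N lam A y step x (T + 1) =
    descentStep m d N lam A y step (descent m d N lam A y step x T) :=
  Function.iterate_succ_apply' _ _ _

theorem descent_val_succ_le (T : ℕ) : (descent m d N lam A y step x (T + 1)).val ≤
    (descent m d N lam A y step x T).val := by
  rw [descent_succ, descentStep]
  dsimp only
  split_ifs with h
  · exact h.le
  · exact le_rfl

theorem descent_val_anti {T T' : ℕ} (h : T ≤ T') : (descent m d N lam A y step x T').val ≤
    (descent m d N lam A y step x T).val :=
  antitone_nat_of_succ_le (f := fun T => (descent m d N lam A y step x T).val)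
    (fun T => descent_val_succ_le step x T) h

theorem descent_val_le_obj {t T : ℕ} (h : t < T) : (descent m d N lam A y step x T).val ≤
    obj m d N lam A y (descent m d N lam A y step x t).cur := by
  refine (descent_val_anti step x (Nat.succ_le_of_lt h)).trans ?_
  rw [Nat.succ_eq_add_one, descent_succ, descentStep]
  dsimp only
  split_ifs with h
  · exact le_rfl
  · exact not_lt.mp h

theorem descent_val_eq (h : x.val = obj m d N lam A y x.best) (T : ℕ) :
    (descent m d N lam A y step x T).val =
      obj m d N lam A y (descent m d N lam A y step x T).best := by
  induction T with
  | zero => exact h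
  | succ T ih =>
    rw [descent_succ, descentStep]
    dsimp only
    split_ifs
    · rfl
    · exact ih

theorem descent_supp {S : ℕ → Prop} (hA : ∀ r l, ¬ S l → A r l = 0)
    (hc : ∀ l, ¬ S l → x.cur l = 0) (hb : ∀ l, ¬ S l → x.best l = 0) (T : ℕ) {l : ℕ} (hl : ¬ S l) :
    (descent m d N lam A y step x T).cur l = 0 ∧ (descent m d N lam A y step x T).best l = 0 := by
  induction T with
  | zero => exact ⟨hc l hl, hb l hl⟩
  | succ T ih =>
    rw [descent_succ, descentStep]
    dsimp only
    refine ⟨by simp [grad, ih.1, hA _ _ hl, sgn], ?_⟩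
    split_ifs
    · exact ih.1
    · exact ih.2

theorem descent_converges (hN : 0 < N) (hm : (m : ℝ) = 2 * N) (hlam : 0 ≤ lam) (hlam' : lam ≤ 1)
    (hA : ∀ r < m, ∀ l < d, |A r l| ≤ 1) (hd : 0 < d) {xi : ℝ} (hxi : 0 < xi)
    (hstep : step = xi / (9 * d)) (f : ℕ → ℝ) {T : ℕ} (hT : 0 < T)
    (hdist : (∑ l ∈ range d, (x.cur l - f l) ^ 2) * (9 * d) ≤ T * xi ^ 2) :
    (descent m d N lam A y step x T).val ≤ obj m d N lam A y f + xi := by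
  by_contra! hcon
  have hd' : (0 : ℝ) < 9 * d := by positivity
  have hs : 0 < step := by rw [hstep]; positivity
  have key : ∀ t ≤ T, (∑ l ∈ range d, ((descent m d N lam A y step x t).cur l - f l) ^ 2) +
      t * (xi ^ 2 / (9 * d)) ≤ ∑ l ∈ range d, (x.cur l - f l) ^ 2 ∧
      (0 < t → (∑ l ∈ range d, ((descent m d N lam A y step x t).cur l - f l) ^ 2) +
      t * (xi ^ 2 / (9 * d)) < ∑ l ∈ range d, (x.cur l - f l) ^ 2) := by
    intro t
    induction t with
    | zero => intro _; simp [descent]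
    | succ t ih =>
      intro ht
      have ih := (ih (by omega)).1
      set c := (descent m d N lam A y step x t).cur with hc
      have h1 : obj m d N lam A y f + xi < obj m d N lam A y c :=
        hcon.trans_le (descent_val_le_obj step x (by omega))
      have h2 := obj_add_grad_le (m := m) (d := d) (A := A) (y := y) hN.le hlam c f
      set g := grad m d N lam A y c with hg
      have h3 : ∑ l ∈ range d, (c l - step * g l - f l) ^ 2 =
          ∑ l ∈ range d, (c l - f l) ^ 2 + 2 * step * ∑ l ∈ range d, g l * (f l - c l) +
            step ^ 2 * ∑ l ∈ range d, g l ^ 2 := by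
        simp only [mul_sum, ← sum_add_distrib]
        exact sum_congr rfl fun l _ => by ring
      have h4 : ∑ l ∈ range d, g l ^ 2 ≤ 9 * d := by
        calc ∑ l ∈ range d, g l ^ 2 ≤ ∑ l ∈ range d, (9 : ℝ) := sum_le_sum fun l hl => by
              have h := abs_grad_le (d := d) (A := A) (y := y) (l := l) hN hm hlam hlam' c
                fun r hr => hA r hr l (mem_range.mp hl)
              rw [← sq_abs, ← hg] at *
              nlinarith [abs_nonneg (g l)]
          _ = 9 * d := by simp [mul_comm]
      have h5 : 2 * step * ∑ l ∈ range d, g l * (f l - c l) < 2 * step * (-xi) :=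
        mul_lt_mul_of_pos_left (by linarith) (by positivity)
      have h6 : step ^ 2 * ∑ l ∈ range d, g l ^ 2 ≤ step ^ 2 * (9 * d) :=
        mul_le_mul_of_nonneg_left h4 (by positivity)
      have h7 : 2 * step * (-xi) + step ^ 2 * (9 * d) = - (xi ^ 2 / (9 * d)) := by
        rw [hstep]; field_simp; ring
      have h8 : ∑ l ∈ range d, ((descent m d N lam A y step x (t + 1)).cur l - f l) ^ 2 =
          ∑ l ∈ range d, (c l - step * g l - f l) ^ 2 := by
        rw [descent_succ]; rfl
      rw [h8, h3]
      push_cast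
      exact ⟨by linarith, fun _ => by linarith⟩
  have h := (key T le_rfl).2 hT
  have h0 : 0 ≤ ∑ l ∈ range d, ((descent m d N lam A y step x T).cur l - f l) ^ 2 :=
    sum_nonneg fun l _ => sq_nonneg _
  have : T * xi ^ 2 / (9 * d) < ∑ l ∈ range d, (x.cur l - f l) ^ 2 := by
    rw [mul_div_assoc]; linarith
  rw [div_lt_iff₀ hd'] at this
  linarith

end Subgradient

/-! ### Weighted least squares by Gram-Schmidt orthogonalization -/

section GramSchmidt

variable (m : ℕ) (w : ℕ → ℝ)

def wip (u v : ℕ → ℝ) : ℝ := ∑ r ∈ range m, w r * u r * v r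

/-- Columns: sampled values and coefficients. -/
structure Columns where
  samp : ℕ → ℕ → ℝ
  coef : ℕ → ℕ → ℝ

/-- The multiple of column `l` that is subtracted from column `j` when `l` is eliminated. -/
noncomputable def gsCoeff (V : ℕ → ℕ → ℝ) (l j : ℕ) : ℝ :=
  wip m w (V j) (V l) / wip m w (V l) (V l) * ((1 - (1 - (j - l)) : ℕ) : ℝ)

noncomputable def gsStep (x : Columns) (l : ℕ) : Columns where
  samp := fun j r => x.samp j r - gsCoeff m w x.samp l j * x.samp l r
  coef := fun j i => x.coef j i - gsCoeff m w x.samp l j * x.coef l i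

noncomputable def gs (x : Columns) : ℕ → Columns
  | 0 => x
  | l + 1 => gsStep m w (gs x l) l

variable {m w}

theorem gsCoeff_of_lt (V : ℕ → ℕ → ℝ) {l j : ℕ} (h : l < j) :
    gsCoeff m w V l j = wip m w (V j) (V l) / wip m w (V l) (V l) := by
  rw [gsCoeff, show 1 - (1 - (j - l)) = 1 by omega]; simp

theorem gsCoeff_of_le (V : ℕ → ℕ → ℝ) {l j : ℕ} (h : j ≤ l) : gsCoeff m w V l j = 0 := by
  rw [gsCoeff, show 1 - (1 - (j - l)) = 0 by omega]; simp

theorem wip_sub_mul (u v v' : ℕ → ℝ) (a : ℝ) :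
    wip m w (fun r => u r - a * v r) v' = wip m w u v' - a * wip m w v v' := by
  simp only [wip, mul_sum, ← sum_sub_distrib]
  exact sum_congr rfl fun r _ => by ring

theorem wip_comm (u v : ℕ → ℝ) : wip m w u v = wip m w v u :=
  sum_congr rfl fun r _ => by ring

theorem wip_eq_zero_of_self (hw : ∀ r, 0 ≤ w r) {v : ℕ → ℝ} (h : wip m w v v = 0) (u : ℕ → ℝ) :
    wip m w u v = 0 := by
  have h1 := (sum_eq_zero_iff_of_nonneg (s := range m) (f := fun r => w r * v r * v r)
    fun r _ => by nlinarith [mul_nonneg (hw r) (mul_self_nonneg (v r))]).mp h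
  refine sum_eq_zero fun r hr => ?_
  have h2 := h1 r hr
  rw [mul_assoc, mul_eq_zero, mul_self_eq_zero] at h2
  rcases h2 with h2 | h2 <;> simp [h2]

theorem gs_samp_of_le (x : Columns) {l j : ℕ} (h : j ≤ l) :
    (gs m w x (l + 1)).samp j = (gs m w x l).samp j := by
  funext r
  simp [gs, gsStep, gsCoeff_of_le _ h]

theorem gs_orthogonal (hw : ∀ r, 0 ≤ w r) (x : Columns) (l : ℕ) :
    ∀ i < l, ∀ j ≥ l, wip m w ((gs m w x l).samp j) ((gs m w x l).samp i) = 0 := by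
  induction l with
  | zero => intro i hi; omega
  | succ l ih =>
    intro i hi j hj
    rw [gs_samp_of_le x (Nat.lt_succ_iff.mp hi)]
    have h1 : (gs m w x (l + 1)).samp j = fun r => (gs m w x l).samp j r -
        gsCoeff m w (gs m w x l).samp l j * (gs m w x l).samp l r := rfl
    rw [h1, wip_sub_mul, gsCoeff_of_lt _ (by omega : l < j)]
    rcases Nat.lt_succ_iff_lt_or_eq.mp hi with h | rfl
    · rw [ih i h j (by omega), ih i h l le_rfl]; simp
    · by_cases h0 : wip m w ((gs m w x i).samp i) ((gs m w x i).samp i) = 0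
      · rw [h0, wip_eq_zero_of_self hw h0]; simp
      · rw [div_mul_cancel₀ _ h0, sub_self]

theorem gs_perp (x : Columns) (l : ℕ) (u : ℕ → ℝ) (d : ℕ) (hl : l ≤ d)
    (h : ∀ i < d, wip m w ((gs m w x l).samp i) u = 0) : ∀ i < d, wip m w (x.samp i) u = 0 := by
  induction l with
  | zero => exact h
  | succ l ih =>
    refine ih (by omega) fun i hi => ?_
    have h1 := h i hi
    have h2 := h l (by omega)
    rw [gs_samp_of_le x le_rfl] at h2
    have h3 : (gs m w x (l + 1)).samp i = fun r => (gs m w x l).samp i r -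
        gsCoeff m w (gs m w x l).samp l i * (gs m w x l).samp l r := rfl
    rw [h3, wip_sub_mul, h2, mul_zero, sub_zero] at h1
    exact h1

/-- The initial columns: the columns of `A` and, as the column with index `d`, the data `y`. -/
def gsInit (d : ℕ) (A : ℕ → ℕ → ℝ) (y : ℕ → ℝ) : Columns where
  samp := fun j r => if j < d then A r j else y r
  coef := fun j i => ((1 - ((i - j) + (j - i)) : ℕ) : ℝ)

theorem gs_rowVal (d : ℕ) (A : ℕ → ℕ → ℝ) (y : ℕ → ℝ) (l : ℕ) (hl : l ≤ d) :
    ∀ j ≤ d, ∀ r, (gs m w (gsInit d A y) l).samp j r =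
      (if j < d then 0 else y r) + rowVal d A ((gs m w (gsInit d A y) l).coef j) r := by
  induction l with
  | zero =>
    intro j hj r
    have h0 : ∀ i < d, (gsInit d A y).coef j i = if i = j then 1 else 0 := by
      intro i _
      simp only [gsInit]
      split_ifs with h
      · subst h; simp
      · rw [show 1 - ((i - j) + (j - i)) = 0 by omega]; simp
    have h1 : rowVal d A ((gsInit d A y).coef j) r = if j < d then A r j else 0 := by
      unfold rowVal
      rw [sum_congr rfl fun i hi => by rw [h0 i (mem_range.mp hi)]]
      simp
    rw [gs, h1]
    simp only [gsInit]
    split_ifs <;> simp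
  | succ l ih =>
    intro j hj r
    have h1 : (gs m w (gsInit d A y) (l + 1)).samp j r = (gs m w (gsInit d A y) l).samp j r -
        gsCoeff m w (gs m w (gsInit d A y) l).samp l j * (gs m w (gsInit d A y) l).samp l r := rfl
    have h2 : rowVal d A ((gs m w (gsInit d A y) (l + 1)).coef j) r =
        rowVal d A ((gs m w (gsInit d A y) l).coef j) r -
        gsCoeff m w (gs m w (gsInit d A y) l).samp l j *
          rowVal d A ((gs m w (gsInit d A y) l).coef l) r := by
      simp only [rowVal, gs, gsStep, mul_sum, ← sum_sub_distrib]
      exact sum_congr rfl fun i _ => by ring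
    rw [h1, h2, ih (by omega) j hj, ih (by omega) l (by omega), if_pos (by omega : l < d)]
    ring

variable (m w) in
/-- The weighted least squares solution. -/
noncomputable def lsCoef (d : ℕ) (A : ℕ → ℕ → ℝ) (y : ℕ → ℝ) (i : ℕ) : ℝ :=
  0 - (gs m w (gsInit d A y) d).coef d i

variable (m w) in
noncomputable def lsRes (d : ℕ) (A : ℕ → ℕ → ℝ) (y : ℕ → ℝ) (r : ℕ) : ℝ :=
  (gs m w (gsInit d A y) d).samp d r

theorem lsRes_eq (d : ℕ) (A : ℕ → ℕ → ℝ) (y : ℕ → ℝ) (r : ℕ) :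
    lsRes m w d A y r = y r - rowVal d A (lsCoef m w d A y) r := by
  rw [lsRes, gs_rowVal d A y d le_rfl d le_rfl, if_neg (lt_irrefl d)]
  simp [rowVal, lsCoef]

theorem lsRes_orthogonal (hw : ∀ r, 0 ≤ w r) (d : ℕ) (A : ℕ → ℕ → ℝ) (y : ℕ → ℝ) {i : ℕ}
    (hi : i < d) : wip m w (fun r => A r i) (lsRes m w d A y) = 0 := by
  have := gs_perp (m := m) (w := w) (gsInit d A y) d (lsRes m w d A y) d le_rfl
    (fun i hi => by
      rw [wip_comm]
      exact gs_orthogonal hw _ d i hi d le_rfl) i hi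
  simpa [gsInit, hi] using this

theorem lsRes_sq_le (hw : ∀ r, 0 ≤ w r) (d : ℕ) (A : ℕ → ℕ → ℝ) (y : ℕ → ℝ) (f : ℕ → ℝ) :
    ∑ r ∈ range m, w r * lsRes m w d A y r ^ 2 ≤
      ∑ r ∈ range m, w r * (y r - rowVal d A f r) ^ 2 := by
  set ρ := lsRes m w d A y with hρ
  set c := lsCoef m w d A y with hc
  have h0 : wip m w (fun r => rowVal d A c r - rowVal d A f r) ρ = 0 := by
    have : wip m w (fun r => rowVal d A c r - rowVal d A f r) ρ =
        ∑ i ∈ range d, (c i - f i) * wip m w (fun r => A r i) ρ := by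
      simp only [wip, rowVal_sub_rowVal d A c f, mul_sum, sum_mul]
      rw [sum_comm]
      exact sum_congr rfl fun i _ => sum_congr rfl fun r _ => by ring
    rw [this]
    exact sum_eq_zero fun i hi => by rw [lsRes_orthogonal hw d A y (mem_range.mp hi), mul_zero]
  have h1 : ∑ r ∈ range m, w r * (y r - rowVal d A f r) ^ 2 = ∑ r ∈ range m, w r * ρ r ^ 2 +
      2 * wip m w (fun r => rowVal d A c r - rowVal d A f r) ρ +
      ∑ r ∈ range m, w r * (rowVal d A c r - rowVal d A f r) ^ 2 := by
    simp only [wip, mul_sum, ← sum_add_distrib]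
    refine sum_congr rfl fun r _ => ?_
    have : y r = ρ r + rowVal d A c r := by rw [hρ, lsRes_eq]; ring
    rw [this]; ring
  rw [h1, h0]
  have : 0 ≤ ∑ r ∈ range m, w r * (rowVal d A c r - rowVal d A f r) ^ 2 :=
    sum_nonneg fun r _ => mul_nonneg (hw r) (sq_nonneg _)
  linarith

end GramSchmidt

end RobustRegression

namespace RobustRegression

open Finset

/-- On the functions supported in `U`, the good samples outweigh the bad ones; here `nu` is a norm
that dominates all coefficients. -/
structure Robust (m d N : ℕ) (A : ℕ → ℕ → ℝ) (δ t : ℝ) (good : ℕ → Prop) [DecidablePred good]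
    (nu : (ℕ → ℝ) → ℝ) (U : ℕ → Prop) : Prop where
  nonneg : ∀ h, 0 ≤ nu h
  main : ∀ h : ℕ → ℝ, (∀ l, ¬ U l → h l = 0) → 2 * δ * nu h - t * l1 d h ≤
    (∑ r ∈ range m, if good r then |rowVal d A h r| else -|rowVal d A h r|) / N
  coord : ∀ h : ℕ → ℝ, (∀ l, ¬ U l → h l = 0) → ∀ l < d, |h l| ≤ nu h

theorem obj_zero (m d : ℕ) (N lam : ℝ) (A : ℕ → ℕ → ℝ) (y : ℕ → ℝ) :
    obj m d N lam A y (fun _ => 0) = (∑ r ∈ range m, |y r|) / N := by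
  simp [obj, rowVal, l1]

theorem obj_nonneg {m d : ℕ} {N lam : ℝ} (hN : 0 ≤ N) (hlam : 0 ≤ lam) (A : ℕ → ℕ → ℝ)
    (y c : ℕ → ℝ) : 0 ≤ obj m d N lam A y c :=
  add_nonneg (div_nonneg (sum_nonneg fun _ _ => abs_nonneg _) hN)
    (mul_nonneg hlam (sum_nonneg fun _ _ => abs_nonneg _))

section

variable {m d N k q : ℕ} {A : ℕ → ℕ → ℝ} {y : ℕ → ℝ} {δ t : ℝ} {good : ℕ → Prop}
  [DecidablePred good] {nu : (ℕ → ℝ) → ℝ} {U : ℕ → Prop} {S : Finset ℕ}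

theorem Robust.sum_abs_le (R : Robust m d N A δ t good nu U) (hS : S ⊆ range d)
    (hk : S.card ≤ 2 * k) {h : ℕ → ℝ} (hU : ∀ l, ¬ U l → h l = 0) :
    ∑ l ∈ S, |h l| ≤ 2 * k * nu h := by
  calc ∑ l ∈ S, |h l| ≤ ∑ l ∈ S, nu h :=
        sum_le_sum fun l hl => R.coord h hU l (mem_range.mp (hS hl))
    _ = S.card * nu h := by simp
    _ ≤ 2 * k * nu h := by
      refine mul_le_mul_of_nonneg_right ?_ (R.nonneg h)
      exact_mod_cast hk

theorem Robust.sum_sq_le (R : Robust m d N A δ t good nu U) (hS : S ⊆ range d)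
    (hk : S.card ≤ 2 * k) {h : ℕ → ℝ} (hU : ∀ l, ¬ U l → h l = 0) (hh : ∀ l, l ∉ S → h l = 0) :
    ∑ l ∈ range d, h l ^ 2 ≤ 2 * k * nu h ^ 2 := by
  calc ∑ l ∈ range d, h l ^ 2 = ∑ l ∈ S, h l ^ 2 :=
        (sum_subset hS fun l _ hl => by rw [hh l hl]; simp).symm
    _ ≤ ∑ l ∈ S, nu h ^ 2 := sum_le_sum fun l hl =>
        sq_le_sq' (abs_le.mp (R.coord h hU l (mem_range.mp (hS hl)))).1
          (abs_le.mp (R.coord h hU l (mem_range.mp (hS hl)))).2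
    _ = S.card * nu h ^ 2 := by simp
    _ ≤ 2 * k * nu h ^ 2 := by
      refine mul_le_mul_of_nonneg_right ?_ (sq_nonneg _)
      exact_mod_cast hk

theorem l1_eq_sum (hS : S ⊆ range d) {h : ℕ → ℝ} (hh : ∀ l, l ∉ S → h l = 0) :
    l1 d h = ∑ l ∈ S, |h l| :=
  (sum_subset hS fun l _ hl => by rw [hh l hl]; simp).symm

theorem Robust.le_sum_good (R : Robust m d N A δ t good nu U) (hS : S ⊆ range d)
    (hk : S.card ≤ 2 * k) (hSU : ∀ l ∈ S, U l) (ht : 0 ≤ t) (hkt : 4 * k * t ≤ δ)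
    {h : ℕ → ℝ} (hh : ∀ l, l ∉ S → h l = 0) {e : ℝ} (he : 0 ≤ e)
    (hgood : ∀ r < m, good r → |rowVal d A h r| ≤ e) : δ * nu h ≤ m * e / N := by
  have hU : ∀ l, ¬ U l → h l = 0 := fun l hl => hh l fun h' => hl (hSU l h')
  have h1 := R.main h hU
  have h2 := R.sum_abs_le hS hk hU
  rw [← l1_eq_sum hS hh] at h2
  have h3 : (∑ r ∈ range m, if good r then |rowVal d A h r| else -|rowVal d A h r|) / (N : ℝ) ≤
      m * e / N := by
    refine div_le_div_of_nonneg_right ?_ (Nat.cast_nonneg N)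
    calc _ ≤ ∑ r ∈ range m, e := sum_le_sum fun r hr => by
          split_ifs with hg
          · exact hgood r (mem_range.mp hr) hg
          · linarith [abs_nonneg (rowVal d A h r)]
      _ = m * e := by simp
  have h4 : t * l1 d h ≤ t * (2 * k * nu h) := mul_le_mul_of_nonneg_left h2 ht
  have h5 : 4 * k * t * nu h ≤ δ * nu h := mul_le_mul_of_nonneg_right hkt (R.nonneg h)
  have h6 : 0 ≤ t * (2 * k * nu h) := by have := R.nonneg h; positivity
  linarith

/-- The objective has a sharp minimum at a sparse function that fits the good samples. -/
theorem Robust.sharp (R : Robust m d N A δ t good nu U) (hN : 0 < N) (hm : m = 2 * N)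
    (hS : S ⊆ range d) (hk : S.card ≤ 2 * k) (hSU : ∀ l ∈ S, U l) (ht : 0 ≤ t)
    (hkt : 4 * k * t ≤ δ) {f g : ℕ → ℝ} (hf : ∀ l, l ∉ S → f l = 0) (hg : ∀ l, ¬ U l → g l = 0)
    {e : ℝ} (he : 0 ≤ e) (hgood : ∀ r < m, good r → |rowVal d A f r - y r| ≤ e) :
    δ * nu (fun l => g l - f l) ≤ obj m d N t A y g - obj m d N t A y f + 4 * e := by
  set h : ℕ → ℝ := fun l => g l - f l with hh
  have hU : ∀ l, ¬ U l → h l = 0 := fun l hl => by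
    simp [hh, hg l hl, hf l fun h' => hl (hSU l h')]
  have h1 := R.main h hU
  have h2 := R.sum_abs_le hS hk hU
  have hN' : (0 : ℝ) < N := by exact_mod_cast hN
  have h3 : (∑ r ∈ range m, if good r then |rowVal d A h r| else -|rowVal d A h r|) / (N : ℝ) ≤
      (∑ r ∈ range m, |rowVal d A g r - y r|) / N - (∑ r ∈ range m, |rowVal d A f r - y r|) / N +
        4 * e := by
    have : 4 * e = (∑ r ∈ range m, 2 * e) / N := by
      rw [sum_const, card_range, nsmul_eq_mul, hm]; push_cast; field_simp; ring
    rw [this, ← sub_div, ← add_div, ← sum_sub_distrib, ← sum_add_distrib]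
    refine div_le_div_of_nonneg_right (sum_le_sum fun r hr => ?_) hN'.le
    rw [show rowVal d A h r = rowVal d A g r - rowVal d A f r from rowVal_sub d A g f r]
    split_ifs with hr'
    · have h4 := hgood r (mem_range.mp hr) hr'
      have h5 := abs_sub_le (rowVal d A g r) (y r) (rowVal d A f r)
      rw [abs_sub_comm (y r)] at h5
      linarith
    · have h5 := abs_sub_le (y r) (rowVal d A g r) (rowVal d A f r)
      have h6 := abs_sub_comm (y r) (rowVal d A g r)
      have h7 := abs_sub_comm (y r) (rowVal d A f r)
      linarith
  have h4 : l1 d h - 2 * ∑ l ∈ S, |h l| ≤ l1 d g - l1 d f := by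
    have : ∑ l ∈ S, |h l| = ∑ l ∈ range d, if l ∈ S then |h l| else 0 := by
      rw [sum_ite_mem, inter_eq_right.mpr hS]
    rw [this, l1, l1, l1, mul_sum, ← sum_sub_distrib, ← sum_sub_distrib]
    refine sum_le_sum fun l _ => ?_
    by_cases hl : l ∈ S
    · rw [if_pos hl]
      have h5 := abs_sub_abs_le_abs_sub (f l) (g l)
      rw [abs_sub_comm] at h5
      change |g l - f l| - 2 * |g l - f l| ≤ _
      linarith
    · rw [if_neg hl]
      simp [hh, hf l hl]
  have h5 := mul_le_mul_of_nonneg_left h4 ht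
  have h6 := mul_le_mul_of_nonneg_left h2 ht
  have h7 : 4 * k * t * nu h ≤ δ * nu h := mul_le_mul_of_nonneg_right hkt (R.nonneg h)
  unfold obj
  linarith

/-- Parameters of the algorithm. -/
noncomputable def lamOf (k q : ℕ) : ℝ := 1 / (4 * k * q)

theorem lamOf_nonneg : 0 ≤ lamOf k q := by unfold lamOf; positivity

theorem four_mul_lamOf_le (hk : 0 < k) (hδ : 0 < δ) (hq : 1 / δ ≤ q) :
    4 * k * lamOf k q ≤ δ := by
  have hk' : (0 : ℝ) < k := by exact_mod_cast hk
  have hq' : (0 : ℝ) < q := lt_of_lt_of_le (by positivity) hq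
  have : 4 * k * lamOf k q = 1 / q := by unfold lamOf; field_simp
  rw [this]
  exact (one_div_le hδ hq').mp hq

theorem lamOf_le_one (hk : 0 < k) (hq : 0 < q) : lamOf k q ≤ 1 := by
  have hk' : (1 : ℝ) ≤ k := by exact_mod_cast hk
  have hq' : (1 : ℝ) ≤ q := by exact_mod_cast hq
  unfold lamOf
  rw [div_le_one (by positivity)]
  nlinarith

def zeroDescent (v : ℝ) : Descent := ⟨fun _ => 0, fun _ => 0, v⟩

/-- The first stage: a descent from the origin. -/
noncomputable def coarse (m d N k q : ℕ) (η : ℝ) (R : ℕ) (A : ℕ → ℕ → ℝ) (y : ℕ → ℝ) : Descent :=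
  descent m d N (lamOf k q) A y (η / (72 * q * d))
    (zeroDescent ((∑ r ∈ range m, |y r|) / N)) (1152 * k * d * ((R + 1) * (R + 1)) * (q * q * q * q))

theorem coarse_spec (R : Robust m d N A δ (lamOf k q) good nu fun _ => True) (hN : 0 < N)
    (hm : m = 2 * N) (hS : S ⊆ range d) (hcard : S.card ≤ 2 * k) (hk : 0 < k) (hd : 0 < d)
    (hδ : 0 < δ) (hδ' : δ ≤ 1 / 2) (hq : 1 / δ ≤ q) (hA : ∀ r < m, ∀ l < d, |A r l| ≤ 1)
    {f : ℕ → ℝ} (hf : ∀ l, l ∉ S → f l = 0) {ε η : ℝ} (hε : 0 ≤ ε) (hη : 0 < η)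
    (hεη : ε ≤ 1 / 64 * η * δ) (hgood : ∀ r < m, good r → |rowVal d A f r - y r| ≤ ε)
    {R₀ : ℕ} (hR : (∑ r ∈ range m, |y r|) / N / η ≤ R₀) :
    ∀ l < d, |(coarse m d N k q η R₀ A y).best l - f l| ≤ 3 / 16 * η := by
  have hk' : (0 : ℝ) < k := by exact_mod_cast hk
  have hd' : (0 : ℝ) < d := by exact_mod_cast hd
  have hN' : (0 : ℝ) < N := by exact_mod_cast hN
  have hq' : (0 : ℝ) < q := lt_of_lt_of_le (by positivity) hq
  have hqn : 0 < q := by exact_mod_cast hq'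
  have hkt := four_mul_lamOf_le hk hδ hq
  have hδq : 1 ≤ δ * q := by rw [div_le_iff₀ hδ] at hq; linarith
  have hsh := fun g => R.sharp (y := y) (g := g) (e := ε) hN hm hS hcard (fun _ _ => trivial)
    lamOf_nonneg hkt hf (fun l hl => absurd trivial hl) hε hgood
  set M := (∑ r ∈ range m, |y r|) / (N : ℝ) with hM
  have hM0 : obj m d N (lamOf k q) A y (fun _ => 0) = M := obj_zero _ _ _ _ _ _
  have hfn := obj_nonneg (m := m) (d := d) hN'.le (lamOf_nonneg (k := k) (q := q)) A y f
  have h1 : nu (fun l => 0 - f l) ≤ q * (η * (R₀ + 1)) := by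
    have h2 := hsh fun _ => 0
    rw [hM0] at h2
    rw [div_le_iff₀ hη] at hR
    have h0 := R.nonneg fun l => 0 - f l
    have hδ1 : δ * nu (fun l => 0 - f l) ≤ η * (R₀ + 1) + (4 * ε - η) := by linarith
    have hδη : 4 * ε ≤ η := by nlinarith
    calc nu (fun l => 0 - f l) ≤ (δ * q) * nu (fun l => 0 - f l) := le_mul_of_one_le_left h0 hδq
      _ = q * (δ * nu (fun l => 0 - f l)) := by ring
      _ ≤ q * (η * (R₀ + 1)) := mul_le_mul_of_nonneg_left (by linarith) hq'.le
  have h2 : (coarse m d N k q η R₀ A y).val ≤ obj m d N (lamOf k q) A y f + η / (8 * q) := by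
    refine descent_converges (xi := η / (8 * q)) _ _ hN' (by rw [hm]; push_cast; ring)
      lamOf_nonneg (lamOf_le_one hk hqn) hA hd (by positivity) (by field_simp; norm_num) f
      (by positivity) ?_
    have h3 := R.sum_sq_le hS hcard (h := fun l => 0 - f l) (fun l hl => absurd trivial hl)
      (fun l hl => by simp [hf l hl])
    have h4 : nu (fun l => 0 - f l) ^ 2 ≤ (q * (η * (R₀ + 1))) ^ 2 :=
      pow_le_pow_left₀ (R.nonneg _) h1 2
    have h5 : ∑ l ∈ range d, ((zeroDescent M).cur l - f l) ^ 2 ≤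
        2 * k * (q * (η * (R₀ + 1))) ^ 2 :=
      h3.trans (mul_le_mul_of_nonneg_left h4 (by positivity))
    calc _ ≤ 2 * k * (q * (η * (R₀ + 1))) ^ 2 * (9 * d) :=
          mul_le_mul_of_nonneg_right h5 (by positivity)
      _ = _ := by push_cast; field_simp; ring
  have h3 : (coarse m d N k q η R₀ A y).val =
      obj m d N (lamOf k q) A y (coarse m d N k q η R₀ A y).best :=
    descent_val_eq _ _ hM0.symm _
  set g := (coarse m d N k q η R₀ A y).best with hg
  have h4 := hsh g
  have h5 : η / (8 * q) ≤ η * δ / 8 := by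
    rw [div_le_div_iff₀ (by positivity) (by norm_num)]
    nlinarith
  have h6 : δ * nu (fun l => g l - f l) ≤ δ * (3 / 16 * η) := by linarith
  have h7 := le_of_mul_le_mul_left h6 hδ
  exact fun l hl => (R.coord (fun l => g l - f l) (fun l hl => absurd trivial hl) l hl).trans h7

/-- The state of the second stage: weights of the samples, the best point and its objective. -/
structure Phase where
  wt : ℕ → ℝ
  best : ℕ → ℝ
  val : ℝ

/-- The total residual of the weighted least squares fit. -/
noncomputable def lsTotal (m d : ℕ) (A : ℕ → ℕ → ℝ) (y w : ℕ → ℝ) : ℝ :=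
  ∑ r ∈ range m, w r * |lsRes m w d A y r|

noncomputable def phaseDescent (m d N k q : ℕ) (A : ℕ → ℕ → ℝ) (y mask : ℕ → ℝ) (x : Phase) :
    Descent :=
  descent m d N (lamOf k q) A y (lsTotal m d A y x.wt / (288 * m * k * q * d))
    ⟨fun l => lsCoef m x.wt d A y l * mask l, x.best, x.val⟩
    (294912 * (k * k * k) * d * (m * m) * (q * q * q * q))

open Classical in
noncomputable def phaseStep (m d N k q : ℕ) (A : ℕ → ℕ → ℝ) (y mask : ℕ → ℝ) (x : Phase) :
    Phase where
  wt := fun r => if lsTotal m d A y x.wt / (2 * m) <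
    |rowVal d A (phaseDescent m d N k q A y mask x).best r - y r| then 0 else x.wt r
  best := (phaseDescent m d N k q A y mask x).best
  val := (phaseDescent m d N k q A y mask x).val

/-- The invariant of the second stage. -/
structure PhaseInv (m d N k q : ℕ) (A : ℕ → ℕ → ℝ) (y : ℕ → ℝ) (good : ℕ → Prop) (S : Finset ℕ)
    (f : ℕ → ℝ) (ε : ℝ) (p : ℕ) (x : Phase) : Prop where
  val_eq : x.val = obj m d N (lamOf k q) A y x.best
  supp : ∀ l, l ∉ S → x.best l = 0
  wt : ∀ r, x.wt r = 0 ∨ x.wt r = 1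
  progress : x.val ≤ obj m d N (lamOf k q) A y f + 4 * ε ∨
    ((∀ r < m, good r → x.wt r = 1) ∧ ∑ r ∈ range m, x.wt r ≤ m - p)

theorem PhaseInv.step (R : Robust m d N A δ (lamOf k q) good nu (· ∈ S)) (hN : 0 < N)
    (hm : m = 2 * N) (hS : S ⊆ range d) (hcard : S.card ≤ 2 * k) (hk : 0 < k) (hd : 0 < d)
    (hδ : 0 < δ) (hq : 1 / δ ≤ q) (hA : ∀ r < m, ∀ l < d, |A r l| ≤ 1)
    (hA0 : ∀ r l, l ∉ S → A r l = 0)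
    {f : ℕ → ℝ} (hf : ∀ l, l ∉ S → f l = 0) {ε : ℝ} (hε : 0 ≤ ε)
    (hgood : ∀ r < m, good r → |rowVal d A f r - y r| ≤ ε) {mask : ℕ → ℝ}
    (hmask : ∀ l, mask l = if l ∈ S then 1 else 0) {p : ℕ} {x : Phase}
    (hx : PhaseInv m d N k q A y good S f ε p x) :
    PhaseInv m d N k q A y good S f ε (p + 1) (phaseStep m d N k q A y mask x) := by
  have hk' : (0 : ℝ) < k := by exact_mod_cast hk
  have hk1 : (1 : ℝ) ≤ k := by exact_mod_cast hk
  have hd' : (0 : ℝ) < d := by exact_mod_cast hd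
  have hN' : (0 : ℝ) < N := by exact_mod_cast hN
  have hm0 : 0 < m := by omega
  have hm' : (0 : ℝ) < m := by exact_mod_cast hm0
  have hm1 : (1 : ℝ) ≤ m := by exact_mod_cast hm0
  have hq' : (0 : ℝ) < q := lt_of_lt_of_le (by positivity) hq
  have hqn : 0 < q := by exact_mod_cast hq'
  have hq1 : (1 : ℝ) ≤ q := by exact_mod_cast hqn
  have hkt := four_mul_lamOf_le hk hδ hq
  have hδq : 1 ≤ δ * q := by rw [div_le_iff₀ hδ] at hq; linarith
  have hw0 : ∀ r, 0 ≤ x.wt r := fun r => by rcases hx.wt r with h | h <;> simp [h]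
  set c := fun l => lsCoef m x.wt d A y l * mask l with hc
  have hcS : ∀ l, l ∉ S → c l = 0 := fun l hl => by simp [hc, hmask, hl]
  have hres : ∀ r, |rowVal d A c r - y r| = |lsRes m x.wt d A y r| := by
    intro r
    rw [lsRes_eq, abs_sub_comm]
    congr 2
    refine rowVal_congr fun l _ => ?_
    by_cases hl : l ∈ S
    · simp [hc, hmask, hl]
    · simp [hA0 r l hl]
  set D := phaseDescent m d N k q A y mask x with hD
  have hval : D.val = obj m d N (lamOf k q) A y D.best := descent_val_eq _ _ hx.val_eq _
  have hsupp : ∀ l, l ∉ S → D.best l = 0 := fun l hl =>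
    (descent_supp (S := (· ∈ S)) _ _ hA0 hcS hx.supp _ hl).2
  have hanti : D.val ≤ x.val := descent_val_anti _ _ (Nat.zero_le _)
  refine ⟨hval, hsupp, fun r => ?_, ?_⟩
  · simp only [phaseStep]
    split_ifs
    · exact Or.inl rfl
    · exact hx.wt r
  rcases hx.progress with h | ⟨hw1, hcount⟩
  · exact Or.inl (hanti.trans h)
  set τ := lsTotal m d A y x.wt with hτ
  have hτ0 : 0 ≤ τ := sum_nonneg fun r _ => mul_nonneg (hw0 r) (abs_nonneg _)
  have hτr : ∀ r < m, good r → |rowVal d A c r - y r| ≤ τ := by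
    intro r hr hg
    have := single_le_sum (f := fun r => x.wt r * |lsRes m x.wt d A y r|)
      (fun r _ => mul_nonneg (hw0 r) (abs_nonneg _)) (mem_range.mpr hr)
    rw [hres]
    refine le_trans ?_ this
    simp [hw1 r hr hg]
  have hT : 0 < 294912 * (k * k * k) * d * (m * m) * (q * q * q * q) := by positivity
  have hsh := fun g hg => R.sharp (y := y) (f := f) (g := g) (e := ε) hN hm hS hcard
    (fun _ h => h) lamOf_nonneg hkt hf hg hε hgood
  -- convergence of the descent when the residual is not tiny
  have hconv : ε ≤ τ → 0 < τ →
      D.val ≤ obj m d N (lamOf k q) A y f + τ / (32 * m * k * q) := by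
    intro hετ hτpos
    have hh : ∀ l, l ∉ S → c l - f l = 0 := fun l hl => by rw [hcS l hl, hf l hl, sub_zero]
    have h1 : δ * nu (fun l => c l - f l) ≤ 4 * τ := by
      have := R.le_sum_good hS hcard (fun _ h => h) lamOf_nonneg hkt hh (e := 2 * τ) (by linarith)
        (fun r hr hg => by
          rw [show rowVal d A (fun l => c l - f l) r = rowVal d A c r - rowVal d A f r from
            rowVal_sub d A c f r]
          have h2 := abs_sub_le (rowVal d A c r) (y r) (rowVal d A f r)
          rw [abs_sub_comm (y r)] at h2
          linarith [hτr r hr hg, hgood r hr hg])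
      refine this.trans_eq ?_
      rw [hm]; push_cast; field_simp; norm_num
    have h2 : nu (fun l => c l - f l) ≤ 4 * τ * q := by
      calc nu (fun l => c l - f l) ≤ (δ * q) * nu (fun l => c l - f l) :=
            le_mul_of_one_le_left (R.nonneg _) hδq
        _ = (δ * nu (fun l => c l - f l)) * q := by ring
        _ ≤ 4 * τ * q := mul_le_mul_of_nonneg_right h1 hq'.le
    have h3 := R.sum_sq_le hS hcard (h := fun l => c l - f l) hh hh
    have h4 : nu (fun l => c l - f l) ^ 2 ≤ (4 * τ * q) ^ 2 :=
      pow_le_pow_left₀ (R.nonneg _) h2 2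
    refine descent_converges (xi := τ / (32 * m * k * q)) _ _ hN' (by rw [hm]; push_cast; ring)
      lamOf_nonneg (lamOf_le_one hk hqn) hA hd (by positivity)
      (by rw [← hτ]; field_simp; norm_num) f hT ?_
    calc _ ≤ 2 * k * (4 * τ * q) ^ 2 * (9 * d) :=
          mul_le_mul_of_nonneg_right (h3.trans (mul_le_mul_of_nonneg_left h4 (by positivity)))
            (by positivity)
      _ = _ := by push_cast; field_simp; ring
  by_cases hsmall : τ ≤ 64 * m * k * q * ε
  · left
    change D.val ≤ _
    rcases le_or_gt τ ε with hle | hlt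
    · have h1 : D.val ≤ obj m d N (lamOf k q) A y c := descent_val_le_obj (t := 0) _ _ hT
      have h2 := R.sharp (y := y) (f := c) (g := f) (e := τ) hN hm hS hcard
        (fun _ h => h) lamOf_nonneg hkt hcS hf hτ0 hτr
      have h3 := mul_nonneg hδ.le (R.nonneg fun l => f l - c l)
      linarith
    · refine (hconv hlt.le (hε.trans_lt hlt)).trans ?_
      have : τ / (32 * m * k * q) ≤ 2 * ε := by
        rw [div_le_iff₀ (by positivity)]; linarith
      linarith
  · right
    push Not at hsmall
    have hmkq : (1 : ℝ) ≤ m * k * q := by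
      have := one_le_mul_of_one_le_of_one_le hm1 hk1
      exact one_le_mul_of_one_le_of_one_le this hq1
    have hmε : 64 * ε * m ≤ τ := by
      have : m * ε * 1 ≤ m * ε * (k * q) :=
        mul_le_mul_of_nonneg_left (one_le_mul_of_one_le_of_one_le hk1 hq1) (by positivity)
      nlinarith
    have hετ : ε ≤ τ := by nlinarith
    have hτpos : 0 < τ := lt_of_le_of_lt (by positivity) hsmall
    have hεm : ε ≤ τ / m / 64 := by
      rw [le_div_iff₀ (by norm_num), le_div_iff₀ hm']; linarith
    have hv := hconv hετ hτpos
    have h1 := hsh D.best hsupp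
    rw [← hval] at h1
    -- the distance of the best point to `f`
    have h2 : ∀ r < m, |rowVal d A D.best r - rowVal d A f r| ≤ τ / m * (3 / 16) := by
      intro r hr
      have hh : ∀ l, l ∉ S → D.best l - f l = 0 := fun l hl => by
        rw [hsupp l hl, hf l hl, sub_zero]
      have h3 := R.sum_abs_le hS hcard (h := fun l => D.best l - f l) hh
      rw [← l1_eq_sum hS hh] at h3
      have h4 : nu (fun l => D.best l - f l) ≤ (τ / (32 * m * k * q) + 4 * ε) * q := by
        calc nu (fun l => D.best l - f l) ≤ (δ * q) * nu (fun l => D.best l - f l) :=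
              le_mul_of_one_le_left (R.nonneg _) hδq
          _ = (δ * nu (fun l => D.best l - f l)) * q := by ring
          _ ≤ _ := mul_le_mul_of_nonneg_right (by linarith) hq'.le
      rw [← rowVal_sub]
      calc _ ≤ l1 d fun l => D.best l - f l := abs_rowVal_le fun l hl => hA r hr l hl
        _ ≤ 2 * k * ((τ / (32 * m * k * q) + 4 * ε) * q) :=
          h3.trans (mul_le_mul_of_nonneg_left h4 (by positivity))
        _ = τ / m * (1 / 16) + 8 * (k * q * ε) := by field_simp; ring
        _ ≤ τ / m * (1 / 16) + 8 * (τ / m / 64) := by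
          have : k * q * ε ≤ τ / m / 64 := by
            rw [le_div_iff₀ (by norm_num), le_div_iff₀ hm']; linarith
          linarith
        _ = _ := by ring
    have hthr : τ / (2 * m) = τ / m / 2 := by field_simp
    have hτm : 0 < τ / m := by positivity
    refine ⟨fun r hr hg => ?_, ?_⟩
    · simp only [phaseStep]
      rw [if_neg, hw1 r hr hg]
      rw [not_lt, hthr]
      have h3 := abs_sub_le (rowVal d A D.best r) (rowVal d A f r) (y r)
      have h4 := h2 r hr
      have h5 := hgood r hr hg
      linarith
    · obtain ⟨r₀, hr₀, hw₀, hbig⟩ : ∃ r < m, x.wt r = 1 ∧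
          9 / 10 * (τ / m) < |y r - rowVal d A f r| := by
        by_contra! hcon
        have h3 := lsRes_sq_le (m := m) hw0 d A y f
        have h4 : ∑ r ∈ range m, x.wt r * (y r - rowVal d A f r) ^ 2 ≤
            m * (9 / 10 * (τ / m)) ^ 2 := by
          calc _ ≤ ∑ r ∈ range m, (9 / 10 * (τ / m)) ^ 2 := sum_le_sum fun r hr => by
                rcases hx.wt r with h | h
                · rw [h, zero_mul]; positivity
                · rw [h, one_mul, ← sq_abs]
                  exact pow_le_pow_left₀ (abs_nonneg _) (hcon r (mem_range.mp hr) h) 2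
            _ = _ := by simp
        have h5 : τ ^ 2 ≤ m * ∑ r ∈ range m, x.wt r * lsRes m x.wt d A y r ^ 2 := by
          have h6 := sq_sum_le_card_mul_sum_sq (s := range m)
            (f := fun r => x.wt r * |lsRes m x.wt d A y r|)
          rw [card_range] at h6
          refine h6.trans_eq ?_
          congr 1
          refine sum_congr rfl fun r _ => ?_
          rcases hx.wt r with h | h <;> simp [h]
        have h6 : τ ^ 2 ≤ m * (m * (9 / 10 * (τ / m)) ^ 2) :=
          h5.trans (mul_le_mul_of_nonneg_left (h3.trans h4) hm'.le)
        have h7 : m * (m * (9 / 10 * (τ / m)) ^ 2) = 81 / 100 * τ ^ 2 := by field_simp; norm_num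
        rw [h7] at h6
        nlinarith
      have hdisc : (phaseStep m d N k q A y mask x).wt r₀ = 0 := by
        simp only [phaseStep]
        rw [if_pos]
        change τ / (2 * m) < |rowVal d A D.best r₀ - y r₀|
        rw [hthr]
        have h3 := abs_sub_le (y r₀) (rowVal d A D.best r₀) (rowVal d A f r₀)
        have h4 := h2 r₀ hr₀
        rw [abs_sub_comm (y r₀) (rowVal d A D.best r₀)] at h3
        linarith
      have hle : ∀ r, (phaseStep m d N k q A y mask x).wt r ≤ x.wt r := by
        intro r
        simp only [phaseStep]
        split_ifs
        · exact hw0 r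
        · exact le_rfl
      have h3 : ∑ r ∈ range m, (phaseStep m d N k q A y mask x).wt r + 1 ≤
          ∑ r ∈ range m, x.wt r := by
        rw [← sum_erase_add _ _ (mem_range.mpr hr₀), ← sum_erase_add _ _ (mem_range.mpr hr₀),
          hdisc, hw₀]
        have := sum_le_sum (s := (range m).erase r₀) fun r _ => hle r
        linarith
      push_cast
      linarith

noncomputable def phases (m d N k q : ℕ) (A : ℕ → ℕ → ℝ) (y mask : ℕ → ℝ) (p : ℕ) : Phase :=
  (phaseStep m d N k q A y mask)^[p] ⟨fun _ => 1, fun _ => 0, (∑ r ∈ range m, |y r|) / N⟩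

theorem phases_spec (R : Robust m d N A δ (lamOf k q) good nu (· ∈ S)) (hN : 0 < N)
    (hm : m = 2 * N) (hS : S ⊆ range d) (hcard : S.card ≤ 2 * k) (hk : 0 < k) (hd : 0 < d)
    (hδ : 0 < δ) (hq : 1 / δ ≤ q) (hA : ∀ r < m, ∀ l < d, |A r l| ≤ 1)
    (hA0 : ∀ r l, l ∉ S → A r l = 0)
    {f : ℕ → ℝ} (hf : ∀ l, l ∉ S → f l = 0) {ε : ℝ} (hε : 0 ≤ ε)
    (hgood : ∀ r < m, good r → |rowVal d A f r - y r| ≤ ε) {mask : ℕ → ℝ}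
    (hmask : ∀ l, mask l = if l ∈ S then 1 else 0) :
    (∀ l, l ∉ S → (phases m d N k q A y mask (m + 1)).best l = 0) ∧
    nu (fun l => (phases m d N k q A y mask (m + 1)).best l - f l) ≤ 8 * (ε / δ) := by
  have key : ∀ p, PhaseInv m d N k q A y good S f ε p (phases m d N k q A y mask p) := by
    intro p
    induction p with
    | zero => exact ⟨(obj_zero _ _ _ _ _ _).symm, fun _ _ => rfl, fun _ => Or.inr rfl,
        Or.inr ⟨fun _ _ _ => rfl, by simp [phases]⟩⟩
    | succ p ih =>
      rw [phases, Function.iterate_succ_apply']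
      exact ih.step R hN hm hS hcard hk hd hδ hq hA hA0 hf hε hgood hmask
  have h := key (m + 1)
  refine ⟨h.supp, ?_⟩
  have hkt := four_mul_lamOf_le hk hδ hq
  have h1 := R.sharp (y := y) (f := f) (g := (phases m d N k q A y mask (m + 1)).best) (e := ε)
    hN hm hS hcard (fun _ h => h) lamOf_nonneg hkt hf h.supp hε hgood
  rw [← h.val_eq] at h1
  rcases h.progress with h2 | ⟨-, h2⟩
  · rw [← mul_div_assoc, le_div_iff₀ hδ]
    linarith
  · have h3 : 0 ≤ ∑ r ∈ range m, (phases m d N k q A y mask (m + 1)).wt r :=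
      sum_nonneg fun r _ => by rcases h.wt r with h | h <;> simp [h]
    push_cast at h2
    linarith

end

end RobustRegression

/-! ## A uniform law of large numbers -/

namespace RobustRegression

open Finset

/-- The cube `l1 ≤ 1` has finite nets. -/
theorem exists_l1_net (d : ℕ) {e : ℝ} (he : 0 < e) : ∃ C : Finset (ℕ → ℝ), C.Nonempty ∧
    (∀ c ∈ C, l1 d c ≤ 1) ∧ ∀ c, l1 d c ≤ 1 → ∃ c' ∈ C, l1 d (fun l => c l - c' l) ≤ e := by
  classical
  set K : Set (Fin d → ℝ) := {c | ∑ l, |c l| ≤ 1} with hK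
  have hKc : IsCompact K := by
    refine Metric.isCompact_of_isClosed_isBounded
      (isClosed_le (by fun_prop) continuous_const) ?_
    refine (Metric.isBounded_closedBall (x := (0 : Fin d → ℝ)) (r := 1)).subset fun c hc => ?_
    rw [mem_closedBall_zero_iff, pi_norm_le_iff_of_nonneg zero_le_one]
    exact fun l => (single_le_sum (f := fun l => |c l|) (fun _ _ => abs_nonneg _)
      (mem_univ l)).trans hc
  obtain ⟨T, hTK, hTf, hT⟩ := hKc.finite_cover_balls (e := e / (d + 1)) (by positivity)
  let ext : (Fin d → ℝ) → ℕ → ℝ := fun c l => if h : l < d then c ⟨l, h⟩ else 0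
  have hl1 : ∀ c : Fin d → ℝ, l1 d (ext c) = ∑ l, |c l| := by
    intro c
    rw [l1, ← Fin.sum_univ_eq_sum_range (fun l => |ext c l|)]
    exact sum_congr rfl fun l _ => by simp [ext]
  have key : ∀ c, l1 d c ≤ 1 → ∃ c' ∈ hTf.toFinset.image ext, l1 d (fun l => c l - c' l) ≤ e := by
    intro c hc
    have hcK : (fun l : Fin d => c l) ∈ K := by
      rw [l1, ← Fin.sum_univ_eq_sum_range (fun l => |c l|)] at hc
      exact hc
    obtain ⟨b, hb, hcb⟩ := Set.mem_iUnion₂.mp (hT hcK)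
    refine ⟨ext b, mem_image_of_mem _ (hTf.mem_toFinset.mpr hb), ?_⟩
    rw [l1, ← Fin.sum_univ_eq_sum_range (fun l => |c l - ext b l|)]
    calc ∑ l : Fin d, |c l - ext b l| ≤ ∑ l : Fin d, e / (d + 1) := sum_le_sum fun l _ => by
          have h1 := (dist_le_pi_dist (fun l : Fin d => c l) b l).trans (Metric.mem_ball.mp hcb).le
          simpa [Real.dist_eq, ext] using h1
      _ = d / (d + 1) * e := by simp; ring
      _ ≤ 1 * e := by
        refine mul_le_mul_of_nonneg_right ?_ he.le
        rw [div_le_one (by positivity)]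
        linarith
      _ = e := one_mul e
  refine ⟨hTf.toFinset.image ext, ?_, ?_, key⟩
  · obtain ⟨c', hc', -⟩ := key (fun _ => 0) (by simp [l1])
    exact ⟨c', hc'⟩
  · intro c hc
    obtain ⟨b, hb, rfl⟩ := mem_image.mp hc
    rw [hl1]
    exact hTK (hTf.mem_toFinset.mp hb)

/-- The largest exponential of the values of `g` on `C`. -/
noncomputable def maxExp (C : Finset (ℕ → ℝ)) (g : (ℕ → ℝ) → ℝ) : ENNReal :=
  C.sup fun c => ENNReal.ofReal (Real.exp (g c))

theorem le_maxExp {C : Finset (ℕ → ℝ)} {g : (ℕ → ℝ) → ℝ} {c : ℕ → ℝ} (hc : c ∈ C) :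
    ENNReal.ofReal (Real.exp (g c)) ≤ maxExp C g :=
  le_sup (f := fun c => ENNReal.ofReal (Real.exp (g c))) hc

theorem maxExp_mono {C : Finset (ℕ → ℝ)} {g g' : (ℕ → ℝ) → ℝ} (h : ∀ c ∈ C, g c ≤ g' c) :
    maxExp C g ≤ maxExp C g' :=
  Finset.sup_le fun c hc =>
    (ENNReal.ofReal_le_ofReal (Real.exp_le_exp.mpr (h c hc))).trans (le_maxExp hc)

theorem measurable_maxExp {β : Type*} [MeasurableSpace β] {C : Finset (ℕ → ℝ)}
    {g : β → (ℕ → ℝ) → ℝ} (h : ∀ c, Measurable fun b => g b c) :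
    Measurable fun b => maxExp C (g b) := by
  classical
  unfold maxExp
  induction C using Finset.induction_on with
  | empty => simp
  | insert c C _ ih =>
    simp only [sup_insert]
    exact ((h c).exp).ennreal_ofReal.sup ih

theorem maxExp_abs_le {C : Finset (ℕ → ℝ)} (A v : (ℕ → ℝ) → ℝ) :
    maxExp C (fun c => A c + |v c|) + maxExp C (fun c => A c - |v c|) ≤
      maxExp C (fun c => A c + v c) + maxExp C (fun c => A c - v c) := by
  rcases C.eq_empty_or_nonempty with rfl | hC
  · simp [maxExp]
  obtain ⟨c, hc, hmax⟩ := exists_mem_eq_sup C hC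
    fun c => ENNReal.ofReal (Real.exp (A c + |v c|))
  change maxExp C (fun c => A c + |v c|) = _ at hmax
  rw [hmax]
  rcases le_total 0 (v c) with h | h
  · rw [abs_of_nonneg h]
    exact add_le_add (le_maxExp (g := fun c => A c + v c) hc)
      (maxExp_mono fun c _ => by linarith [le_abs_self (v c)])
  · rw [abs_of_nonpos h, add_comm (maxExp C fun c => A c + v c), ← sub_eq_add_neg]
    exact add_le_add (le_maxExp (g := fun c => A c - v c) hc)
      (maxExp_mono fun c _ => by linarith [neg_abs_le (v c)])

theorem ofReal_exp_half (a b : ℝ) : ENNReal.ofReal (Real.exp ((a + b) / 2)) ≤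
    2⁻¹ * (ENNReal.ofReal (Real.exp a) + ENNReal.ofReal (Real.exp b)) := by
  rw [← ENNReal.ofReal_add (Real.exp_nonneg a) (Real.exp_nonneg b),
    show (2⁻¹ : ENNReal) = ENNReal.ofReal 2⁻¹ by
      rw [ENNReal.ofReal_inv_of_pos (by norm_num)]; simp,
    ← ENNReal.ofReal_mul (by norm_num)]
  refine ENNReal.ofReal_le_ofReal ?_
  have h1 : Real.exp ((a + b) / 2) ^ 2 = Real.exp a * Real.exp b := by
    rw [← Real.exp_nat_mul, ← Real.exp_add]; congr 1; push_cast; ring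
  have h2 := sq_nonneg (Real.exp a - Real.exp b)
  have h3 := Real.exp_pos a
  have h4 := Real.exp_pos b
  have h5 := Real.exp_pos ((a + b) / 2)
  nlinarith

section OneSample

variable {α : Type*} [MeasurableSpace α] (ν : Measure α) [IsProbabilityMeasure ν]

theorem ofReal_exp_integral_le {Y : α → ℝ} (hY : Measurable Y) {b : ℝ} (hb : ∀ z, |Y z| ≤ b) :
    ENNReal.ofReal (Real.exp (∫ z, Y z ∂ν)) ≤ ∫⁻ z, ENNReal.ofReal (Real.exp (Y z)) ∂ν := by
  have hi : Integrable Y ν := Integrable.of_bound hY.aestronglyMeasurable b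
    (Filter.Eventually.of_forall hb)
  have hi' : Integrable (fun z => Real.exp (Y z)) ν :=
    Integrable.of_bound hY.exp.aestronglyMeasurable (Real.exp b)
      (Filter.Eventually.of_forall fun z => by
        rw [Real.norm_eq_abs, Real.abs_exp]
        exact Real.exp_le_exp.mpr ((le_abs_self _).trans (hb z)))
  rw [← ofReal_integral_eq_lintegral_ofReal hi'
    (Filter.Eventually.of_forall fun z => Real.exp_nonneg _)]
  refine ENNReal.ofReal_le_ofReal ?_
  exact convexOn_exp.map_integral_le Real.continuous_exp.continuousOn isClosed_univ
    (Filter.Eventually.of_forall fun _ => Set.mem_univ _) hi hi'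

theorem lintegral_maxExp_le {C : Finset (ℕ → ℝ)} (A : (ℕ → ℝ) → ℝ) (v : (ℕ → ℝ) → α → ℝ)
    (sg : α → ℝ) (hsg : Measurable sg) (hsg1 : ∀ z, sg z = 1 ∨ sg z = -1)
    (hv : ∀ c, Measurable (v c)) {b : (ℕ → ℝ) → ℝ} (hb : ∀ c z, |v c z| ≤ b c) :
    ∫⁻ z, maxExp C (fun c => A c + ((∫ z', sg z' * |v c z'| ∂ν) - sg z * |v c z|)) ∂ν ≤
      ∫⁻ z, 2⁻¹ * (maxExp C (fun c => A c + 2 * v c z) +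
        maxExp C (fun c => A c - 2 * v c z)) ∂ν := by
  set X : (ℕ → ℝ) → α → ℝ := fun c z => sg z * |v c z| with hX
  have hXm : ∀ c, Measurable (X c) := fun c => hsg.mul (hv c).abs
  have hXb : ∀ c z, |X c z| ≤ b c := by
    intro c z
    rcases hsg1 z with h | h <;> simpa [hX, h] using hb c z
  have h1 : ∀ z, maxExp C (fun c => A c + ((∫ z', X c z' ∂ν) - X c z)) ≤
      ∫⁻ z', 2⁻¹ * (maxExp C (fun c => A c + 2 * X c z') +
        maxExp C (fun c => A c - 2 * X c z)) ∂ν := by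
    intro z
    refine Finset.sup_le fun c hc => ?_
    have hi : Integrable (X c) ν := Integrable.of_bound (hXm c).aestronglyMeasurable (b c)
      (Filter.Eventually.of_forall (hXb c))
    have h2 : A c + ((∫ z', X c z' ∂ν) - X c z) = ∫ z', (A c - X c z + X c z') ∂ν := by
      rw [integral_add (integrable_const _) hi]
      simp; ring
    change ENNReal.ofReal (Real.exp (A c + ((∫ z', X c z' ∂ν) - X c z))) ≤ _
    rw [h2]
    refine (ofReal_exp_integral_le ν (measurable_const.add (hXm c)) (b := |A c - X c z| + b c)
      fun z' => (abs_add_le _ _).trans (add_le_add_right (hXb c z') _)).trans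
      (lintegral_mono fun z' => ?_)
    have h3 : A c - X c z + X c z' = ((A c + 2 * X c z') + (A c - 2 * X c z)) / 2 := by ring
    change ENNReal.ofReal (Real.exp (A c - X c z + X c z')) ≤ _
    rw [h3]
    refine (ofReal_exp_half _ _).trans (mul_le_mul_right ?_ _)
    exact add_le_add (le_maxExp (g := fun c => A c + 2 * X c z') hc)
      (le_maxExp (g := fun c => A c - 2 * X c z) hc)
  have hm1 : Measurable fun z => maxExp C (fun c => A c + 2 * X c z) :=
    measurable_maxExp fun c => measurable_const.add ((hXm c).const_mul 2)
  have hm2 : Measurable fun z => maxExp C (fun c => A c - 2 * X c z) :=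
    measurable_maxExp fun c => measurable_const.sub ((hXm c).const_mul 2)
  calc _ ≤ ∫⁻ z, ∫⁻ z', 2⁻¹ * (maxExp C (fun c => A c + 2 * X c z') +
        maxExp C (fun c => A c - 2 * X c z)) ∂ν ∂ν := lintegral_mono h1
    _ = ∫⁻ z, 2⁻¹ * (maxExp C (fun c => A c + 2 * X c z) +
        maxExp C (fun c => A c - 2 * X c z)) ∂ν := by
      have h4 : ∀ z, ∫⁻ z', 2⁻¹ * (maxExp C (fun c => A c + 2 * X c z') +
          maxExp C (fun c => A c - 2 * X c z)) ∂ν =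
          2⁻¹ * ((∫⁻ z', maxExp C (fun c => A c + 2 * X c z') ∂ν) +
            maxExp C (fun c => A c - 2 * X c z)) := by
        intro z
        rw [lintegral_const_mul _ (hm1.add_const _), lintegral_add_right _ measurable_const]
        simp
      have h7 : ∫⁻ z, 2⁻¹ * (maxExp C (fun c => A c + 2 * X c z) +
          maxExp C (fun c => A c - 2 * X c z)) ∂ν =
          2⁻¹ * ((∫⁻ z, maxExp C (fun c => A c + 2 * X c z) ∂ν) +
            ∫⁻ z, maxExp C (fun c => A c - 2 * X c z) ∂ν) := by
        rw [lintegral_const_mul 2⁻¹ (f := fun z => maxExp C (fun c => A c + 2 * X c z) +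
          maxExp C (fun c => A c - 2 * X c z)) (hm1.add hm2), lintegral_add_right _ hm2]
      simp_rw [h4]
      rw [lintegral_const_mul _ (hm2.const_add _), h7, lintegral_add_right _ hm2]
      simp
    _ ≤ _ := by
      refine lintegral_mono fun z => mul_le_mul_right ?_ _
      have h5 := maxExp_abs_le (C := C) A fun c => 2 * v c z
      have h6 : ∀ c, |2 * v c z| = 2 * |v c z| := fun c => by rw [abs_mul, abs_two]
      simp only [h6] at h5
      rcases hsg1 z with h | h
      · simpa [hX, h] using h5
      · refine le_trans (le_of_eq ?_) h5
        rw [add_comm]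
        simp [hX, h, sub_eq_add_neg]

end OneSample

/-- The value at `z` of the function with coefficients `c` with respect to `φ`. -/
def feat {α : Type*} (d : ℕ) (φ : ℕ → α → ℝ) (c : ℕ → ℝ) (z : α) : ℝ :=
  ∑ l ∈ range d, φ l z * c l

section Features

variable {α : Type*} {d : ℕ} {φ : ℕ → α → ℝ}

theorem abs_feat_le (hφ : ∀ l z, |φ l z| ≤ 1) (c : ℕ → ℝ) (z : α) : |feat d φ c z| ≤ l1 d c := by
  refine (abs_sum_le_sum_abs _ _).trans (sum_le_sum fun l _ => ?_)
  rw [abs_mul]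
  exact mul_le_of_le_one_left (abs_nonneg _) (hφ l z)

theorem feat_sub (c c' : ℕ → ℝ) (z : α) :
    feat d φ (fun l => c l - c' l) z = feat d φ c z - feat d φ c' z := by
  simp [feat, mul_sub]

theorem feat_smul (a : ℝ) (c : ℕ → ℝ) (z : α) :
    feat d φ (fun l => a * c l) z = a * feat d φ c z := by
  simp only [feat, mul_sum]
  exact sum_congr rfl fun l _ => by ring

theorem measurable_feat [MeasurableSpace α] (hφ : ∀ l, Measurable (φ l)) (c : ℕ → ℝ) :
    Measurable (feat d φ c) :=
  Finset.measurable_sum _ fun l _ => (hφ l).mul_const _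

end Features

/-- A potential that dominates `maxExp` of linear functions on the `l1`-ball. -/
noncomputable def potential (d : ℕ) (w : ℕ → ℝ) : ENNReal :=
  ∑ l ∈ range d, ENNReal.ofReal (2 * Real.cosh (w l))

theorem maxExp_le_potential {d : ℕ} (hd : 0 < d) {C : Finset (ℕ → ℝ)} (hC : ∀ c ∈ C, l1 d c ≤ 1)
    (w : ℕ → ℝ) : maxExp C (fun c => ∑ l ∈ range d, w l * c l) ≤ potential d w := by
  refine Finset.sup_le fun c hc => ?_
  obtain ⟨l₀, hl₀, hmax⟩ := exists_max_image (range d) (fun l => |w l|) ⟨0, mem_range.mpr hd⟩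
  have h1 : ∑ l ∈ range d, w l * c l ≤ |w l₀| := by
    calc ∑ l ∈ range d, w l * c l ≤ ∑ l ∈ range d, |w l₀| * |c l| := sum_le_sum fun l hl => by
          refine (le_abs_self _).trans ?_
          rw [abs_mul]
          exact mul_le_mul_of_nonneg_right (hmax l hl) (abs_nonneg _)
      _ = |w l₀| * l1 d c := by rw [l1, mul_sum]
      _ ≤ |w l₀| * 1 := mul_le_mul_of_nonneg_left (hC c hc) (abs_nonneg _)
      _ = |w l₀| := mul_one _
  have h2 : Real.exp (∑ l ∈ range d, w l * c l) ≤ 2 * Real.cosh (w l₀) := by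
    refine (Real.exp_le_exp.mpr h1).trans ?_
    rw [← Real.cosh_abs, Real.cosh_eq]
    have := Real.exp_pos (-|w l₀|)
    linarith
  exact (ENNReal.ofReal_le_ofReal h2).trans
    (single_le_sum (f := fun l => ENNReal.ofReal (2 * Real.cosh (w l))) (fun _ _ => zero_le) hl₀)

theorem potential_avg_le (d : ℕ) (w v : ℕ → ℝ) {θ : ℝ} (hv : ∀ l, |v l| ≤ 1) :
    2⁻¹ * (potential d (fun l => w l + 2 * (θ * v l)) +
      potential d (fun l => w l - 2 * (θ * v l))) ≤
      ENNReal.ofReal (Real.exp (2 * θ ^ 2)) * potential d w := by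
  unfold potential
  rw [← sum_add_distrib, mul_sum, mul_sum]
  refine sum_le_sum fun l _ => ?_
  have hc : ∀ x, 0 ≤ 2 * Real.cosh x := fun x => by have := Real.cosh_pos x; positivity
  rw [← ENNReal.ofReal_add (hc _) (hc _),
    show (2⁻¹ : ENNReal) = ENNReal.ofReal 2⁻¹ by
      rw [ENNReal.ofReal_inv_of_pos (by norm_num)]; simp,
    ← ENNReal.ofReal_mul (by norm_num), ← ENNReal.ofReal_mul (Real.exp_nonneg _)]
  refine ENNReal.ofReal_le_ofReal ?_
  rw [Real.cosh_add, Real.cosh_sub]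
  have h1 : Real.cosh (2 * (θ * v l)) ≤ Real.exp (2 * θ ^ 2) := by
    refine (Real.cosh_le_exp_half_sq _).trans (Real.exp_le_exp.mpr ?_)
    have h2 : v l ^ 2 ≤ 1 := by rw [← sq_abs]; exact pow_le_one₀ (abs_nonneg _) (hv l)
    nlinarith [mul_le_mul_of_nonneg_left h2 (sq_nonneg θ)]
  have h3 := mul_le_mul_of_nonneg_right h1 (hc (w l))
  linarith

section Sequence

variable {α : Type*} [MeasurableSpace α] {Ω : Type*} [MeasurableSpace Ω] {P : Measure Ω}
  [IsProbabilityMeasure P] {Z : ℕ → Ω → α} {d : ℕ} {φ : ℕ → α → ℝ} {sg : α → ℝ}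

variable (P Z d φ sg) in
/-- The expected value minus the observed value of the signed size of the `i`-th sample. -/
noncomputable def dev (c : ℕ → ℝ) (i : ℕ) (ω : Ω) : ℝ :=
  (∫ z, sg z * |feat d φ c z| ∂(P.map (Z i))) - sg (Z i ω) * |feat d φ c (Z i ω)|

theorem lintegral_maxExp_dev_le (hind : iIndepFun Z P) (hZ : ∀ i, Measurable (Z i)) (hd : 0 < d)
    (hφ : ∀ l, Measurable (φ l)) (hφ1 : ∀ l z, |φ l z| ≤ 1) (hsg : Measurable sg)
    (hsg1 : ∀ z, sg z = 1 ∨ sg z = -1) {C : Finset (ℕ → ℝ)} (hC : ∀ c ∈ C, l1 d c ≤ 1)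
    {θ : ℝ} (hθ : 0 ≤ θ) (N : ℕ) (w : ℕ → ℝ) :
    ∫⁻ ω, maxExp C (fun c => ∑ l ∈ range d, w l * c l +
        θ * ∑ i ∈ range N, dev P Z d φ sg c i ω) ∂P ≤
      ENNReal.ofReal (Real.exp (2 * θ ^ 2)) ^ N * potential d w := by
  induction N generalizing w with
  | zero => simpa using maxExp_le_potential hd hC w
  | succ N ih =>
    set Y : Ω → (range N → α) := fun ω i => Z i ω with hY
    have hYm : Measurable Y := measurable_pi_lambda _ fun i => hZ i
    have hYZ : IndepFun Y (Z N) P :=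
      (hind.indepFun_finset (range N) {N} (by simp) hZ).comp measurable_id
        (measurable_pi_apply (⟨N, by simp⟩ : ({N} : Finset ℕ)))
    have hprod := (indepFun_iff_map_prod_eq_prod_map_map hYm.aemeasurable
      (hZ N).aemeasurable).mp hYZ
    set νN := P.map (Z N) with hνN
    have : IsProbabilityMeasure νN := Measure.isProbabilityMeasure_map (hZ N).aemeasurable
    have : IsProbabilityMeasure (P.map Y) := Measure.isProbabilityMeasure_map hYm.aemeasurable
    set D : (ℕ → ℝ) → (range N → α) → ℝ := fun c y =>
      ∑ i : range N, ((∫ z, sg z * |feat d φ c z| ∂(P.map (Z i))) -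
        sg (y i) * |feat d φ c (y i)|) with hD
    have hDm : ∀ c, Measurable (D c) := fun c => Finset.measurable_sum _ fun i _ =>
      measurable_const.sub ((hsg.comp (measurable_pi_apply i)).mul
        ((measurable_feat hφ c).comp (measurable_pi_apply i)).abs)
    have hDY : ∀ c ω, D c (Y ω) = ∑ i ∈ range N, dev P Z d φ sg c i ω := fun c ω =>
      Finset.sum_coe_sort (range N) fun i => dev P Z d φ sg c i ω
    set A : (range N → α) → (ℕ → ℝ) → ℝ := fun y c =>
      ∑ l ∈ range d, w l * c l + θ * D c y with hA
    have hAm : ∀ c, Measurable fun y => A y c := fun c =>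
      measurable_const.add ((hDm c).const_mul θ)
    set v : (ℕ → ℝ) → α → ℝ := fun c z => θ * feat d φ c z with hv
    have hvm : ∀ c, Measurable (v c) := fun c => (measurable_feat hφ c).const_mul θ
    have hm0 : Measurable fun p : (range N → α) × α => maxExp C (fun c => A p.1 c +
        ((∫ z', sg z' * |v c z'| ∂νN) - sg p.2 * |v c p.2|)) :=
      measurable_maxExp fun c => ((hAm c).comp measurable_fst).add (measurable_const.sub
        ((hsg.comp measurable_snd).mul ((hvm c).comp measurable_snd).abs))
    have hmp : Measurable fun p : (range N → α) × α => maxExp C (fun c => A p.1 c + 2 * v c p.2) :=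
      measurable_maxExp fun c => ((hAm c).comp measurable_fst).add
        (((hvm c).comp measurable_snd).const_mul 2)
    have hmm : Measurable fun p : (range N → α) × α => maxExp C (fun c => A p.1 c - 2 * v c p.2) :=
      measurable_maxExp fun c => ((hAm c).comp measurable_fst).sub
        (((hvm c).comp measurable_snd).const_mul 2)
    have h1 : ∫⁻ ω, maxExp C (fun c => ∑ l ∈ range d, w l * c l +
        θ * ∑ i ∈ range (N + 1), dev P Z d φ sg c i ω) ∂P =
        ∫⁻ y, ∫⁻ z, maxExp C (fun c => A y c +
          ((∫ z', sg z' * |v c z'| ∂νN) - sg z * |v c z|)) ∂νN ∂(P.map Y) := by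
      rw [← lintegral_prod _ hm0.aemeasurable, ← hprod, lintegral_map hm0 (hYm.prodMk (hZ N))]
      refine lintegral_congr fun ω => ?_
      congr 1
      funext c
      simp only [hA, hDY, hv, abs_mul, abs_of_nonneg hθ, sum_range_succ]
      have h2 : ∀ z, sg z * (θ * |feat d φ c z|) = θ * (sg z * |feat d φ c z|) := fun z => by ring
      simp only [h2, integral_const_mul]
      rw [dev]
      ring
    rw [h1]
    calc _ ≤ ∫⁻ y, ∫⁻ z, 2⁻¹ * (maxExp C (fun c => A y c + 2 * v c z) +
          maxExp C (fun c => A y c - 2 * v c z)) ∂νN ∂(P.map Y) :=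
        lintegral_mono fun y => lintegral_maxExp_le νN (A y) v sg hsg hsg1 hvm
          (b := fun c => θ * l1 d c) fun c z => by
            rw [hv, abs_mul, abs_of_nonneg hθ]
            exact mul_le_mul_of_nonneg_left (abs_feat_le hφ1 c z) hθ
      _ = ∫⁻ z, ∫⁻ y, 2⁻¹ * (maxExp C (fun c => A y c + 2 * v c z) +
          maxExp C (fun c => A y c - 2 * v c z)) ∂(P.map Y) ∂νN :=
        lintegral_lintegral_swap ((hmp.add hmm).const_mul 2⁻¹).aemeasurable
      _ ≤ ∫⁻ z, ENNReal.ofReal (Real.exp (2 * θ ^ 2)) ^ (N + 1) * potential d w ∂νN := by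
        refine lintegral_mono fun z => ?_
        have hmpz : Measurable fun y => maxExp C (fun c => A y c + 2 * v c z) :=
          measurable_maxExp fun c => (hAm c).add_const _
        have hmmz : Measurable fun y => maxExp C (fun c => A y c - 2 * v c z) :=
          measurable_maxExp fun c => (hAm c).sub_const _
        rw [lintegral_const_mul 2⁻¹ (f := fun y => maxExp C (fun c => A y c + 2 * v c z) +
          maxExp C (fun c => A y c - 2 * v c z)) (hmpz.add hmmz), lintegral_add_right _ hmmz,
          lintegral_map hmpz hYm, lintegral_map hmmz hYm]
        have h3 := ih fun l => w l + 2 * (θ * φ l z)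
        have h4 := ih fun l => w l - 2 * (θ * φ l z)
        have h5 : ∀ c ω, ∑ l ∈ range d, (w l + 2 * (θ * φ l z)) * c l +
            θ * ∑ i ∈ range N, dev P Z d φ sg c i ω = A (Y ω) c + 2 * v c z := by
          intro c ω
          simp only [hA, hv, hDY, feat, mul_sum, add_mul, sum_add_distrib]
          have : ∑ l ∈ range d, 2 * (θ * φ l z) * c l = ∑ l ∈ range d, 2 * (θ * (φ l z * c l)) :=
            sum_congr rfl fun l _ => by ring
          rw [this]; ring
        have h6 : ∀ c ω, ∑ l ∈ range d, (w l - 2 * (θ * φ l z)) * c l +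
            θ * ∑ i ∈ range N, dev P Z d φ sg c i ω = A (Y ω) c - 2 * v c z := by
          intro c ω
          simp only [hA, hv, hDY, feat, mul_sum, sub_mul, sum_sub_distrib]
          have : ∑ l ∈ range d, 2 * (θ * φ l z) * c l = ∑ l ∈ range d, 2 * (θ * (φ l z * c l)) :=
            sum_congr rfl fun l _ => by ring
          rw [this]; ring
        simp only [h5] at h3
        simp only [h6] at h4
        calc _ ≤ 2⁻¹ * (ENNReal.ofReal (Real.exp (2 * θ ^ 2)) ^ N *
                potential d (fun l => w l + 2 * (θ * φ l z)) +
              ENNReal.ofReal (Real.exp (2 * θ ^ 2)) ^ N *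
                potential d (fun l => w l - 2 * (θ * φ l z))) :=
              mul_le_mul_right (add_le_add h3 h4) _
          _ = ENNReal.ofReal (Real.exp (2 * θ ^ 2)) ^ N * (2⁻¹ *
              (potential d (fun l => w l + 2 * (θ * φ l z)) +
                potential d (fun l => w l - 2 * (θ * φ l z)))) := by ring
          _ ≤ ENNReal.ofReal (Real.exp (2 * θ ^ 2)) ^ N *
              (ENNReal.ofReal (Real.exp (2 * θ ^ 2)) * potential d w) :=
              mul_le_mul_right (potential_avg_le d w (fun l => φ l z) fun l => hφ1 l z) _
          _ = _ := by ring
      _ = _ := by rw [lintegral_const, measure_univ, mul_one]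

theorem abs_dev_sub_le (hZ : ∀ i, Measurable (Z i)) (hφ : ∀ l, Measurable (φ l))
    (hφ1 : ∀ l z, |φ l z| ≤ 1) (hsg : Measurable sg) (hsg1 : ∀ z, sg z = 1 ∨ sg z = -1)
    (c c' : ℕ → ℝ) (i : ℕ) (ω : Ω) :
    dev P Z d φ sg c i ω - dev P Z d φ sg c' i ω ≤ 2 * l1 d fun l => c l - c' l := by
  have : IsProbabilityMeasure (P.map (Z i)) :=
    Measure.isProbabilityMeasure_map (hZ i).aemeasurable
  have hb : ∀ c z, |(sg z * |feat d φ c z|)| ≤ l1 d c := by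
    intro c z
    rcases hsg1 z with h | h <;> simpa [h] using abs_feat_le hφ1 c z
  have hint : ∀ c, Integrable (fun z => sg z * |feat d φ c z|) (P.map (Z i)) := fun c =>
    Integrable.of_bound (hsg.mul (measurable_feat hφ c).abs).aestronglyMeasurable (l1 d c)
      (Filter.Eventually.of_forall (hb c))
  have hdiff : ∀ z, |sg z * |feat d φ c z| - (sg z * |feat d φ c' z|)| ≤
      l1 d fun l => c l - c' l := by
    intro z
    have h1 := (abs_abs_sub_abs_le (feat d φ c z) (feat d φ c' z)).trans_eq
      (congrArg abs (feat_sub c c' z).symm)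
    have h2 := h1.trans (abs_feat_le hφ1 _ z)
    rw [← mul_sub, abs_mul]
    rcases hsg1 z with h | h <;> simpa [h] using h2
  have h3 : (∫ z, sg z * |feat d φ c z| ∂(P.map (Z i))) -
      (∫ z, sg z * |feat d φ c' z| ∂(P.map (Z i))) ≤ l1 d fun l => c l - c' l := by
    rw [← integral_sub (hint c) (hint c')]
    calc _ ≤ ∫ z, (l1 d fun l => c l - c' l) ∂(P.map (Z i)) :=
          integral_mono ((hint c).sub (hint c')) (integrable_const _)
            fun z => (le_abs_self _).trans (hdiff z)
      _ = _ := by simp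
  have h4 := (abs_le.mp (hdiff (Z i ω))).1
  unfold dev
  linarith

/-- Uniformly over all `c`, the observed mean of the signed size is not much smaller than its
expected value. -/
theorem measure_dev_le (hind : iIndepFun Z P) (hZ : ∀ i, Measurable (Z i)) (hd : 0 < d)
    (hφ : ∀ l, Measurable (φ l)) (hφ1 : ∀ l z, |φ l z| ≤ 1) (hsg : Measurable sg)
    (hsg1 : ∀ z, sg z = 1 ∨ sg z = -1) {t : ℝ} (ht : 0 < t) (N : ℕ) :
    P {ω | ¬ ∀ c, ∑ i ∈ range N, dev P Z d φ sg c i ω ≤ N * t * l1 d c} ≤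
      ENNReal.ofReal (2 * d * Real.exp (-(N * t ^ 2 / 32))) := by
  obtain ⟨C, hCne, hC, hnet⟩ := exists_l1_net d (e := t / 4) (by positivity)
  set θ := t / 8 with hθ
  set G : Ω → ENNReal := fun ω =>
    maxExp C (fun c => θ * ∑ i ∈ range N, dev P Z d φ sg c i ω) with hG
  have hGm : Measurable G := measurable_maxExp fun c => (Finset.measurable_sum _ fun i _ =>
    measurable_const.sub ((hsg.comp (hZ i)).mul
      ((measurable_feat hφ c).comp (hZ i)).abs)).const_mul θ
  have hGint : ∫⁻ ω, G ω ∂P ≤ ENNReal.ofReal (Real.exp (2 * θ ^ 2)) ^ N * potential d fun _ => 0 := by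
    simpa [hG] using lintegral_maxExp_dev_le hind hZ hd hφ hφ1 hsg hsg1 hC
      (by positivity : 0 ≤ θ) N fun _ => 0
  have hsub : {ω | ¬ ∀ c, ∑ i ∈ range N, dev P Z d φ sg c i ω ≤ N * t * l1 d c} ⊆
      {ω | ENNReal.ofReal (Real.exp (θ * (N * (t / 2)))) ≤ G ω} := by
    intro ω hω
    simp only [Set.mem_ofPred_eq, not_forall, not_le] at hω ⊢
    obtain ⟨c, hc⟩ := hω
    have hl0 : 0 ≤ l1 d c := sum_nonneg fun _ _ => abs_nonneg _
    have hlpos : 0 < l1 d c := by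
      rcases hl0.lt_or_eq with h | h
      · exact h
      · exfalso
        rw [← h, mul_zero] at hc
        have h0 : ∀ z, |feat d φ c z| = 0 := fun z =>
          le_antisymm ((abs_feat_le hφ1 c z).trans h.symm.le) (abs_nonneg _)
        simp [dev, h0] at hc
    set a := (l1 d c)⁻¹ with ha
    have hapos : 0 < a := inv_pos.mpr hlpos
    have hal : a * l1 d c = 1 := inv_mul_cancel₀ hlpos.ne'
    have hdev : ∀ i, dev P Z d φ sg (fun l => a * c l) i ω = a * dev P Z d φ sg c i ω := by
      intro i
      simp only [dev, feat_smul, abs_mul, abs_of_pos hapos]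
      have h2 : ∀ z, sg z * (a * |feat d φ c z|) = a * (sg z * |feat d φ c z|) := fun z => by ring
      simp only [h2, integral_const_mul]
      ring
    have hl1 : l1 d (fun l => a * c l) = 1 := by
      simp only [l1, abs_mul, abs_of_pos hapos, ← mul_sum]
      exact hal
    have hbig : N * t < ∑ i ∈ range N, dev P Z d φ sg (fun l => a * c l) i ω := by
      simp only [hdev, ← mul_sum]
      have := mul_lt_mul_of_pos_left hc hapos
      calc N * t = a * (N * t * l1 d c) := by rw [mul_left_comm, hal, mul_one]
        _ < _ := this
    obtain ⟨c', hc', hcc'⟩ := hnet (fun l => a * c l) hl1.le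
    have h5 : ∑ i ∈ range N, dev P Z d φ sg (fun l => a * c l) i ω -
        ∑ i ∈ range N, dev P Z d φ sg c' i ω ≤ N * (t / 2) := by
      rw [← sum_sub_distrib]
      calc _ ≤ ∑ i ∈ range N, t / 2 := sum_le_sum fun i _ =>
            (abs_dev_sub_le hZ hφ hφ1 hsg hsg1 _ c' i ω).trans (by linarith)
        _ = _ := by simp
    refine le_trans (ENNReal.ofReal_le_ofReal (Real.exp_le_exp.mpr ?_))
      (le_maxExp (g := fun c => θ * ∑ i ∈ range N, dev P Z d φ sg c i ω) hc')
    exact mul_le_mul_of_nonneg_left (by linarith) (by positivity)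
  have hpot : (potential d fun _ => 0) = ENNReal.ofReal (2 * d) := by
    simp only [potential, Real.cosh_zero, mul_one, sum_const, card_range, nsmul_eq_mul]
    rw [mul_comm (2 : ℝ), ENNReal.ofReal_mul (Nat.cast_nonneg d), ENNReal.ofReal_natCast]
  have hmk := meas_ge_le_lintegral_div (μ := P) hGm.aemeasurable
    (ε := ENNReal.ofReal (Real.exp (θ * (N * (t / 2)))))
    (by simpa using Real.exp_pos _) ENNReal.ofReal_ne_top
  refine (measure_mono hsub).trans (hmk.trans ?_)
  refine (ENNReal.div_le_div_right hGint _).trans ?_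
  rw [hpot, ← ENNReal.ofReal_pow (Real.exp_nonneg _), ← ENNReal.ofReal_mul (by positivity),
    ← ENNReal.ofReal_div_of_pos (Real.exp_pos _)]
  refine ENNReal.ofReal_le_ofReal (le_of_eq ?_)
  rw [← Real.exp_nat_mul, mul_comm, mul_div_assoc, ← Real.exp_sub]
  congr 2
  rw [hθ]; ring

end Sequence

end RobustRegression

namespace RealRAM

/-! ### Notation for expressions -/

instance : Add NatExpr := ⟨.add⟩
instance : Sub NatExpr := ⟨.sub⟩
instance : Mul NatExpr := ⟨.mul⟩
instance : Add RealExpr := ⟨.add⟩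
instance : Sub RealExpr := ⟨.sub⟩
instance : Mul RealExpr := ⟨.mul⟩
instance : Div RealExpr := ⟨.div⟩
instance : Coe NatExpr RealExpr := ⟨.ofNat⟩

@[simp] theorem NatExpr.eval_reg (s : State) (i : ℕ) : (NatExpr.reg i).eval s = s.nat i := rfl
@[simp] theorem NatExpr.eval_const (s : State) (c : ℕ) : (NatExpr.const c).eval s = c := rfl
@[simp] theorem NatExpr.eval_add (s : State) (a b : NatExpr) :
    (a + b).eval s = a.eval s + b.eval s := rfl
@[simp] theorem NatExpr.eval_sub (s : State) (a b : NatExpr) :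
    (a - b).eval s = a.eval s - b.eval s := rfl
@[simp] theorem NatExpr.eval_mul (s : State) (a b : NatExpr) :
    (a * b).eval s = a.eval s * b.eval s := rfl
@[simp] theorem RealExpr.eval_coe (s : State) (a : NatExpr) :
    (RealExpr.ofNat a).eval s = (a.eval s : ℝ) := rfl
@[simp] theorem RealExpr.eval_add (s : State) (a b : RealExpr) :
    (a + b).eval s = a.eval s + b.eval s := rfl
@[simp] theorem RealExpr.eval_sub (s : State) (a b : RealExpr) :
    (a - b).eval s = a.eval s - b.eval s := rfl
@[simp] theorem RealExpr.eval_mul (s : State) (a b : RealExpr) :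
    (a * b).eval s = a.eval s * b.eval s := rfl
@[simp] theorem RealExpr.eval_div (s : State) (a b : RealExpr) :
    (a / b).eval s = a.eval s / b.eval s := rfl
@[simp] theorem Test.holds_realLt (s : State) (a b : RealExpr) :
    (Test.realLt a b).Holds s ↔ a.eval s < b.eval s := Iff.rfl
@[simp] theorem Test.holds_natLt (s : State) (a b : NatExpr) :
    (Test.natLt a b).Holds s ↔ a.eval s < b.eval s := Iff.rfl

/-- `|e|` -/
def absE (e : RealExpr) : RealExpr := .sqrt (e * e)

/-- the sign of `e` -/
def sgnE (e : RealExpr) : RealExpr := e / absE e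

@[simp] theorem absE_eval (s : State) (e : RealExpr) : (absE e).eval s = |e.eval s| := by
  change Real.sqrt (e.eval s * e.eval s) = _
  exact Real.sqrt_mul_self_eq_abs _

@[simp] theorem sgnE_eval (s : State) (e : RealExpr) :
    (sgnE e).eval s = RobustRegression.sgn (e.eval s) := by
  simp [sgnE, RobustRegression.sgn]

/-- register -/
abbrev rg (i : ℕ) : NatExpr := .reg i

/-- numeral -/
abbrev nc (c : ℕ) : NatExpr := .const c

/-- scalar variable -/
abbrev sc (a : ℕ) : RealExpr := rd a (nc 0)

open RobustRegression Finset

/-- Registers and scalars that hold the parameters. -/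
structure Ctx (n d k q N m : ℕ) (η : ℝ) (s : State) : Prop where
  reg_n : s.nat 0 = n
  reg_k : s.nat 1 = k
  reg_d : s.nat 2 = d
  reg_N : s.nat 3 = N
  reg_m : s.nat 4 = m
  reg_q : s.nat 5 = q
  lam : s.arr 3 0 = lamOf k q
  eta : s.arr 2 0 = η

theorem Ctx.frame {n d k q N m : ℕ} {η : ℝ} {s s' : State} (h : Ctx n d k q N m η s) {p : Prog}
    (hf : Frame p s s') (hp : (p.writesReg 0 || p.writesReg 1 || p.writesReg 2 || p.writesReg 3 ||
      p.writesReg 4 || p.writesReg 5 || p.writesTag 3 || p.writesTag 2) = false) :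
    Ctx n d k q N m η s' := by
  simp only [Bool.or_eq_false_iff] at hp
  obtain ⟨⟨⟨⟨⟨⟨⟨h0, h1⟩, h2⟩, h3⟩, h4⟩, h5⟩, h6⟩, h7⟩ := hp
  exact ⟨(hf.nat _ h0).trans h.reg_n, (hf.nat _ h1).trans h.reg_k, (hf.nat _ h2).trans h.reg_d,
    (hf.nat _ h3).trans h.reg_N, (hf.nat _ h4).trans h.reg_m, (hf.nat _ h5).trans h.reg_q,
    (congrFun (hf.arr _ h6) 0).trans h.lam, (congrFun (hf.arr _ h7) 0).trans h.eta⟩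

/-- The sample matrix and the observations. -/
structure Data (d m : ℕ) (A : ℕ → ℕ → ℝ) (y : ℕ → ℝ) (s : State) : Prop where
  mat : ∀ r < m, ∀ l < d, s.arr 10 (r * d + l) = A r l
  obs : ∀ r < m, s.arr 11 r = y r

theorem Data.frame {d m : ℕ} {A : ℕ → ℕ → ℝ} {y : ℕ → ℝ} {s s' : State} (h : Data d m A y s)
    {p : Prog} (hf : Frame p s s') (hp : (p.writesTag 10 || p.writesTag 11) = false) :
    Data d m A y s' := by
  simp only [Bool.or_eq_false_iff] at hp
  exact ⟨fun r hr l hl => by rw [hf.arr _ hp.1]; exact h.mat r hr l hl,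
    fun r hr => by rw [hf.arr _ hp.2]; exact h.obs r hr⟩

variable {o : ℕ → Example} {Y : ℕ}

section Descent

variable {n d k q N m : ℕ} {η : ℝ} {A : ℕ → ℕ → ℝ} {y : ℕ → ℝ}

/-- residuals of the coefficients in the array `b` -/
def residualProg (b : ℕ) : Prog :=
  forLoop 11 (rg 4) (.seq
    (sumLoop 12 (rg 2) 6 (rd 10 (rg 11 * rg 2 + rg 12) * rd b (rg 12)))
    (wr 16 (rg 11) (sc 6 - rd 11 (rg 11))))

theorem exists_runs_residualProg {b : ℕ} (hb : b = 12 ∨ b = 13) {s : State}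
    (hc : Ctx n d k q N m η s) (hD : Data d m A y s) (hdY : d ≤ Y) (hmY : m ≤ Y) (hY : 1 ≤ Y)
    {c : ℕ → ℝ} (hs : ∀ l < d, s.arr b l = c l) :
    ∃ s', Runs o Y (residualProg b) s s' ∧ ∀ r < m, s'.arr 16 r = rowVal d A c r - y r := by
  have hw : (residualProg b).writesTag b = false := by rcases hb with rfl | rfl <;> rfl
  refine exists_runs_forLoop hY (fun i s' => ∀ r < i, s'.arr 16 r = rowVal d A c r - y r)
    (fun _ _ _ h => h) hmY rfl (fun s' hf => by simp [hf.nat 4 rfl, hc.reg_m]) (by simp) ?_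
  intro i hi s1 hf hr hI
  have hc1 := hc.frame hf rfl
  have hD1 := hD.frame hf rfl
  have hs1 : ∀ l < d, s1.arr b l = c l := fun l hl => by rw [hf.arr b hw]; exact hs l hl
  obtain ⟨s2, hs2, hv⟩ := exists_runs_sumLoop (o := o) (Y := Y) (r := 12) (bnd := rg 2) (acc := 6)
    (e := rd 10 (rg 11 * rg 2 + rg 12) * rd b (rg 12)) hY s1 (fun l => A i l * c l) hdY
    (by norm_num) (fun s' hf' => by simp [hf'.nat 2 rfl, hc1.reg_d])
    (fun l hl s' hf' hr' => by
      have hwb : (sumLoop 12 (rg 2) 6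
          (rd 10 (rg 11 * rg 2 + rg 12) * rd b (rg 12))).writesTag b = false := by
        rcases hb with rfl | rfl <;> rfl
      simp [hf'.nat 2 rfl, hf'.nat 11 rfl, hr, hr', hc1.reg_d, hf'.arr 10 rfl, hf'.arr b hwb,
        hD1.mat i hi l hl, hs1 l hl])
  refine ⟨_, hs2.seq hY (Runs.wr _ _ _ _), fun r hr' => ?_⟩
  rw [State.arr_setArr _ (by norm_num) (by norm_num)]
  have hf2 := hs2.frame
  rcases Nat.lt_succ_iff_lt_or_eq.mp hr' with h | rfl
  · simp [hf2.nat 11 rfl, hr, h.ne, hf2.arr 16 rfl, hI r h]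
  · simp [hf2.nat 11 rfl, hr, hv, hf2.arr 11 rfl, hD1.obs r hi, rowVal]

/-- The arrays hold the state `x` of a descent. -/
structure HoldsDescent (d : ℕ) (x : Descent) (s : State) : Prop where
  cur : ∀ l < d, s.arr 12 l = x.cur l
  best : ∀ l < d, s.arr 13 l = x.best l
  val : s.arr 5 0 = x.val

/-- objective at the current point -/
def objectiveProg : Prog :=
  .seq (sumLoop 11 (rg 4) 6 (absE (rd 16 (rg 11)))) <|
  .seq (sumLoop 11 (rg 2) 7 (absE (rd 12 (rg 11))))
    (wr 20 (nc 0) (sc 6 / (rg 3 : RealExpr) + sc 3 * sc 7))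

theorem exists_runs_objectiveProg {s : State} (hc : Ctx n d k q N m η s) (hdY : d ≤ Y)
    (hmY : m ≤ Y) (hY : 1 ≤ Y) {c : ℕ → ℝ} (hs : ∀ l < d, s.arr 12 l = c l)
    (hr : ∀ r < m, s.arr 16 r = rowVal d A c r - y r) :
    ∃ s', Runs o Y objectiveProg s s' ∧ s'.arr 20 0 = obj m d N (lamOf k q) A y c := by
  obtain ⟨s1, hs1, hv1⟩ := exists_runs_sumLoop (o := o) (Y := Y) (r := 11) (bnd := rg 4) (acc := 6)
    (e := absE (rd 16 (rg 11))) hY s (fun r => |rowVal d A c r - y r|) hmY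
    (by norm_num) (fun s' hf' => by simp [hf'.nat 4 rfl, hc.reg_m])
    (fun r hr1 s' hf' hr' => by simp [hr', hf'.arr 16 rfl, hr r hr1])
  have hc1 := hc.frame hs1.frame rfl
  obtain ⟨s2, hs2, hv2⟩ := exists_runs_sumLoop (o := o) (Y := Y) (r := 11) (bnd := rg 2) (acc := 7)
    (e := absE (rd 12 (rg 11))) hY s1 (fun l => |c l|) hdY
    (by norm_num) (fun s' hf' => by simp [hf'.nat 2 rfl, hc1.reg_d])
    (fun l hl s' hf' hr' => by simp [hr', hf'.arr 12 rfl, hs1.frame.arr 12 rfl, hs l hl])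
  have hc2 := hc1.frame hs2.frame rfl
  refine ⟨_, hs1.seq hY (hs2.seq hY (Runs.wr _ _ _ _)), ?_⟩
  rw [State.arr_setArr _ (by norm_num) (by norm_num)]
  simp [hv2, hs2.frame.arr 6 rfl, hv1, hc2.reg_N, hc2.lam, obj, l1]

/-- keep the best point -/
def keepBestProg : Prog :=
  .ite (.realLt (sc 20) (sc 5))
    (.seq (wr 5 (nc 0) (sc 20)) (mapLoop 11 (rg 2) 13 (rg 11) (rd 12 (rg 11)))) .skip

/-- a step in the direction of a subgradient -/
def moveProg : Prog :=
  forLoop 11 (rg 2) (.seq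
    (sumLoop 12 (rg 4) 6 (rd 10 (rg 12 * rg 2 + rg 11) * sgnE (rd 16 (rg 12))))
    (wr 12 (rg 11) (rd 12 (rg 11) -
      sc 4 * (sc 6 / (rg 3 : RealExpr) + sc 3 * sgnE (rd 12 (rg 11))))))

theorem exists_runs_keepBestProg {s : State} (hc : Ctx n d k q N m η s) (hdY : d ≤ Y)
    (hY : 1 ≤ Y) {step : ℝ} {x : Descent} (hx : HoldsDescent d x s)
    (hv : s.arr 20 0 = obj m d N (lamOf k q) A y x.cur) :
    ∃ s', Runs o Y keepBestProg s s' ∧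
      (∀ l < d, s'.arr 13 l = (descentStep m d N (lamOf k q) A y step x).best l) ∧
      s'.arr 5 0 = (descentStep m d N (lamOf k q) A y step x).val := by
  by_cases h : obj m d N (lamOf k q) A y x.cur < x.val
  · have hw := Runs.wr (o := o) (Y := Y) s 5 (nc 0) (sc 20)
    obtain ⟨s2, hs2, hv2, -⟩ := exists_runs_mapLoop (o := o) (Y := Y) (r := 11) (bnd := rg 2)
      (a := 13) (idx := rg 11) (e := rd 12 (rg 11)) hY (s.setArr 5 ((nc 0).eval s)
        ((sc 20).eval s)) id x.cur hdY (by norm_num) (fun _ _ _ _ h => h)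
      (fun s' hf' => by simp [hf'.nat 2 rfl, hc.reg_d]) (fun l hl s' hf' hr' => by simp [hr'])
      (fun l hl s' hf' hr' _ => by
        simp [hr', hf'.arr 12 rfl, State.arr_setArr, hx.cur l hl])
    refine ⟨s2, Runs.ite_true hY (by simp [hv, hx.val, h]) (hw.seq hY hs2), ?_, ?_⟩
    · simpa [descentStep, h] using hv2
    · rw [hs2.frame.arr 5 rfl, State.arr_setArr _ (by norm_num) (by norm_num)]
      simp [descentStep, h, hv]
  · refine ⟨s, Runs.ite_false hY (by simpa [hv, hx.val] using h) (Runs.skip s), ?_, ?_⟩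
    · simpa [descentStep, h] using hx.best
    · simpa [descentStep, h] using hx.val

theorem exists_runs_moveProg {s : State} (hc : Ctx n d k q N m η s) (hD : Data d m A y s)
    (hdY : d ≤ Y) (hmY : m ≤ Y) (hY : 1 ≤ Y) {step : ℝ} (hstep : s.arr 4 0 = step) {x : Descent}
    (hx : ∀ l < d, s.arr 12 l = x.cur l)
    (hr : ∀ r < m, s.arr 16 r = rowVal d A x.cur r - y r) :
    ∃ s', Runs o Y moveProg s s' ∧
      ∀ l < d, s'.arr 12 l = (descentStep m d N (lamOf k q) A y step x).cur l := by
  obtain ⟨s', hs', h⟩ := exists_runs_forLoop (o := o) (Y := Y) (r := 11) (bnd := rg 2)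
    (p := .seq (sumLoop 12 (rg 4) 6 (rd 10 (rg 12 * rg 2 + rg 11) * sgnE (rd 16 (rg 12))))
      (wr 12 (rg 11) (rd 12 (rg 11) -
        sc 4 * (sc 6 / (rg 3 : RealExpr) + sc 3 * sgnE (rd 12 (rg 11)))))) hY
    (fun i s' => (∀ l < i, s'.arr 12 l = (descentStep m d N (lamOf k q) A y step x).cur l) ∧
      ∀ l < d, i ≤ l → s'.arr 12 l = x.cur l)
    (fun _ _ _ h => h) hdY (s := s) rfl (fun s' hf => by simp [hf.nat 2 rfl, hc.reg_d])
    ⟨by simp, fun l hl _ => hx l hl⟩ (by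
      rintro i hi s1 hf hr1 ⟨hI, hI'⟩
      have hc1 := hc.frame hf rfl
      have hD1 := hD.frame hf rfl
      obtain ⟨s2, hs2, hv⟩ := exists_runs_sumLoop (o := o) (Y := Y) (r := 12) (bnd := rg 4)
        (acc := 6) (e := rd 10 (rg 12 * rg 2 + rg 11) * sgnE (rd 16 (rg 12))) hY s1
        (fun r => A r i * sgn (rowVal d A x.cur r - y r)) hmY
        (by norm_num) (fun s' hf' => by simp [hf'.nat 4 rfl, hc1.reg_m])
        (fun r hr2 s' hf' hr' => by
          simp [hf'.nat 2 rfl, hf'.nat 11 rfl, hr1, hr', hc1.reg_d, hf'.arr 10 rfl, hf'.arr 16 rfl,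
            hD1.mat r hr2 i hi, hf.arr 16 rfl, hr r hr2])
      have hf2 := hs2.frame
      have hc2 := hc1.frame hf2 rfl
      refine ⟨_, hs2.seq hY (Runs.wr _ _ _ _), fun l hl => ?_, fun l hl hil => ?_⟩
      · rw [State.arr_setArr _ (by norm_num) (by norm_num)]
        rcases Nat.lt_succ_iff_lt_or_eq.mp hl with h | rfl
        · simp [hf2.nat 11 rfl, hr1, h.ne, hf2.arr 12 rfl, hI l h]
        · simp [hf2.nat 11 rfl, hr1, hv, hf2.arr 12 rfl, hI' l hi le_rfl, hc2.reg_N, hc2.lam,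
            hf2.arr 4 rfl, hf.arr 4 rfl, hstep, descentStep, grad]
      · rw [State.arr_setArr _ (by norm_num) (by norm_num)]
        have hne : l ≠ i := by omega
        simp [hf2.nat 11 rfl, hr1, hne, hf2.arr 12 rfl, hI' l hl (by omega)])
  exact ⟨s', hs', h.1⟩

def descentStepProg : Prog :=
  .seq (residualProg 12) <| .seq objectiveProg <| .seq keepBestProg moveProg

theorem exists_runs_descentStepProg {s : State} (hc : Ctx n d k q N m η s) (hD : Data d m A y s)
    (hdY : d ≤ Y) (hmY : m ≤ Y) (hY : 1 ≤ Y) {step : ℝ} (hstep : s.arr 4 0 = step) {x : Descent}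
    (hx : HoldsDescent d x s) :
    ∃ s', Runs o Y descentStepProg s s' ∧
      HoldsDescent d (descentStep m d N (lamOf k q) A y step x) s' := by
  obtain ⟨s1, hs1, h1⟩ := exists_runs_residualProg (o := o) (Or.inl rfl) hc hD hdY hmY hY hx.cur
  have hf1 := hs1.frame
  have hc1 := hc.frame hf1 rfl
  obtain ⟨s2, hs2, h2⟩ := exists_runs_objectiveProg (o := o) hc1 hdY hmY hY (c := x.cur)
    (by rw [hf1.arr 12 rfl]; exact hx.cur) h1
  have hf2 := hs2.frame
  have hc2 := hc1.frame hf2 rfl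
  obtain ⟨s3, hs3, h3, h3'⟩ := exists_runs_keepBestProg (o := o) (step := step) (x := x) hc2 hdY hY
    ⟨by rw [hf2.arr 12 rfl, hf1.arr 12 rfl]; exact hx.cur,
      by rw [hf2.arr 13 rfl, hf1.arr 13 rfl]; exact hx.best,
      by rw [hf2.arr 5 rfl, hf1.arr 5 rfl]; exact hx.val⟩ h2
  have hf3 := hs3.frame
  obtain ⟨s4, hs4, h4⟩ := exists_runs_moveProg (o := o) (step := step) (x := x)
    (hc2.frame hf3 rfl) (((hD.frame hf1 rfl).frame hf2 rfl).frame hf3 rfl) hdY hmY hY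
    (by rw [hf3.arr 4 rfl, hf2.arr 4 rfl, hf1.arr 4 rfl]; exact hstep)
    (by rw [hf3.arr 12 rfl, hf2.arr 12 rfl, hf1.arr 12 rfl]; exact hx.cur)
    (by rw [hf3.arr 16 rfl, hf2.arr 16 rfl]; exact h1)
  have hf4 := hs4.frame
  exact ⟨s4, hs1.seq hY (hs2.seq hY (hs3.seq hY hs4)), h4, by rw [hf4.arr 13 rfl]; exact h3,
    by rw [hf4.arr 5 rfl]; exact h3'⟩

/-- as many steps as register 7 says -/
def descentProg : Prog := forLoop 10 (rg 7) descentStepProg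

theorem exists_runs_descentProg {s : State} (hc : Ctx n d k q N m η s) (hD : Data d m A y s)
    (hdY : d ≤ Y) (hmY : m ≤ Y) (hY : 1 ≤ Y) {step : ℝ} (hstep : s.arr 4 0 = step) {x : Descent}
    (hx : HoldsDescent d x s) {T : ℕ} (hT : s.nat 7 = T) (hTY : T ≤ Y) :
    ∃ s', Runs o Y descentProg s s' ∧
      HoldsDescent d (descent m d N (lamOf k q) A y step x T) s' := by
  refine exists_runs_forLoop hY
    (fun i s' => HoldsDescent d (descent m d N (lamOf k q) A y step x i) s')
    (fun _ _ _ h => ⟨h.cur, h.best, h.val⟩) hTY rfl (fun s' hf => by simp [hf.nat 7 rfl, hT]) hx ?_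
  intro i hi s1 hf hr hI
  rw [descent_succ]
  exact exists_runs_descentStepProg (hc.frame hf rfl) (hD.frame hf rfl) hdY hmY hY
    (by rw [hf.arr 4 rfl]; exact hstep) hI

end Descent

end RealRAM

namespace RealRAM
open RobustRegression Finset

theorem rowMajor_inj {w i j i' j' : ℕ} (hj : j < w) (hj' : j' < w) (h : i * w + j = i' * w + j') :
    i = i' ∧ j = j' := by
  have hw : 0 < w := by omega
  have h1 : (i * w + j) / w = i := by
    rw [mul_comm, Nat.mul_add_div hw, Nat.div_eq_of_lt hj, add_zero]
  have h2 : (i' * w + j') / w = i' := by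
    rw [mul_comm, Nat.mul_add_div hw, Nat.div_eq_of_lt hj', add_zero]
  have h3 : i = i' := by rw [← h1, ← h2, h]
  subst h3
  exact ⟨rfl, by omega⟩

variable {o : ℕ → Example} {Y : ℕ}

/-- `for r₁ < b₁ do for r₂ < b₂ do a[r₁ * w + r₂] := e` -/
def mapLoop₂ (r₁ : ℕ) (b₁ : NatExpr) (r₂ : ℕ) (b₂ : NatExpr) (a : ℕ) (w : NatExpr)
    (e : RealExpr) : Prog :=
  forLoop r₁ b₁ (mapLoop r₂ b₂ a (rg r₁ * w + rg r₂) e)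

theorem exists_runs_mapLoop₂ {r₁ r₂ : ℕ} {b₁ b₂ w : NatExpr} {a : ℕ} {e : RealExpr}
    (hY : 1 ≤ Y) (s : State) (v : ℕ → ℕ → ℝ) {m n : ℕ} (hm : m ≤ Y) (hn : n ≤ Y) (ha : a < 64)
    (hr : r₁ ≠ r₂)
    (hb₁ : ∀ s', Frame (mapLoop₂ r₁ b₁ r₂ b₂ a w e) s s' → b₁.eval s' = m)
    (hb₂ : ∀ s', Frame (mapLoop₂ r₁ b₁ r₂ b₂ a w e) s s' → b₂.eval s' = n)
    (hw : ∀ s', Frame (mapLoop₂ r₁ b₁ r₂ b₂ a w e) s s' → w.eval s' = n)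
    (he : ∀ i < m, ∀ j < n, ∀ s', Frame (mapLoop₂ r₁ b₁ r₂ b₂ a w e) s s' → s'.nat r₁ = i →
      s'.nat r₂ = j → s'.arr a (i * n + j) = s.arr a (i * n + j) → e.eval s' = v i j) :
    ∃ s', Runs o Y (mapLoop₂ r₁ b₁ r₂ b₂ a w e) s s' ∧
      ∀ i < m, ∀ j < n, s'.arr a (i * n + j) = v i j := by
  obtain ⟨s', hs', h⟩ := exists_runs_forLoop (o := o) (Y := Y) (r := r₁) (bnd := b₁)
    (p := mapLoop r₂ b₂ a (rg r₁ * w + rg r₂) e) hY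
    (fun i s' => (∀ i' < i, ∀ j < n, s'.arr a (i' * n + j) = v i' j) ∧
      ∀ i', i ≤ i' → ∀ j < n, s'.arr a (i' * n + j) = s.arr a (i' * n + j))
    (fun _ _ _ h => h) hm (s := s) (by simp [mapLoop, forLoop, Prog.writesReg, wr, hr.symm]) hb₁
    ⟨by simp, fun _ _ _ _ => rfl⟩ (by
      rintro i hi s1 hf hr1 ⟨hI, hI'⟩
      have hfr : ∀ s', Frame (mapLoop r₂ b₂ a (rg r₁ * w + rg r₂) e) s1 s' →
          Frame (mapLoop₂ r₁ b₁ r₂ b₂ a w e) s s' ∧ s'.nat r₁ = i := fun s' hf' =>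
        ⟨hf.trans hf'.seq_left.loop.seq_right,
          (hf'.nat r₁ (by simp [mapLoop, forLoop, Prog.writesReg, wr, hr.symm])).trans hr1⟩
      obtain ⟨s2, hs2, h2, h2'⟩ := exists_runs_mapLoop (o := o) (Y := Y) (r := r₂) (bnd := b₂)
        (a := a) (idx := rg r₁ * w + rg r₂) (e := e) hY s1 (fun j => i * n + j) (v i) hn ha
        (fun _ _ _ _ h => by simpa using h) (fun s' hf' => hb₂ s' (hfr s' hf').1)
        (fun j hj s' hf' hr' => by simp [(hfr s' hf').2, hr', hw s' (hfr s' hf').1])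
        (fun j hj s' hf' hr' hold => he i hi j hj s' (hfr s' hf').1 (hfr s' hf').2 hr' (by
          rw [hold _ fun j' hj' => by simpa using hj'.ne', hI' i le_rfl j hj]))
      refine ⟨s2, hs2, fun i' hi' j hj => ?_, fun i' hi' j hj => ?_⟩
      · rcases Nat.lt_succ_iff_lt_or_eq.mp hi' with h | rfl
        · rw [h2' _ fun j' hj' hh => h.ne (rowMajor_inj hj hj' hh).1]
          exact hI i' h j hj
        · exact h2 j hj
      · rw [h2' _ fun j' hj' hh => (by omega : i' ≠ i) (rowMajor_inj hj hj' hh).1]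
        exact hI' i' (by omega) j hj)
  exact ⟨s', hs', h.1⟩

section LeastSquares

variable {n d k q N m : ℕ} {η : ℝ} {A : ℕ → ℕ → ℝ} {y w : ℕ → ℝ}

/-- The arrays 19 and 21 hold the columns `x`. -/
structure HoldsColumns (d m : ℕ) (x : Columns) (s : State) : Prop where
  samp : ∀ j ≤ d, ∀ r < m, s.arr 19 (j * m + r) = x.samp j r
  coef : ∀ j ≤ d, ∀ i < d, s.arr 21 (j * d + i) = x.coef j i

def gsInitProg : Prog :=
  .seq (mapLoop₂ 11 (rg 2) 12 (rg 4) 19 (rg 4) (rd 10 (rg 12 * rg 2 + rg 11))) <|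
  .seq (mapLoop 12 (rg 4) 19 (rg 2 * rg 4 + rg 12) (rd 11 (rg 12)))
    (mapLoop₂ 11 (rg 2 + nc 1) 12 (rg 2) 21 (rg 2)
      (nc 1 - ((rg 12 - rg 11) + (rg 11 - rg 12)) : NatExpr))

theorem exists_runs_gsInitProg {s : State} (hc : Ctx n d k q N m η s) (hD : Data d m A y s)
    (hdY : d + 1 ≤ Y) (hmY : m ≤ Y) :
    ∃ s', Runs o Y gsInitProg s s' ∧ HoldsColumns d m (gsInit d A y) s' := by
  have hY : 1 ≤ Y := by omega
  obtain ⟨s1, hs1, h1⟩ := exists_runs_mapLoop₂ (o := o) (Y := Y) (r₁ := 11) (r₂ := 12)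
    (b₁ := rg 2) (b₂ := rg 4) (w := rg 4) (a := 19) (e := rd 10 (rg 12 * rg 2 + rg 11)) hY s
    (fun j r => A r j) (m := d) (n := m) (by omega) hmY (by norm_num) (by norm_num)
    (fun s' hf => by simp [hf.nat 2 rfl, hc.reg_d]) (fun s' hf => by simp [hf.nat 4 rfl, hc.reg_m])
    (fun s' hf => by simp [hf.nat 4 rfl, hc.reg_m])
    (fun j hj r hr s' hf h1 h2 _ => by
      simp [h1, h2, hf.nat 2 rfl, hc.reg_d, hf.arr 10 rfl, hD.mat r hr j hj])
  have hc1 := hc.frame hs1.frame rfl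
  have hD1 := hD.frame hs1.frame rfl
  obtain ⟨s2, hs2, h2, h2'⟩ := exists_runs_mapLoop (o := o) (Y := Y) (r := 12)
    (bnd := rg 4) (a := 19) (idx := rg 2 * rg 4 + rg 12) (e := rd 11 (rg 12)) hY s1
    (fun r => d * m + r) y hmY (by norm_num) (fun _ _ _ _ h => by simpa using h)
    (fun s' hf => by simp [hf.nat 4 rfl, hc1.reg_m])
    (fun r _ s' hf h => by simp [hf.nat 4 rfl, hf.nat 2 rfl, hc1.reg_m, hc1.reg_d, h])
    (fun r hr s' hf h _ => by simp [h, hf.arr 11 rfl, hD1.obs r hr])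
  have hc2 := hc1.frame hs2.frame rfl
  obtain ⟨s3, hs3, h3⟩ := exists_runs_mapLoop₂ (o := o) (Y := Y) (r₁ := 11) (r₂ := 12)
    (b₁ := rg 2 + nc 1) (b₂ := rg 2) (w := rg 2) (a := 21)
    (e := (nc 1 - ((rg 12 - rg 11) + (rg 11 - rg 12)) : NatExpr)) hY s2
    (gsInit d A y).coef (m := d + 1) (n := d) hdY (by omega) (by norm_num) (by norm_num)
    (fun s' hf => by simp [hf.nat 2 rfl, hc2.reg_d]) (fun s' hf => by simp [hf.nat 2 rfl, hc2.reg_d])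
    (fun s' hf => by simp [hf.nat 2 rfl, hc2.reg_d])
    (fun j hj i hi s' hf h1 h2 _ => by simp [h1, h2, gsInit])
  refine ⟨s3, hs1.seq hY (hs2.seq hY hs3), fun j hj r hr => ?_,
    fun j hj i hi => h3 j (by omega) i hi⟩
  rw [hs3.frame.arr 19 rfl]
  rcases hj.lt_or_eq with h | rfl
  · rw [h2' _ fun r' hr' hh => h.ne (rowMajor_inj hr hr' hh).1, h1 j h r hr]
    simp [gsInit, h]
  · rw [h2 r hr]
    simp [gsInit]

def gsColumnProg : Prog :=
  .seq (sumLoop 12 (rg 4) 6 (rd 18 (rg 12) * rd 19 (rg 13 * rg 4 + rg 12) *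
    rd 19 (rg 11 * rg 4 + rg 12))) <|
  .seq (wr 22 (nc 0) (sc 6 / sc 15 * (nc 1 - (nc 1 - (rg 13 - rg 11)) : NatExpr))) <|
  .seq (mapLoop 12 (rg 4) 19 (rg 13 * rg 4 + rg 12)
    (rd 19 (rg 13 * rg 4 + rg 12) - sc 22 * rd 19 (rg 11 * rg 4 + rg 12)))
    (mapLoop 12 (rg 2) 21 (rg 13 * rg 2 + rg 12)
      (rd 21 (rg 13 * rg 2 + rg 12) - sc 22 * rd 21 (rg 11 * rg 2 + rg 12)))

theorem exists_runs_gsColumnProg {s : State} (hc : Ctx n d k q N m η s)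
    (hdY : d + 1 ≤ Y) (hmY : m ≤ Y) (hw : ∀ r < m, s.arr 18 r = w r) {x : Columns} {l j : ℕ}
    (hl : s.nat 11 = l) (hj : s.nat 13 = j)
    (hjs : ∀ r < m, s.arr 19 (j * m + r) = x.samp j r)
    (hls : ∀ r < m, s.arr 19 (l * m + r) = x.samp l r)
    (hjc : ∀ i < d, s.arr 21 (j * d + i) = x.coef j i)
    (hlc : ∀ i < d, s.arr 21 (l * d + i) = x.coef l i)
    (hden : s.arr 15 0 = wip m w (x.samp l) (x.samp l)) :
    ∃ s', Runs o Y gsColumnProg s s' ∧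
      (∀ r < m, s'.arr 19 (j * m + r) = (gsStep m w x l).samp j r) ∧
      (∀ i < d, s'.arr 21 (j * d + i) = (gsStep m w x l).coef j i) ∧
      (∀ j' ≠ j, ∀ r < m, s'.arr 19 (j' * m + r) = s.arr 19 (j' * m + r)) ∧
      (∀ j' ≠ j, ∀ i < d, s'.arr 21 (j' * d + i) = s.arr 21 (j' * d + i)) := by
  have hY : 1 ≤ Y := by omega
  obtain ⟨s1, hs1, h1⟩ := exists_runs_sumLoop (o := o) (Y := Y) (r := 12) (bnd := rg 4) (acc := 6)
    (e := rd 18 (rg 12) * rd 19 (rg 13 * rg 4 + rg 12) * rd 19 (rg 11 * rg 4 + rg 12)) hY s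
    (fun r => w r * x.samp j r * x.samp l r) hmY (by norm_num)
    (fun s' hf => by simp [hf.nat 4 rfl, hc.reg_m])
    (fun r hr s' hf h => by
      simp [h, hf.nat 4 rfl, hf.nat 11 rfl, hf.nat 13 rfl, hl, hj, hc.reg_m, hf.arr 18 rfl,
        hf.arr 19 rfl, hw r hr, hjs r hr, hls r hr])
  have hf1 := hs1.frame
  have hw1 := Runs.wr (o := o) (Y := Y) s1 22 (nc 0)
    (sc 6 / sc 15 * (nc 1 - (nc 1 - (rg 13 - rg 11)) : NatExpr))
  set s2 := s1.setArr 22 ((nc 0).eval s1)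
    ((sc 6 / sc 15 * (nc 1 - (nc 1 - (rg 13 - rg 11)) : NatExpr)).eval s1) with hs2
  have hf2 := hw1.frame
  have h2 : s2.arr 22 0 = gsCoeff m w x.samp l j := by
    rw [hs2, State.arr_setArr _ (by norm_num) (by norm_num)]
    simp [h1, hf1.arr 15 rfl, hden, hf1.nat 13 rfl, hf1.nat 11 rfl, hl, hj, gsCoeff, wip]
  have hc2 := (hc.frame hf1 rfl).frame hf2 rfl
  have hl2 : s2.nat 11 = l := by rw [hf2.nat 11 rfl, hf1.nat 11 rfl, hl]
  have hj2 : s2.nat 13 = j := by rw [hf2.nat 13 rfl, hf1.nat 13 rfl, hj]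
  have h19 : s2.arr 19 = s.arr 19 := by rw [hf2.arr 19 rfl, hf1.arr 19 rfl]
  have h21 : s2.arr 21 = s.arr 21 := by rw [hf2.arr 21 rfl, hf1.arr 21 rfl]
  obtain ⟨s3, hs3, h3, h3'⟩ := exists_runs_mapLoop (o := o) (Y := Y) (r := 12)
    (bnd := rg 4) (a := 19) (idx := rg 13 * rg 4 + rg 12)
    (e := rd 19 (rg 13 * rg 4 + rg 12) - sc 22 * rd 19 (rg 11 * rg 4 + rg 12)) hY s2
    (fun r => j * m + r) (fun r => x.samp j r - gsCoeff m w x.samp l j * x.samp l r) hmY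
    (by norm_num) (fun _ _ _ _ h => by simpa using h)
    (fun s' hf => by simp [hf.nat 4 rfl, hc2.reg_m])
    (fun r _ s' hf h => by simp [hf.nat 4 rfl, hf.nat 13 rfl, hc2.reg_m, hj2, h])
    (fun r hr s' hf h hold => by
      have e1 : s'.arr 19 (j * m + r) = x.samp j r := by
        rw [hold _ fun r' hr' => by simpa using hr'.ne', h19, hjs r hr]
      have e2 : s'.arr 19 (l * m + r) = x.samp l r := by
        rw [hold _ fun r' hr' hh =>
          hr'.ne' (rowMajor_inj hr (hr'.trans hr) hh).2, h19, hls r hr]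
      simp [h, hf.nat 4 rfl, hf.nat 13 rfl, hf.nat 11 rfl, hc2.reg_m, hj2, hl2, e1, e2,
        hf.arr 22 rfl, h2])
  have hf3 := hs3.frame
  have hc3 := hc2.frame hf3 rfl
  obtain ⟨s4, hs4, h4, h4'⟩ := exists_runs_mapLoop (o := o) (Y := Y) (r := 12)
    (bnd := rg 2) (a := 21) (idx := rg 13 * rg 2 + rg 12)
    (e := rd 21 (rg 13 * rg 2 + rg 12) - sc 22 * rd 21 (rg 11 * rg 2 + rg 12)) hY s3
    (fun i => j * d + i) (fun i => x.coef j i - gsCoeff m w x.samp l j * x.coef l i)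
    (b := d) (by omega)
    (by norm_num) (fun _ _ _ _ h => by simpa using h)
    (fun s' hf => by simp [hf.nat 2 rfl, hc3.reg_d])
    (fun r _ s' hf h => by
      simp [hf.nat 2 rfl, hf.nat 13 rfl, hc3.reg_d, hf3.nat 13 rfl, hj2, h])
    (fun r hr s' hf h hold => by
      have e1 : s'.arr 21 (j * d + r) = x.coef j r := by
        rw [hold _ fun r' hr' => by simpa using hr'.ne', hf3.arr 21 rfl, h21, hjc r hr]
      have e2 : s'.arr 21 (l * d + r) = x.coef l r := by
        rw [hold _ fun r' hr' hh =>
          hr'.ne' (rowMajor_inj hr (hr'.trans hr) hh).2, hf3.arr 21 rfl, h21, hlc r hr]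
      simp [h, hf.nat 2 rfl, hf.nat 13 rfl, hf.nat 11 rfl, hf3.nat 13 rfl, hf3.nat 11 rfl,
        hc3.reg_d, hj2, hl2, e1, e2, hf.arr 22 rfl, hf3.arr 22 rfl, h2])
  have hf4 := hs4.frame
  refine ⟨s4, hs1.seq hY (hw1.seq hY (hs3.seq hY hs4)), fun r hr => ?_, h4,
    fun j' hj' r hr => ?_, fun j' hj' i hi => ?_⟩
  · rw [hf4.arr 19 rfl]
    exact h3 r hr
  · rw [hf4.arr 19 rfl, h3' _ fun r' hr' hh => hj' (rowMajor_inj hr hr' hh).1, h19]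
  · rw [h4' _ fun r' hr' hh => hj' (rowMajor_inj hi hr' hh).1, hf3.arr 21 rfl, h21]

def gsStepProg : Prog :=
  .seq (sumLoop 12 (rg 4) 15 (rd 18 (rg 12) * rd 19 (rg 11 * rg 4 + rg 12) *
    rd 19 (rg 11 * rg 4 + rg 12)))
    (forLoop 13 (rg 2 + nc 1) gsColumnProg)

theorem exists_runs_gsStepProg {s : State} (hc : Ctx n d k q N m η s)
    (hdY : d + 1 ≤ Y) (hmY : m ≤ Y) (hw : ∀ r < m, s.arr 18 r = w r) {x : Columns} {l : ℕ}
    (hld : l < d) (hl : s.nat 11 = l) (hx : HoldsColumns d m x s) :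
    ∃ s', Runs o Y gsStepProg s s' ∧ HoldsColumns d m (gsStep m w x l) s' := by
  have hY : 1 ≤ Y := by omega
  obtain ⟨s1, hs1, h1⟩ := exists_runs_sumLoop (o := o) (Y := Y) (r := 12) (bnd := rg 4) (acc := 15)
    (e := rd 18 (rg 12) * rd 19 (rg 11 * rg 4 + rg 12) * rd 19 (rg 11 * rg 4 + rg 12)) hY s
    (fun r => w r * x.samp l r * x.samp l r) hmY (by norm_num)
    (fun s' hf => by simp [hf.nat 4 rfl, hc.reg_m])
    (fun r hr s' hf h => by
      simp [h, hf.nat 4 rfl, hf.nat 11 rfl, hl, hc.reg_m, hf.arr 18 rfl,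
        hf.arr 19 rfl, hw r hr, hx.samp l hld.le r hr])
  have hf1 := hs1.frame
  have hc1 := hc.frame hf1 rfl
  obtain ⟨s2, hs2, h2⟩ := exists_runs_forLoop (o := o) (Y := Y) (r := 13) (bnd := rg 2 + nc 1)
    (p := gsColumnProg) hY
    (fun j s' => (∀ j' < j, (∀ r < m, s'.arr 19 (j' * m + r) = (gsStep m w x l).samp j' r) ∧
        ∀ i < d, s'.arr 21 (j' * d + i) = (gsStep m w x l).coef j' i) ∧
      ∀ j' ≤ d, j ≤ j' → (∀ r < m, s'.arr 19 (j' * m + r) = x.samp j' r) ∧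
        ∀ i < d, s'.arr 21 (j' * d + i) = x.coef j' i)
    (fun _ _ _ h => h) hdY (s := s1) rfl (fun s' hf => by simp [hf.nat 2 rfl, hc1.reg_d])
    ⟨by simp, fun j hj _ => ⟨by rw [hf1.arr 19 rfl]; exact hx.samp j hj,
      by rw [hf1.arr 21 rfl]; exact hx.coef j hj⟩⟩ (by
      rintro j hj s' hf hr ⟨hI, hI'⟩
      have hcol : (∀ r < m, s'.arr 19 (l * m + r) = x.samp l r) ∧
          ∀ i < d, s'.arr 21 (l * d + i) = x.coef l i := by
        rcases lt_or_ge l j with h | h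
        · have := hI l h
          simpa [gsStep, gsCoeff_of_le] using this
        · exact hI' l hld.le h
      obtain ⟨s'', hs'', a1, a2, a3, a4⟩ := exists_runs_gsColumnProg (o := o) (Y := Y) (w := w)
        (hc1.frame hf rfl) hdY hmY (by rw [hf.arr 18 rfl, hf1.arr 18 rfl]; exact hw) (x := x)
        (by rw [hf.nat 11 rfl, hf1.nat 11 rfl]; exact hl) hr (hI' j (by omega) le_rfl).1 hcol.1
        (hI' j (by omega) le_rfl).2 hcol.2 (by rw [hf.arr 15 rfl, h1]; rfl)
      refine ⟨s'', hs'', fun j' hj' => ?_, fun j' hj' hjj' => ?_⟩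
      · rcases Nat.lt_succ_iff_lt_or_eq.mp hj' with h | rfl
        · exact ⟨fun r hr => (a3 j' h.ne r hr).trans ((hI j' h).1 r hr),
            fun i hi => (a4 j' h.ne i hi).trans ((hI j' h).2 i hi)⟩
        · exact ⟨a1, a2⟩
      · have hne : j' ≠ j := by omega
        exact ⟨fun r hr => (a3 j' hne r hr).trans ((hI' j' hj' (by omega)).1 r hr),
          fun i hi => (a4 j' hne i hi).trans ((hI' j' hj' (by omega)).2 i hi)⟩)
  exact ⟨s2, hs1.seq hY hs2, fun j hj => (h2.1 j (by omega)).1, fun j hj => (h2.1 j (by omega)).2⟩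

/-- least squares fit: the coefficients in the array 12, the total residual in 14 -/
def leastSquaresProg : Prog :=
  .seq gsInitProg <| .seq (forLoop 11 (rg 2) gsStepProg) <|
  .seq (mapLoop 12 (rg 2) 12 (rg 12)
    (((nc 0 : RealExpr) - rd 21 (rg 2 * rg 2 + rg 12)) * rd 17 (rg 12)))
    (sumLoop 12 (rg 4) 14 (rd 18 (rg 12) * absE (rd 19 (rg 2 * rg 4 + rg 12))))

theorem exists_runs_leastSquaresProg {s : State} (hc : Ctx n d k q N m η s) (hD : Data d m A y s)
    (hdY : d + 1 ≤ Y) (hmY : m ≤ Y) (hw : ∀ r < m, s.arr 18 r = w r) {mask : ℕ → ℝ}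
    (hmask : ∀ l < d, s.arr 17 l = mask l) :
    ∃ s', Runs o Y leastSquaresProg s s' ∧
      (∀ l < d, s'.arr 12 l = lsCoef m w d A y l * mask l) ∧ s'.arr 14 0 = lsTotal m d A y w := by
  have hY : 1 ≤ Y := by omega
  obtain ⟨s1, hs1, h1⟩ := exists_runs_gsInitProg (o := o) hc hD hdY hmY
  have hf1 := hs1.frame
  have hc1 := hc.frame hf1 rfl
  obtain ⟨s2, hs2, h2⟩ := exists_runs_forLoop (o := o) (Y := Y) (r := 11) (bnd := rg 2)
    (p := gsStepProg) hY (fun l s' => HoldsColumns d m (gs m w (gsInit d A y) l) s')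
    (fun _ _ _ h => ⟨h.samp, h.coef⟩) (b := d) (by omega) (s := s1) rfl
    (fun s' hf => by simp [hf.nat 2 rfl, hc1.reg_d]) h1
    (fun l hl s' hf hr hI => exists_runs_gsStepProg (hc1.frame hf rfl) hdY hmY
      (by rw [hf.arr 18 rfl, hf1.arr 18 rfl]; exact hw) hl hr hI)
  have hf2 := hs2.frame
  have hc2 := hc1.frame hf2 rfl
  obtain ⟨s3, hs3, h3, -⟩ := exists_runs_mapLoop (o := o) (Y := Y) (r := 12)
    (bnd := rg 2) (a := 12) (idx := rg 12)
    (e := ((nc 0 : RealExpr) - rd 21 (rg 2 * rg 2 + rg 12)) * rd 17 (rg 12)) hY s2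
    id (fun l => lsCoef m w d A y l * mask l) (b := d) (by omega) (by norm_num)
    (fun _ _ _ _ h => h) (fun s' hf => by simp [hf.nat 2 rfl, hc2.reg_d])
    (fun l _ s' hf h => by simp [h])
    (fun l hl s' hf h _ => by
      simp [h, hf.nat 2 rfl, hc2.reg_d, hf.arr 21 rfl, h2.coef d le_rfl l hl, lsCoef,
        hf.arr 17 rfl, hf2.arr 17 rfl, hf1.arr 17 rfl, hmask l hl])
  have hf3 := hs3.frame
  have hc3 := hc2.frame hf3 rfl
  obtain ⟨s4, hs4, h4⟩ := exists_runs_sumLoop (o := o) (Y := Y) (r := 12) (bnd := rg 4) (acc := 14)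
    (e := rd 18 (rg 12) * absE (rd 19 (rg 2 * rg 4 + rg 12))) hY s3
    (fun r => w r * |lsRes m w d A y r|) hmY (by norm_num)
    (fun s' hf => by simp [hf.nat 4 rfl, hc3.reg_m])
    (fun r hr s' hf h => by
      simp [h, hf.nat 4 rfl, hf.nat 2 rfl, hc3.reg_m, hc3.reg_d, hf.arr 18 rfl, hf3.arr 18 rfl,
        hf2.arr 18 rfl, hf1.arr 18 rfl, hw r hr, hf.arr 19 rfl, hf3.arr 19 rfl,
        h2.samp d le_rfl r hr, lsRes])
  exact ⟨s4, hs1.seq hY (hs2.seq hY (hs3.seq hY hs4)), by rw [hs4.frame.arr 12 rfl]; exact h3, h4⟩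

end LeastSquares

section Phases

variable {n d k q N m : ℕ} {η : ℝ} {A : ℕ → ℕ → ℝ} {y mask : ℕ → ℝ}

/-- The arrays hold the state `x` of the second stage. -/
structure HoldsPhase (d m : ℕ) (x : Phase) (s : State) : Prop where
  wt : ∀ r < m, s.arr 18 r = x.wt r
  best : ∀ l < d, s.arr 13 l = x.best l
  val : s.arr 5 0 = x.val

/-- drop the samples with large residuals -/
def discardProg : Prog :=
  forLoop 11 (rg 4) (.ite (.realLt (sc 14 / (nc 2 * rg 4 : NatExpr)) (absE (rd 16 (rg 11))))
    (wr 18 (rg 11) (nc 0 : NatExpr)) .skip)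

theorem exists_runs_discardProg {s : State} (hc : Ctx n d k q N m η s) (hmY : m ≤ Y) (hY : 1 ≤ Y)
    {x : Phase} (hw : ∀ r < m, s.arr 18 r = x.wt r) (hτ : s.arr 14 0 = lsTotal m d A y x.wt)
    (hr : ∀ r < m, s.arr 16 r =
      rowVal d A (phaseDescent m d N k q A y mask x).best r - y r) :
    ∃ s', Runs o Y discardProg s s' ∧
      ∀ r < m, s'.arr 18 r = (phaseStep m d N k q A y mask x).wt r := by
  obtain ⟨s', hs', h⟩ := exists_runs_forLoop (o := o) (Y := Y) (r := 11) (bnd := rg 4)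
    (p := .ite (.realLt (sc 14 / (nc 2 * rg 4 : NatExpr)) (absE (rd 16 (rg 11))))
      (wr 18 (rg 11) (nc 0 : NatExpr)) .skip) hY
    (fun i s' => (∀ r < i, s'.arr 18 r = (phaseStep m d N k q A y mask x).wt r) ∧
      ∀ r < m, i ≤ r → s'.arr 18 r = x.wt r)
    (fun _ _ _ h => h) hmY (s := s) rfl (fun s' hf => by simp [hf.nat 4 rfl, hc.reg_m])
    ⟨by simp, fun r hr _ => hw r hr⟩ (by
      rintro i hi s1 hf hr1 ⟨hI, hI'⟩
      have hcond : (Test.realLt (sc 14 / (nc 2 * rg 4 : NatExpr)) (absE (rd 16 (rg 11)))).Holds s1 ↔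
          lsTotal m d A y x.wt / (2 * m) <
            |rowVal d A (phaseDescent m d N k q A y mask x).best i - y i| := by
        simp [hf.arr 14 rfl, hτ, hf.nat 4 rfl, hc.reg_m, hf.arr 16 rfl, hr1, hr i hi]
      by_cases h : lsTotal m d A y x.wt / (2 * m) <
          |rowVal d A (phaseDescent m d N k q A y mask x).best i - y i|
      · refine ⟨_, Runs.ite_true hY (hcond.mpr h) (Runs.wr _ _ _ _), fun r hr' => ?_,
          fun r hr' hir => ?_⟩
        · rw [State.arr_setArr _ (by norm_num) (by norm_num)]
          rcases Nat.lt_succ_iff_lt_or_eq.mp hr' with h' | rfl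
          · simp [hr1, h'.ne, hI r h']
          · simp [hr1, phaseStep, h]
        · have hne : r ≠ i := by omega
          rw [State.arr_setArr _ (by norm_num) (by norm_num)]
          simp [hr1, hne, hI' r hr' (by omega)]
      · refine ⟨s1, Runs.ite_false hY (fun h' => h (hcond.mp h')) (Runs.skip _), fun r hr' => ?_,
          fun r hr' hir => hI' r hr' (by omega)⟩
        rcases Nat.lt_succ_iff_lt_or_eq.mp hr' with h' | rfl
        · exact hI r h'
        · rw [hI' r hi le_rfl]
          simp [phaseStep, h])
  exact ⟨s', hs', h.1⟩

def phaseProg : Prog :=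
  .seq leastSquaresProg <|
  .seq (wr 4 (nc 0) (sc 14 / (nc 288 * rg 4 * rg 1 * rg 5 * rg 2 : NatExpr))) <|
  .seq (.setNat 7 (nc 294912 * (rg 1 * rg 1 * rg 1) * rg 2 * (rg 4 * rg 4) *
    (rg 5 * rg 5 * rg 5 * rg 5))) <|
  .seq descentProg <| .seq (residualProg 13) discardProg

theorem exists_runs_phaseProg {s : State} (hc : Ctx n d k q N m η s) (hD : Data d m A y s)
    (hdY : d + 1 ≤ Y) (hmY : m ≤ Y)
    (hTY : 294912 * (k * k * k) * d * (m * m) * (q * q * q * q) ≤ Y)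
    (hmask : ∀ l < d, s.arr 17 l = mask l) {x : Phase} (hx : HoldsPhase d m x s) :
    ∃ s', Runs o Y phaseProg s s' ∧ HoldsPhase d m (phaseStep m d N k q A y mask x) s' := by
  have hY : 1 ≤ Y := by omega
  obtain ⟨s1, hs1, h1, h1'⟩ := exists_runs_leastSquaresProg (o := o) hc hD hdY hmY hx.wt hmask
  have hf1 := hs1.frame
  have hc1 := hc.frame hf1 rfl
  have hr2 := Runs.wr (o := o) (Y := Y) s1 4 (nc 0)
    (sc 14 / (nc 288 * rg 4 * rg 1 * rg 5 * rg 2 : NatExpr))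
  set s2 := s1.setArr 4 ((nc 0).eval s1)
    ((sc 14 / (nc 288 * rg 4 * rg 1 * rg 5 * rg 2 : NatExpr)).eval s1) with hs2
  have hf2 := hr2.frame
  have hc2 := hc1.frame hf2 rfl
  have h2 : s2.arr 4 0 = lsTotal m d A y x.wt / (288 * m * k * q * d) := by
    rw [hs2, State.arr_setArr _ (by norm_num) (by norm_num)]
    simp [h1', hc1.reg_m, hc1.reg_k, hc1.reg_q, hc1.reg_d]
  have hr3 := Runs.setNat (o := o) (Y := Y) s2 7 (nc 294912 * (rg 1 * rg 1 * rg 1) * rg 2 *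
    (rg 4 * rg 4) * (rg 5 * rg 5 * rg 5 * rg 5))
  set s3 := s2.setReg 7 ((nc 294912 * (rg 1 * rg 1 * rg 1) * rg 2 *
    (rg 4 * rg 4) * (rg 5 * rg 5 * rg 5 * rg 5)).eval s2) with hs3
  have hf3 := hr3.frame
  have hc3 := hc2.frame hf3 rfl
  have h3 : s3.nat 7 = 294912 * (k * k * k) * d * (m * m) * (q * q * q * q) := by
    rw [hs3, State.nat_setReg]
    simp [hc2.reg_m, hc2.reg_k, hc2.reg_q, hc2.reg_d]
  have hD3 := ((hD.frame hf1 rfl).frame hf2 rfl).frame hf3 rfl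
  obtain ⟨s4, hs4, h4⟩ := exists_runs_descentProg (o := o) (Y := Y) hc3 hD3 (by omega) hmY hY
    (step := lsTotal m d A y x.wt / (288 * m * k * q * d)) (by rw [hf3.arr 4 rfl, h2])
    (x := ⟨fun l => lsCoef m x.wt d A y l * mask l, x.best, x.val⟩)
    ⟨by rw [hf3.arr 12 rfl, hf2.arr 12 rfl]; exact h1,
      by rw [hf3.arr 13 rfl, hf2.arr 13 rfl, hf1.arr 13 rfl]; exact hx.best,
      by rw [hf3.arr 5 rfl, hf2.arr 5 rfl, hf1.arr 5 rfl]; exact hx.val⟩ h3 hTY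
  have hf4 := hs4.frame
  have hc4 := hc3.frame hf4 rfl
  obtain ⟨s5, hs5, h5⟩ := exists_runs_residualProg (o := o) (Or.inr rfl) hc4
    (hD3.frame hf4 rfl) (by omega) hmY hY h4.best
  have hf5 := hs5.frame
  obtain ⟨s6, hs6, h6⟩ := exists_runs_discardProg (o := o) (Y := Y) (A := A) (y := y)
    (mask := mask) (x := x) (hc4.frame hf5 rfl) hmY hY
    (by rw [hf5.arr 18 rfl, hf4.arr 18 rfl, hf3.arr 18 rfl, hf2.arr 18 rfl, hf1.arr 18 rfl]
        exact hx.wt)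
    (by rw [hf5.arr 14 rfl, hf4.arr 14 rfl, hf3.arr 14 rfl, hf2.arr 14 rfl]; exact h1') h5
  have hf6 := hs6.frame
  exact ⟨s6, hs1.seq hY (hr2.seq hY (hr3.seq hY (hs4.seq hY (hs5.seq hY hs6)))), h6,
    by rw [hf6.arr 13 rfl, hf5.arr 13 rfl]; exact h4.best,
    by rw [hf6.arr 5 rfl, hf5.arr 5 rfl]; exact h4.val⟩

/-- the second stage -/
def phasesProg : Prog := forLoop 9 (rg 4 + nc 1) phaseProg

theorem exists_runs_phasesProg {s : State} (hc : Ctx n d k q N m η s) (hD : Data d m A y s)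
    (hdY : d + 1 ≤ Y) (hmY : m + 1 ≤ Y)
    (hTY : 294912 * (k * k * k) * d * (m * m) * (q * q * q * q) ≤ Y)
    (hmask : ∀ l < d, s.arr 17 l = mask l)
    (hx : HoldsPhase d m ⟨fun _ => 1, fun _ => 0, (∑ r ∈ range m, |y r|) / N⟩ s) :
    ∃ s', Runs o Y phasesProg s s' ∧ HoldsPhase d m (phases m d N k q A y mask (m + 1)) s' := by
  refine exists_runs_forLoop (by omega)
    (fun i s' => HoldsPhase d m (phases m d N k q A y mask i) s')
    (fun _ _ _ h => ⟨h.wt, h.best, h.val⟩) hmY rfl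
    (fun s' hf => by simp [hf.nat 4 rfl, hc.reg_m]) hx ?_
  intro i hi s1 hf hr hI
  rw [phases, Function.iterate_succ_apply']
  exact exists_runs_phaseProg (hc.frame hf rfl) (hD.frame hf rfl) hdY (by omega) hTY
    (by rw [hf.arr 17 rfl]; exact hmask) hI

end Phases

end RealRAM

namespace RealRAM
open RobustRegression Finset

variable {o : ℕ → Example} {Y : ℕ}

/-! ### Preparations -/

noncomputable def lgOf (X : ℝ) : ℕ := ⌈Real.logb 2 X⌉₊

theorem pow_lt_iff_lt_lgOf {X : ℝ} (hX : 0 ≤ X) (i : ℕ) : (2 : ℝ) ^ i < X ↔ i < lgOf X := by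
  unfold lgOf
  rw [Nat.lt_ceil]
  rcases hX.eq_or_lt with rfl | hX
  · simp only [Real.logb_zero]
    constructor
    · intro h
      exact absurd h (by positivity : (0 : ℝ) ≤ 2 ^ i).not_gt
    · intro h
      exact absurd h (by positivity : (0 : ℝ) ≤ i).not_gt
  · rw [Real.lt_logb_iff_rpow_lt (by norm_num) hX, Real.rpow_natCast]

def sampleCount (k q L : ℕ) : ℕ := 2048 * (k * k) * (q * q) * L

/-- register 6 becomes `lgOf (8 n / γ)` -/
def lgProg : Prog :=
  .seq (.setNat 6 (nc 0)) <| .seq (wr 9 (nc 0) (nc 1 : NatExpr)) <|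
    .loop (.realLt (sc 9) ((nc 8 * rg 0 : NatExpr) / sc 0))
      (.seq (wr 9 (nc 0) ((nc 2 : NatExpr) * sc 9)) (.setNat 6 (rg 6 + nc 1)))

theorem exists_runs_lgProg {s : State} {n : ℕ} {γ : ℝ} (hn : s.nat 0 = n) (hγ : s.arr 0 0 = γ)
    (hγ0 : 0 < γ) (hY : 1 ≤ Y) (hL : lgOf (8 * n / γ) ≤ Y) :
    ∃ s', Runs o Y lgProg s s' ∧ s'.nat 6 = lgOf (8 * n / γ) := by
  have h1 := Runs.setNat (o := o) (Y := Y) s 6 (nc 0)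
  have h2 := Runs.wr (o := o) (Y := Y) (s.setReg 6 ((nc 0).eval s)) 9 (nc 0) (nc 1 : NatExpr)
  obtain ⟨s', hs', -, -, h, -⟩ := exists_runs_loop (o := o) (Y := Y)
    (c := .realLt (sc 9) ((nc 8 * rg 0 : NatExpr) / sc 0))
    (p := .seq (wr 9 (nc 0) ((nc 2 : NatExpr) * sc 9)) (.setNat 6 (rg 6 + nc 1))) hY
    (fun i s' => s'.nat 0 = n ∧ s'.arr 0 0 = γ ∧ s'.nat 6 = i ∧ s'.arr 9 0 = 2 ^ i) hL
    (s := (s.setReg 6 ((nc 0).eval s)).setArr 9 ((nc 0).eval (s.setReg 6 ((nc 0).eval s)))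
      (RealExpr.eval (s.setReg 6 ((nc 0).eval s)) (nc 1 : NatExpr)))
    ⟨by simp [State.nat_setReg, hn], by simp [State.arr_setArr, hγ], by simp [State.nat_setReg],
      by simp [State.arr_setArr]⟩
    (by
      rintro i hi s' ⟨a1, a2, a3, a4⟩
      refine ⟨?_, _, (Runs.wr s' _ _ _).seq hY (Runs.setNat _ _ _), ?_, ?_, ?_, ?_⟩
      · simpa [a1, a2, a4] using (pow_lt_iff_lt_lgOf (by positivity) i).mpr hi
      · simp [State.nat_setReg, a1]
      · simp [State.arr_setArr, a2]
      · simp [State.nat_setReg, a3]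
      · simp [State.arr_setArr, a4, pow_succ, mul_comm])
    (by
      rintro s' ⟨a1, a2, a3, a4⟩
      have := (pow_lt_iff_lt_lgOf (X := 8 * n / γ) (by positivity) (lgOf (8 * n / γ))).not.mpr
        (lt_irrefl _)
      simpa [a1, a2, a4] using this)
  exact ⟨s', h1.seq hY (h2.seq hY hs'), h⟩

def prepProg : Prog :=
  .seq (.ite (.natLt (rg 0) (rg 1)) (.setNat 1 (rg 0)) .skip) <|
  .seq (ceilLoop 5 ((nc 1 : NatExpr) / sc 1)) <| .seq lgProg <|
  .seq (.setNat 3 (nc 2048 * (rg 1 * rg 1) * (rg 5 * rg 5) * rg 6)) <|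
  .seq (.setNat 2 (nc 2 * rg 0)) <| .seq (.setNat 4 (nc 2 * rg 3))
  (wr 3 (nc 0) ((nc 1 : NatExpr) / (nc 4 * rg 1 * rg 5 : NatExpr)))

theorem exists_runs_prepProg {s : State} {n k : ℕ} {γ δ η : ℝ} (hn : s.nat 0 = n)
    (hk : s.nat 1 = k) (hγ : s.arr 0 0 = γ) (hδ : s.arr 1 0 = δ) (hη : s.arr 2 0 = η)
    (hγ0 : 0 < γ) (hY : 1 ≤ Y) (hL : lgOf (8 * n / γ) ≤ Y) (hq : ⌈1 / δ⌉₊ ≤ Y) :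
    ∃ s', Runs o Y prepProg s s' ∧ Ctx n (2 * n) (min k n) ⌈1 / δ⌉₊
      (sampleCount (min k n) ⌈1 / δ⌉₊ (lgOf (8 * n / γ)))
      (2 * sampleCount (min k n) ⌈1 / δ⌉₊ (lgOf (8 * n / γ))) η s' := by
  obtain ⟨s1, hs1, h1⟩ : ∃ s', Runs o Y (.ite (.natLt (rg 0) (rg 1)) (.setNat 1 (rg 0)) .skip) s s'
      ∧ s'.nat 1 = min k n := by
    rcases lt_or_ge n k with h | h
    · exact ⟨_, Runs.ite_true hY (by simpa [hn, hk] using h) (Runs.setNat _ _ _), by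
        simp [State.nat_setReg, hn, h.le]⟩
    · exact ⟨_, Runs.ite_false hY (by simpa [hn, hk] using h) (Runs.skip _), by
        simp [hk, h]⟩
  have hf1 := hs1.frame
  obtain ⟨s2, hs2, h2⟩ := exists_runs_ceilLoop (o := o) (Y := Y) (r := 5)
    (e := (nc 1 : NatExpr) / sc 1) hY s1 (1 / δ) hq
    (fun s' hf => by simp [hf.arr 1 rfl, hf1.arr 1 rfl, hδ])
  have hf2 := hs2.frame
  obtain ⟨s3, hs3, h3⟩ := exists_runs_lgProg (o := o) (Y := Y) (s := s2) (n := n) (γ := γ)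
    (by rw [hf2.nat 0 rfl, hf1.nat 0 rfl, hn])
    (by rw [hf2.arr 0 rfl, hf1.arr 0 rfl, hγ]) hγ0 hY hL
  have hf3 := hs3.frame
  have hn3 : s3.nat 0 = n := by rw [hf3.nat 0 rfl, hf2.nat 0 rfl, hf1.nat 0 rfl, hn]
  have hk3 : s3.nat 1 = min k n := by rw [hf3.nat 1 rfl, hf2.nat 1 rfl, h1]
  have hq3 : s3.nat 5 = ⌈1 / δ⌉₊ := by rw [hf3.nat 5 rfl, h2]
  have hη3 : s3.arr 2 0 = η := by rw [hf3.arr 2 rfl, hf2.arr 2 rfl, hf1.arr 2 rfl, hη]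
  refine ⟨_, hs1.seq hY (hs2.seq hY (hs3.seq hY ((Runs.setNat _ _ _).seq hY
    ((Runs.setNat _ _ _).seq hY ((Runs.setNat _ _ _).seq hY (Runs.wr _ _ _ _)))))), ?_⟩
  constructor <;>
    simp [State.nat_setReg, State.arr_setArr, hn3, hk3, hq3, h3, hη3, sampleCount, lamOf]

/-! ### Drawing the samples -/

noncomputable def sampleMatrix (o : ℕ → Example) (N n r l : ℕ) : ℝ :=
  if r < N then if l < n then ((o r).char l).re else -((o r).char (l - n)).im
  else if l < n then ((o (r - N)).char l).im else ((o (r - N)).char (l - n)).re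

noncomputable def sampleObs (o : ℕ → Example) (N r : ℕ) : ℝ :=
  if r < N then (o r).obs.re else (o (r - N)).obs.im

def storeEntryProg : Prog :=
  .seq (wr 10 (rg 9 * rg 2 + rg 10) (.charRe (rg 10))) <|
  .seq (wr 10 (rg 9 * rg 2 + (rg 0 + rg 10)) ((nc 0 : NatExpr) - .charIm (rg 10))) <|
  .seq (wr 10 ((rg 3 + rg 9) * rg 2 + rg 10) (.charIm (rg 10)))
    (wr 10 ((rg 3 + rg 9) * rg 2 + (rg 0 + rg 10)) (.charRe (rg 10)))

theorem exists_runs_wr (s : State) {a : ℕ} (ha : a < 64) (idx : NatExpr) (e : RealExpr) :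
    ∃ s', Runs o Y (wr a idx e) s s' ∧
      ∀ j, s'.arr a j = if j = idx.eval s then e.eval s else s.arr a j :=
  ⟨_, Runs.wr _ _ _ _, fun j => by rw [State.arr_setArr _ ha ha]; simp⟩

theorem exists_runs_storeEntryProg {s : State} {n k q N i j : ℕ} {η : ℝ}
    (hc : Ctx n (2 * n) k q N (2 * N) η s) (hY : 1 ≤ Y) (hi : s.nat 9 = i) (hiN : i < N)
    (hj : s.nat 10 = j) (hjn : j < n) (hcur : s.cur = o i) :
    ∃ s', Runs o Y storeEntryProg s s' ∧ ∀ r < 2 * N, ∀ l < 2 * n,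
      s'.arr 10 (r * (2 * n) + l) = if (r = i ∨ r = N + i) ∧ (l = j ∨ l = n + j) then
        sampleMatrix o N n r l else s.arr 10 (r * (2 * n) + l) := by
  obtain ⟨s1, hs1, h1⟩ := exists_runs_wr (o := o) (Y := Y) s (by norm_num : 10 < 64)
    (rg 9 * rg 2 + rg 10) (.charRe (rg 10))
  obtain ⟨s2, hs2, h2⟩ := exists_runs_wr (o := o) (Y := Y) s1 (by norm_num : 10 < 64)
    (rg 9 * rg 2 + (rg 0 + rg 10)) ((nc 0 : NatExpr) - .charIm (rg 10))
  obtain ⟨s3, hs3, h3⟩ := exists_runs_wr (o := o) (Y := Y) s2 (by norm_num : 10 < 64)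
    ((rg 3 + rg 9) * rg 2 + rg 10) (.charIm (rg 10))
  obtain ⟨s4, hs4, h4⟩ := exists_runs_wr (o := o) (Y := Y) s3 (by norm_num : 10 < 64)
    ((rg 3 + rg 9) * rg 2 + (rg 0 + rg 10)) (.charRe (rg 10))
  have n1 : ∀ r, s1.nat r = s.nat r := fun r => hs1.frame.nat r rfl
  have n2 : ∀ r, s2.nat r = s.nat r := fun r => (hs2.frame.nat r rfl).trans (n1 r)
  have n3 : ∀ r, s3.nat r = s.nat r := fun r => (hs3.frame.nat r rfl).trans (n2 r)
  have c1 : s1.cur = o i := (hs1.frame.cur rfl).trans hcur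
  have c2 : s2.cur = o i := (hs2.frame.cur rfl).trans c1
  have c3 : s3.cur = o i := (hs3.frame.cur rfl).trans c2
  refine ⟨s4, hs1.seq hY (hs2.seq hY (hs3.seq hY hs4)), fun r hr l hl => ?_⟩
  have key : ∀ i' j', j' < 2 * n → (r * (2 * n) + l = i' * (2 * n) + j' ↔ r = i' ∧ l = j') :=
    fun i' j' hj' => ⟨rowMajor_inj hl hj', by rintro ⟨rfl, rfl⟩; rfl⟩
  have hn := hc.reg_n
  have hd := hc.reg_d
  have hN := hc.reg_N
  rw [h4, h3, h2, h1]
  simp only [NatExpr.eval_add, NatExpr.eval_mul, NatExpr.eval_reg, n1, n2, n3, hi, hj, hn, hd, hN,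
    key i j (by omega), key i (n + j) (by omega), key (N + i) j (by omega),
    key (N + i) (n + j) (by omega), RealExpr.eval_sub, NatExpr.eval_const,
    RealExpr.eval, c1, c2, c3, hcur]
  clear h1 h2 h3 h4
  by_cases h4 : r = N + i ∧ l = n + j
  · obtain ⟨rfl, rfl⟩ := h4
    simp [sampleMatrix]
  rw [if_neg h4]
  by_cases h3 : r = N + i ∧ l = j
  · obtain ⟨rfl, rfl⟩ := h3
    simp [sampleMatrix, hjn]
  rw [if_neg h3]
  by_cases h2 : r = i ∧ l = n + j
  · obtain ⟨rfl, rfl⟩ := h2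
    simp [sampleMatrix, hiN]
  rw [if_neg h2]
  by_cases h1 : r = i ∧ l = j
  · obtain ⟨rfl, rfl⟩ := h1
    simp [sampleMatrix, hiN, hjn]
  rw [if_neg h1, if_neg (by tauto)]

def drawOneProg : Prog :=
  .seq .draw <| .seq (wr 11 (rg 9) .obsRe) <| .seq (wr 11 (rg 3 + rg 9) .obsIm)
    (forLoop 10 (rg 0) storeEntryProg)

theorem exists_runs_drawOneProg {s : State} {n k q N i : ℕ} {η : ℝ}
    (hc : Ctx n (2 * n) k q N (2 * N) η s) (hnY : n ≤ Y) (hY : 1 ≤ Y) (hi : s.nat 9 = i)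
    (hiN : i < N) (hq : s.queries = i) :
    ∃ s', Runs o Y drawOneProg s s' ∧ s'.queries = i + 1 ∧
      (∀ r < 2 * N, ∀ l < 2 * n, s'.arr 10 (r * (2 * n) + l) = if r = i ∨ r = N + i then
        sampleMatrix o N n r l else s.arr 10 (r * (2 * n) + l)) ∧
      ∀ r < 2 * N, s'.arr 11 r = if r = i ∨ r = N + i then sampleObs o N r else s.arr 11 r := by
  have hr1 := Runs.draw (o := o) (Y := Y) s
  set s1 : State := { s with cur := o s.queries, queries := s.queries + 1 } with hs1
  have hr2 := Runs.wr (o := o) (Y := Y) s1 11 (rg 9) .obsRe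
  set s2 := s1.setArr 11 ((rg 9).eval s1) (RealExpr.obsRe.eval s1) with hs2
  have hr3 := Runs.wr (o := o) (Y := Y) s2 11 (rg 3 + rg 9) .obsIm
  set s3 := s2.setArr 11 ((rg 3 + rg 9).eval s2) (RealExpr.obsIm.eval s2) with hs3
  have hc3 := ((hc.frame hr1.frame rfl).frame hr2.frame rfl).frame hr3.frame rfl
  have hcur : s3.cur = o i := by simp [hs3, hs2, hs1, hq]
  have h9 : s3.nat 9 = i := hi
  have h10 : s3.arr 10 = s.arr 10 := by
    rw [hr3.frame.arr 10 rfl, hr2.frame.arr 10 rfl, hr1.frame.arr 10 rfl]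
  have h11 : ∀ r < 2 * N,
      s3.arr 11 r = if r = i ∨ r = N + i then sampleObs o N r else s.arr 11 r := by
    intro r hr
    have hobs : s2.cur = o i ∧ s1.cur = o i := by simp [hs2, hs1, hq]
    rw [hs3, State.arr_setArr _ (by norm_num) (by norm_num), hs2,
      State.arr_setArr _ (by norm_num) (by norm_num)]
    have e1 : (rg 3 + rg 9).eval s2 = N + i := by
      rw [← hi, ← hc.reg_N]; rfl
    have e2 : (rg 9).eval s1 = i := hi
    rw [← hs2, e1, e2]
    simp only [true_and, RealExpr.eval, hobs]
    by_cases h1 : r = N + i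
    · subst h1; simp [sampleObs]
    · by_cases h2 : r = i
      · subst h2; simp [sampleObs, hiN]; omega
      · simp [h1, h2]; rfl
  obtain ⟨s4, hs4, h4, -⟩ := exists_runs_forLoop (o := o) (Y := Y) (r := 10) (bnd := rg 0)
    (p := storeEntryProg) hY
    (fun j s' => (∀ r < 2 * N, ∀ l < 2 * n, s'.arr 10 (r * (2 * n) + l) =
      if (r = i ∨ r = N + i) ∧ (l < j ∨ n ≤ l ∧ l < n + j) then
        sampleMatrix o N n r l else s.arr 10 (r * (2 * n) + l)) ∧ s'.cur = o i)
    (fun _ _ _ h => h) hnY (s := s3) rfl (fun s' hf => by simp [hf.nat 0 rfl, hc3.reg_n])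
    ⟨fun r hr l hl => by rw [if_neg (by omega), h10], hcur⟩ (by
      rintro j hj s' hf hr ⟨hI, hI'⟩
      obtain ⟨s'', hs'', h⟩ := exists_runs_storeEntryProg (o := o) (Y := Y) (hc3.frame hf rfl) hY
        ((hf.nat 9 rfl).trans h9) hiN hr hj hI'
      refine ⟨s'', hs'', fun r hr l hl => ?_, (hs''.frame.cur rfl).trans hI'⟩
      rw [h r hr l hl, hI r hr l hl]
      by_cases hri : r = i ∨ r = N + i
      · by_cases hlj : l = j ∨ l = n + j
        · rw [if_pos ⟨hri, hlj⟩, if_pos ⟨hri, by omega⟩]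
        · rw [if_neg fun h => hlj h.2]
          by_cases hl' : l < j ∨ n ≤ l ∧ l < n + j
          · rw [if_pos ⟨hri, hl'⟩, if_pos ⟨hri, by omega⟩]
          · rw [if_neg fun h => hl' h.2, if_neg fun h => hl' (by omega)]
      · rw [if_neg fun h => hri h.1, if_neg fun h => hri h.1, if_neg fun h => hri h.1])
  have hf4 := hs4.frame
  refine ⟨s4, hr1.seq hY (hr2.seq hY (hr3.seq hY hs4)), ?_, fun r hr l hl => ?_, ?_⟩
  · rw [hf4.queries rfl]
    simp [hs3, hs2, hs1, hq]
  · rw [h4 r hr l hl]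
    by_cases hri : r = i ∨ r = N + i
    · rw [if_pos ⟨hri, by omega⟩, if_pos hri]
    · rw [if_neg fun h => hri h.1, if_neg hri]
  · rw [hf4.arr 11 rfl]
    exact h11

def drawProg : Prog := forLoop 9 (rg 3) drawOneProg

theorem exists_runs_drawProg {s : State} {n k q N : ℕ} {η : ℝ}
    (hc : Ctx n (2 * n) k q N (2 * N) η s) (hnY : n ≤ Y) (hNY : N ≤ Y) (hY : 1 ≤ Y)
    (hq : s.queries = 0) :
    ∃ s', Runs o Y drawProg s s' ∧ s'.queries = N ∧
      Data (2 * n) (2 * N) (sampleMatrix o N n) (sampleObs o N) s' := by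
  obtain ⟨s', hs', h1, h2, h3⟩ := exists_runs_forLoop (o := o) (Y := Y) (r := 9) (bnd := rg 3)
    (p := drawOneProg) hY
    (fun i s' => s'.queries = i ∧ (∀ r < 2 * N, ∀ l < 2 * n, (r < i ∨ N ≤ r ∧ r < N + i) →
      s'.arr 10 (r * (2 * n) + l) = sampleMatrix o N n r l) ∧
      ∀ r < 2 * N, (r < i ∨ N ≤ r ∧ r < N + i) → s'.arr 11 r = sampleObs o N r)
    (fun _ _ _ h => h) hNY (s := s) rfl (fun s' hf => by simp [hf.nat 3 rfl, hc.reg_N])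
    ⟨hq, fun r _ l _ h => by omega, fun r _ h => by omega⟩ (by
      rintro i hi s' hf hr ⟨hI, hI', hI''⟩
      obtain ⟨s'', hs'', a1, a2, a3⟩ := exists_runs_drawOneProg (o := o) (Y := Y)
        (hc.frame hf rfl) hnY hY hr hi hI
      refine ⟨s'', hs'', a1, fun r hr l hl h => ?_, fun r hr h => ?_⟩
      · rw [a2 r hr l hl]
        split_ifs with hri
        · rfl
        · exact hI' r hr l hl (by omega)
      · rw [a3 r hr]
        split_ifs with hri
        · rfl
        · exact hI'' r hr (by omega))
  exact ⟨s', hs', h1, fun r hr l hl => h2 r hr l hl (by omega), fun r hr => h3 r hr (by omega)⟩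

/-! ### The first stage -/

section Coarse

variable {n k q N m d : ℕ} {η : ℝ} {A : ℕ → ℕ → ℝ} {y : ℕ → ℝ}

/-- the best point becomes the origin -/
def resetProg : Prog :=
  .seq (wr 5 (nc 0) (sc 8)) (mapLoop 11 (rg 2) 13 (rg 11) (nc 0 : NatExpr))

theorem exists_runs_resetProg {s : State} (hc : Ctx n d k q N m η s) (hdY : d ≤ Y) (hY : 1 ≤ Y) :
    ∃ s', Runs o Y resetProg s s' ∧ s'.arr 5 0 = s.arr 8 0 ∧ ∀ l < d, s'.arr 13 l = 0 := by
  have h1 := Runs.wr (o := o) (Y := Y) s 5 (nc 0) (sc 8)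
  obtain ⟨s2, hs2, h2, -⟩ := exists_runs_mapLoop (o := o) (Y := Y) (r := 11)
    (bnd := rg 2) (a := 13) (idx := rg 11) (e := (nc 0 : NatExpr)) hY
    (s.setArr 5 ((nc 0).eval s) ((sc 8).eval s))
    id (fun _ => 0) (b := d) hdY (by norm_num)
    (fun _ _ _ _ h => h) (fun s' hf => by simp [hf.nat 2 rfl, hc.reg_d])
    (fun l _ s' hf h => by simp [h]) (fun l hl s' hf h _ => by simp)
  refine ⟨s2, h1.seq hY hs2, ?_, h2⟩
  rw [hs2.frame.arr 5 rfl]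
  simp [State.arr_setArr]

/-- the mean absolute observation -/
def meanProg : Prog :=
  .seq (sumLoop 11 (rg 4) 8 (absE (rd 11 (rg 11)))) (wr 8 (nc 0) (sc 8 / (rg 3 : NatExpr)))

theorem exists_runs_meanProg {s : State} (hc : Ctx n d k q N m η s) (hD : Data d m A y s)
    (hmY : m ≤ Y) (hY : 1 ≤ Y) :
    ∃ s', Runs o Y meanProg s s' ∧ s'.arr 8 0 = (∑ r ∈ range m, |y r|) / N := by
  obtain ⟨s1, hs1, h1⟩ := exists_runs_sumLoop (o := o) (Y := Y) (r := 11) (bnd := rg 4) (acc := 8)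
    (e := absE (rd 11 (rg 11))) hY s (fun r => |y r|) hmY (by norm_num)
    (fun s' hf => by simp [hf.nat 4 rfl, hc.reg_m])
    (fun r hr s' hf h => by simp [h, hf.arr 11 rfl, hD.obs r hr])
  refine ⟨_, hs1.seq hY (Runs.wr _ _ _ _), ?_⟩
  simp [State.arr_setArr, h1, (hc.frame hs1.frame rfl).reg_N]

def coarseProg : Prog :=
  .seq meanProg <| .seq (ceilLoop 8 (sc 8 / sc 2)) <| .seq resetProg <|
  .seq (mapLoop 11 (rg 2) 12 (rg 11) (nc 0 : NatExpr)) <|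
  .seq (wr 4 (nc 0) (sc 2 / (nc 72 * rg 5 * rg 2 : NatExpr))) <|
  .seq (.setNat 7 (nc 1152 * rg 1 * rg 2 * ((rg 8 + nc 1) * (rg 8 + nc 1)) *
    (rg 5 * rg 5 * rg 5 * rg 5))) descentProg

theorem exists_runs_coarseProg {s : State} (hc : Ctx n d k q N m η s) (hD : Data d m A y s)
    (hdY : d ≤ Y) (hmY : m ≤ Y) (hY : 1 ≤ Y) {R : ℕ} (hR : ⌈(∑ r ∈ range m, |y r|) / N / η⌉₊ = R)
    (hRY : R ≤ Y) (hTY : 1152 * k * d * ((R + 1) * (R + 1)) * (q * q * q * q) ≤ Y) :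
    ∃ s', Runs o Y coarseProg s s' ∧ HoldsDescent d (coarse m d N k q η R A y) s' ∧
      s'.arr 8 0 = (∑ r ∈ range m, |y r|) / N := by
  obtain ⟨s1, hs1, h1⟩ := exists_runs_meanProg (o := o) hc hD hmY hY
  have hc1 := hc.frame hs1.frame rfl
  obtain ⟨s2, hs2, h2⟩ := exists_runs_ceilLoop (o := o) (Y := Y) (r := 8)
    (e := sc 8 / sc 2) hY s1 ((∑ r ∈ range m, |y r|) / N / η) (hR.le.trans hRY)
    (fun s' hf => by simp [hf.arr 8 rfl, hf.arr 2 rfl, h1, hc1.eta])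
  have hc2 := hc1.frame hs2.frame rfl
  obtain ⟨s3, hs3, h3, h3'⟩ := exists_runs_resetProg (o := o) hc2 hdY hY
  have hc3 := hc2.frame hs3.frame rfl
  obtain ⟨s4, hs4, h4, -⟩ := exists_runs_mapLoop (o := o) (Y := Y) (r := 11)
    (bnd := rg 2) (a := 12) (idx := rg 11) (e := (nc 0 : NatExpr)) hY s3
    id (fun _ => 0) (b := d) hdY (by norm_num)
    (fun _ _ _ _ h => h) (fun s' hf => by simp [hf.nat 2 rfl, hc3.reg_d])
    (fun l _ s' hf h => by simp [h]) (fun l hl s' hf h _ => by simp)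
  have hc4 := hc3.frame hs4.frame rfl
  have hr5 := Runs.wr (o := o) (Y := Y) s4 4 (nc 0) (sc 2 / (nc 72 * rg 5 * rg 2 : NatExpr))
  set s5 := s4.setArr 4 ((nc 0).eval s4) ((sc 2 / (nc 72 * rg 5 * rg 2 : NatExpr)).eval s4) with hs5
  have hf5 := hr5.frame
  have hc5 := hc4.frame hf5 rfl
  have h5 : s5.arr 4 0 = η / (72 * q * d) := by
    rw [hs5, State.arr_setArr _ (by norm_num) (by norm_num)]
    simp [hc4.eta, hc4.reg_q, hc4.reg_d]
  have h8 : s5.nat 8 = R := by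
    rw [hf5.nat 8 rfl, hs4.frame.nat 8 rfl, hs3.frame.nat 8 rfl, h2, hR]
  have hr6 := Runs.setNat (o := o) (Y := Y) s5 7 (nc 1152 * rg 1 * rg 2 *
    ((rg 8 + nc 1) * (rg 8 + nc 1)) * (rg 5 * rg 5 * rg 5 * rg 5))
  set s6 := s5.setReg 7 ((nc 1152 * rg 1 * rg 2 *
    ((rg 8 + nc 1) * (rg 8 + nc 1)) * (rg 5 * rg 5 * rg 5 * rg 5)).eval s5) with hs6
  have hf6 := hr6.frame
  have hc6 := hc5.frame hf6 rfl
  have h6 : s6.nat 7 = 1152 * k * d * ((R + 1) * (R + 1)) * (q * q * q * q) := by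
    rw [hs6, State.nat_setReg]
    simp [hc5.reg_k, hc5.reg_q, hc5.reg_d, h8]
  have hD6 := (((((hD.frame hs1.frame rfl).frame hs2.frame rfl).frame hs3.frame rfl).frame
    hs4.frame rfl).frame hf5 rfl).frame hf6 rfl
  have hv2 : s2.arr 8 0 = (∑ r ∈ range m, |y r|) / N := by rw [hs2.frame.arr 8 rfl, h1]
  obtain ⟨s7, hs7, h7⟩ := exists_runs_descentProg (o := o) (Y := Y) hc6 hD6 hdY hmY hY
    (step := η / (72 * q * d)) (by rw [hf6.arr 4 rfl, h5])
    (x := zeroDescent ((∑ r ∈ range m, |y r|) / N))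
    ⟨by rw [hf6.arr 12 rfl, hf5.arr 12 rfl]; exact h4,
      by rw [hf6.arr 13 rfl, hf5.arr 13 rfl, hs4.frame.arr 13 rfl]; exact h3',
      by rw [hf6.arr 5 rfl, hf5.arr 5 rfl, hs4.frame.arr 5 rfl, h3, hv2]; rfl⟩ h6 hTY
  refine ⟨s7, hs1.seq hY (hs2.seq hY (hs3.seq hY (hs4.seq hY (hr5.seq hY (hr6.seq hY hs7))))),
    h7, ?_⟩
  rw [hs7.frame.arr 8 rfl, hf6.arr 8 rfl, hf5.arr 8 rfl, hs4.frame.arr 8 rfl, hs3.frame.arr 8 rfl,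
    hv2]

open Classical in
/-- The indicator of the coordinates with a large coefficient. -/
noncomputable def maskOf (n : ℕ) (η : ℝ) (b : ℕ → ℝ) (l : ℕ) : ℝ :=
  if l < 2 * n ∧ ¬ (b (l % n) * b (l % n) + b (n + l % n) * b (n + l % n) < η * η / 4) then 1 else 0

def maskProg : Prog :=
  forLoop 11 (rg 0) (.ite (.realLt (rd 13 (rg 11) * rd 13 (rg 11) +
      rd 13 (rg 0 + rg 11) * rd 13 (rg 0 + rg 11)) (sc 2 * sc 2 / (nc 4 : NatExpr)))
    (.seq (wr 17 (rg 11) (nc 0 : NatExpr)) (wr 17 (rg 0 + rg 11) (nc 0 : NatExpr)))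
    (.seq (wr 17 (rg 11) (nc 1 : NatExpr)) (wr 17 (rg 0 + rg 11) (nc 1 : NatExpr))))

theorem exists_runs_maskProg {s : State} (hc : Ctx n (2 * n) k q N m η s) (hnY : n ≤ Y)
    (hY : 1 ≤ Y) {b : ℕ → ℝ} (hb : ∀ l < 2 * n, s.arr 13 l = b l) :
    ∃ s', Runs o Y maskProg s s' ∧ ∀ l < 2 * n, s'.arr 17 l = maskOf n η b l := by
  obtain ⟨s', hs', h⟩ := exists_runs_forLoop (o := o) (Y := Y) (r := 11) (bnd := rg 0)
    (p := .ite (.realLt (rd 13 (rg 11) * rd 13 (rg 11) +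
      rd 13 (rg 0 + rg 11) * rd 13 (rg 0 + rg 11)) (sc 2 * sc 2 / (nc 4 : NatExpr)))
    (.seq (wr 17 (rg 11) (nc 0 : NatExpr)) (wr 17 (rg 0 + rg 11) (nc 0 : NatExpr)))
    (.seq (wr 17 (rg 11) (nc 1 : NatExpr)) (wr 17 (rg 0 + rg 11) (nc 1 : NatExpr)))) hY
    (fun i s' => ∀ l < 2 * n, (l < i ∨ n ≤ l ∧ l < n + i) → s'.arr 17 l = maskOf n η b l)
    (fun _ _ _ h => h) hnY (s := s) rfl (fun s' hf => by simp [hf.nat 0 rfl, hc.reg_n])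
    (fun l _ h => by omega) (by
      intro i hi s1 hf hr hI
      have hc1 := hc.frame hf rfl
      have e1 : s1.arr 13 i = b i := by rw [hf.arr 13 rfl, hb i (by omega)]
      have e2 : s1.arr 13 (n + i) = b (n + i) := by rw [hf.arr 13 rfl, hb _ (by omega)]
      have hcond : (Test.realLt (rd 13 (rg 11) * rd 13 (rg 11) +
          rd 13 (rg 0 + rg 11) * rd 13 (rg 0 + rg 11)) (sc 2 * sc 2 / (nc 4 : NatExpr))).Holds s1 ↔
          b i * b i + b (n + i) * b (n + i) < η * η / 4 := by
        simp [hr, hc1.reg_n, e1, e2, hc1.eta]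
      have hmi : ∀ l, l = i ∨ l = n + i → l % n = i := by
        rintro l (rfl | rfl) <;> simp [Nat.mod_eq_of_lt hi]
      by_cases h : b i * b i + b (n + i) * b (n + i) < η * η / 4
      · refine ⟨_, Runs.ite_true hY (hcond.mpr h) ((Runs.wr _ _ _ _).seq hY (Runs.wr _ _ _ _)),
          fun l hl hli => ?_⟩
        simp only [State.arr_setArr _ (by norm_num : 17 < 64) (by norm_num : 17 < 64), true_and,
          NatExpr.eval_add, NatExpr.eval_reg, State.nat_setArr, hr, hc1.reg_n]
        by_cases hl2 : l = i ∨ l = n + i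
        · have : maskOf n η b l = 0 := by simp [maskOf, hmi l hl2, h]
          rw [this]
          rcases hl2 with h2 | h2 <;> simp [h2]
        · rw [if_neg fun h => hl2 (Or.inr h), if_neg fun h => hl2 (Or.inl h)]
          exact hI l hl (by omega)
      · refine ⟨_, Runs.ite_false hY (fun h' => h (hcond.mp h'))
          ((Runs.wr _ _ _ _).seq hY (Runs.wr _ _ _ _)), fun l hl hli => ?_⟩
        simp only [State.arr_setArr _ (by norm_num : 17 < 64) (by norm_num : 17 < 64), true_and,
          NatExpr.eval_add, NatExpr.eval_reg, State.nat_setArr, hr, hc1.reg_n]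
        by_cases hl2 : l = i ∨ l = n + i
        · have : maskOf n η b l = 1 := by
            rw [maskOf, hmi l hl2, if_pos ⟨hl, h⟩]
          rw [this]
          rcases hl2 with h2 | h2 <;> simp [h2]
        · rw [if_neg fun h => hl2 (Or.inr h), if_neg fun h => hl2 (Or.inl h)]
          exact hI l hl (by omega))
  exact ⟨s', hs', fun l hl => h l hl (by omega)⟩

/-- restrict to the large coefficients and initialize the second stage -/
def restrictProg : Prog :=
  .seq maskProg <|
  .seq (mapLoop₂ 11 (rg 4) 12 (rg 2) 10 (rg 2) (rd 10 (rg 11 * rg 2 + rg 12) * rd 17 (rg 12))) <|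
  .seq resetProg (mapLoop 11 (rg 4) 18 (rg 11) (nc 1 : NatExpr))

theorem exists_runs_restrictProg {s : State} (hc : Ctx n (2 * n) k q N m η s)
    (hD : Data (2 * n) m A y s) (hnY : 2 * n ≤ Y) (hmY : m ≤ Y)
    (hY : 1 ≤ Y) {b : ℕ → ℝ} (hb : ∀ l < 2 * n, s.arr 13 l = b l) {v : ℝ} (hv : s.arr 8 0 = v) :
    ∃ s', Runs o Y restrictProg s s' ∧ (∀ l < 2 * n, s'.arr 17 l = maskOf n η b l) ∧
      Data (2 * n) m (fun r l => A r l * maskOf n η b l) y s' ∧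
      HoldsPhase (2 * n) m ⟨fun _ => 1, fun _ => 0, v⟩ s' := by
  obtain ⟨s1, hs1, h1⟩ := exists_runs_maskProg (o := o) hc (by omega) hY hb
  have hc1 := hc.frame hs1.frame rfl
  have hD1 := hD.frame hs1.frame rfl
  obtain ⟨s2, hs2, h2⟩ := exists_runs_mapLoop₂ (o := o) (Y := Y) (r₁ := 11) (r₂ := 12)
    (b₁ := rg 4) (b₂ := rg 2) (w := rg 2) (a := 10)
    (e := rd 10 (rg 11 * rg 2 + rg 12) * rd 17 (rg 12)) hY s1
    (fun r l => A r l * maskOf n η b l) (m := m) (n := 2 * n) hmY hnY (by norm_num) (by norm_num)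
    (fun s' hf => by simp [hf.nat 4 rfl, hc1.reg_m]) (fun s' hf => by simp [hf.nat 2 rfl, hc1.reg_d])
    (fun s' hf => by simp [hf.nat 2 rfl, hc1.reg_d])
    (fun r hr l hl s' hf a1 a2 hold => by
      simp [a1, a2, hf.nat 2 rfl, hc1.reg_d, hold, hD1.mat r hr l hl, hf.arr 17 rfl, h1 l hl])
  have hf2 := hs2.frame
  have hc2 := hc1.frame hf2 rfl
  obtain ⟨s3, hs3, h3, h3'⟩ := exists_runs_resetProg (o := o) hc2 hnY hY
  have hf3 := hs3.frame
  have hc3 := hc2.frame hf3 rfl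
  obtain ⟨s4, hs4, h4, -⟩ := exists_runs_mapLoop (o := o) (Y := Y) (r := 11)
    (bnd := rg 4) (a := 18) (idx := rg 11) (e := (nc 1 : NatExpr)) hY s3
    id (fun _ => 1) (b := m) hmY (by norm_num)
    (fun _ _ _ _ h => h) (fun s' hf => by simp [hf.nat 4 rfl, hc3.reg_m])
    (fun l _ s' hf h => by simp [h]) (fun l hl s' hf h _ => by simp)
  have hf4 := hs4.frame
  refine ⟨s4, hs1.seq hY (hs2.seq hY (hs3.seq hY hs4)), ?_, ⟨?_, ?_⟩, h4, ?_, ?_⟩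
  · rw [hf4.arr 17 rfl, hf3.arr 17 rfl, hf2.arr 17 rfl]; exact h1
  · rw [hf4.arr 10 rfl, hf3.arr 10 rfl]; exact h2
  · rw [hf4.arr 11 rfl, hf3.arr 11 rfl, hf2.arr 11 rfl]; exact hD1.obs
  · rw [hf4.arr 13 rfl]; exact h3'
  · rw [hf4.arr 5 rfl, h3, hf2.arr 8 rfl, hs1.frame.arr 8 rfl, hv]

end Coarse

/-! ### Output and the whole program -/

def outputProg : Prog :=
  forLoop 11 (rg 0) (.seq (.setReal (nc 2 * rg 11) (rd 13 (rg 11)))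
    (.setReal (nc 2 * rg 11 + nc 1) (rd 13 (rg 0 + rg 11))))

theorem exists_runs_outputProg {s : State} {n : ℕ} (hn : s.nat 0 = n) (hnY : n ≤ Y) (hY : 1 ≤ Y)
    {b : ℕ → ℝ} (hb : ∀ l < 2 * n, s.arr 13 l = b l) :
    ∃ s', Runs o Y outputProg s s' ∧ ∀ j < n, s'.outCoeff j = ⟨b j, b (n + j)⟩ := by
  obtain ⟨s', hs', h1, h2, -⟩ := exists_runs_forLoop (o := o) (Y := Y) (r := 11) (bnd := rg 0)
    (p := .seq (.setReal (nc 2 * rg 11) (rd 13 (rg 11)))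
    (.setReal (nc 2 * rg 11 + nc 1) (rd 13 (rg 0 + rg 11)))) hY
    (fun i s' => (∀ j < i, s'.real (2 * j) = b j) ∧ (∀ j < i, s'.real (2 * j + 1) = b (n + j)) ∧
      ∀ l < 2 * n, i ≤ l → s'.real (64 * l + 13) = b l)
    (fun _ _ _ h => h) hnY (s := s) rfl (fun s' hf => by simp [hf.nat 0 rfl, hn])
    ⟨by simp, by simp, fun l hl _ => hb l hl⟩ (by
      rintro i hi s1 hf hr ⟨h1, h2, h3⟩
      have hn1 : s1.nat 0 = n := (hf.nat 0 rfl).trans hn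
      refine ⟨_, (Runs.setReal _ _ _).seq hY (Runs.setReal _ _ _), fun j hj => ?_, fun j hj => ?_,
        fun l hl hil => ?_⟩
      all_goals simp only [NatExpr.eval_add, NatExpr.eval_mul, NatExpr.eval_reg,
        NatExpr.eval_const, hr, hn1, rd_eval, State.arr, Function.update_apply]
      · rw [if_neg (by omega)]
        split_ifs with h
        · obtain rfl : j = i := by omega
          exact h3 j (by omega) le_rfl
        · exact h1 j (by omega)
      · split_ifs with h h' h'
        · omega
        · obtain rfl : j = i := by omega
          exact h3 _ (by omega) (by omega)
        · omega
        · exact h2 j (by omega)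
      · rw [if_neg (by omega), if_neg (by omega)]
        exact h3 l hl (by omega))
  exact ⟨s', hs', fun j hj => Complex.ext (h1 j hj) (h2 j hj)⟩

/-- The coefficients found by the algorithm. -/
noncomputable def foundCoeff (o : ℕ → Example) (n k q N : ℕ) (η : ℝ) : ℕ → ℝ :=
  let y := sampleObs o N
  let mask := maskOf n η (coarse (2 * N) (2 * n) N k q η
    ⌈(∑ r ∈ range (2 * N), |y r|) / N / η⌉₊ (sampleMatrix o N n) y).best
  (phases (2 * N) (2 * n) N k q (fun r l => sampleMatrix o N n r l * mask l) y mask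
    (2 * N + 1)).best

def learnProg : Prog :=
  .seq prepProg <|
  .seq (.ite (.natLt (nc 0) (rg 1))
    (.seq drawProg <| .seq coarseProg <| .seq restrictProg phasesProg) .skip)
  outputProg

theorem exists_runs_learnProg {n k : ℕ} {γ δ η : ℝ} (hγ : 0 < γ) {q N R : ℕ}
    (hq : q = ⌈1 / δ⌉₊) (hN : N = sampleCount (min k n) q (lgOf (8 * n / γ)))
    (hR : R = ⌈(∑ r ∈ range (2 * N), |sampleObs o N r|) / N / η⌉₊)
    (hY1 : lgOf (8 * n / γ) ≤ Y) (hY2 : q ≤ Y) (hY3 : 2 * n + 1 ≤ Y) (hY4 : 2 * N + 1 ≤ Y)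
    (hY5 : R ≤ Y)
    (hY6 : 1152 * min k n * (2 * n) * ((R + 1) * (R + 1)) * (q * q * q * q) ≤ Y)
    (hY7 : 294912 * (min k n * min k n * min k n) * (2 * n) * (2 * N * (2 * N)) *
      (q * q * q * q) ≤ Y) :
    ∃ s', Runs o Y learnProg (initState n k γ δ η) s' ∧ s'.queries = N ∧
      ∀ j < n, s'.outCoeff j = if 0 < min k n then
        ⟨foundCoeff o n (min k n) q N η j, foundCoeff o n (min k n) q N η (n + j)⟩ else 0 := by
  have hY : 1 ≤ Y := by omega
  obtain ⟨s1, hs1, hc1⟩ := exists_runs_prepProg (o := o) (Y := Y) (s := initState n k γ δ η)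
    (n := n) (k := k) (γ := γ) (δ := δ) (η := η) rfl rfl rfl rfl rfl hγ hY hY1 (hq ▸ hY2)
  rw [← hq, ← hN] at hc1
  have hq1 : s1.queries = 0 := hs1.frame.queries rfl
  by_cases hk : 0 < min k n
  · obtain ⟨s2, hs2, hq2, hD2⟩ := exists_runs_drawProg (o := o) hc1 (by omega) (by omega) hY hq1
    have hc2 := hc1.frame hs2.frame rfl
    obtain ⟨s3, hs3, h3, h3'⟩ := exists_runs_coarseProg (o := o) hc2 hD2 (by omega) (by omega) hY
      hR.symm hY5 hY6
    have hc3 := hc2.frame hs3.frame rfl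
    obtain ⟨s4, hs4, h4, hD4, hx4⟩ := exists_runs_restrictProg (o := o) hc3
      (hD2.frame hs3.frame rfl) (by omega) (by omega) hY h3.best h3'
    have hc4 := hc3.frame hs4.frame rfl
    obtain ⟨s5, hs5, h5⟩ := exists_runs_phasesProg (o := o) hc4 hD4 hY3 hY4 hY7 h4 hx4
    have hc5 := hc4.frame hs5.frame rfl
    obtain ⟨s6, hs6, h6⟩ := exists_runs_outputProg (o := o) hc5.reg_n (by omega) hY h5.best
    refine ⟨s6, hs1.seq hY ((Runs.ite_true hY (by simpa [hc1.reg_k] using hk)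
      (hs2.seq hY (hs3.seq hY (hs4.seq hY hs5)))).seq hY hs6), ?_, fun j hj => ?_⟩
    · rw [hs6.frame.queries rfl, hs5.frame.queries rfl, hs4.frame.queries rfl,
        hs3.frame.queries rfl, hq2]
    · rw [h6 j hj, if_pos hk, foundCoeff, ← hR]
  · have hN0 : N = 0 := by
      rw [hN, sampleCount, Nat.eq_zero_of_not_pos hk]; simp
    obtain ⟨s6, hs6, h6⟩ := exists_runs_outputProg (o := o) (Y := Y) hc1.reg_n (by omega) hY
      (b := fun _ => 0) (fun l _ => by
        rw [hs1.frame.arr 13 rfl]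
        unfold State.arr initState
        dsimp only
        split <;> first | omega | rfl)
    refine ⟨s6, hs1.seq hY ((Runs.ite_false hY (by simpa [hc1.reg_k] using hk)
      (Runs.skip _)).seq hY hs6), ?_, fun j hj => ?_⟩
    · rw [hs6.frame.queries rfl, hq1, hN0]
    · rw [h6 j hj, if_neg hk]; rfl

end RealRAM

/-! ## Linear combinations of characters -/

section Characters

variable {D : Type u} [MeasurableSpace D] {μ : Measure D} [IsProbabilityMeasure μ] {n : ℕ}
  {χ : Fin n → D → ℂ}

/-- The function whose coefficients have the real parts `h j` and the imaginary parts
`h (n + j)`. -/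
noncomputable def charComb (χ : Fin n → D → ℂ) (h : ℕ → ℝ) (x : D) : ℂ :=
  ∑ j : Fin n, (⟨h j, h (n + j)⟩ : ℂ) * χ j x

omit [MeasurableSpace D] in
theorem charComb_sub (h h' : ℕ → ℝ) (x : D) :
    charComb χ (fun l => h l - h' l) x = charComb χ h x - charComb χ h' x := by
  unfold charComb
  rw [← Finset.sum_sub_distrib]
  refine Finset.sum_congr rfl fun j _ => ?_
  rw [← sub_mul]
  rfl

omit [IsProbabilityMeasure μ] in
theorem measurable_charComb (hχ : IsCharacterFamily μ χ) (h : ℕ → ℝ) :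
    Measurable (charComb χ h) :=
  Finset.measurable_sum _ fun j _ => (hχ.measurable j).const_mul _

theorem integrable_character (hχ : IsCharacterFamily μ χ) (j : Fin n) : Integrable (χ j) μ :=
  .of_bound (hχ.measurable j).aestronglyMeasurable 1 (ae_of_all _ (hχ.norm_le_one j))

theorem integrable_charComb (hχ : IsCharacterFamily μ χ) (h : ℕ → ℝ) :
    Integrable (charComb χ h) μ :=
  integrable_finsetSum _ fun j _ => (integrable_character hχ j).const_mul _

omit [IsProbabilityMeasure μ] in
theorem integrable_mul_conj_character (hχ : IsCharacterFamily μ χ) {g : D → ℂ}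
    (hg : Integrable g μ) (j : Fin n) :
    Integrable (fun x => g x * (starRingEnd ℂ) (χ j x)) μ :=
  hg.mul_bdd (c := 1) (Complex.continuous_conj.measurable.comp
    (hχ.measurable j)).aestronglyMeasurable (ae_of_all _ fun x => by
      simpa using hχ.norm_le_one j x)

theorem charCoeff_sum (hχ : IsCharacterFamily μ χ) (a : Fin n → ℂ) (j : Fin n) :
    charCoeff μ χ (fun x => ∑ i, a i * χ i x) j = a j := by
  unfold charCoeff
  simp only [Finset.sum_mul, mul_assoc]
  rw [integral_finsetSum _ fun i _ =>
    (integrable_mul_conj_character hχ (integrable_character hχ i) j).const_mul _]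
  simp [integral_const_mul, hχ.orthonormal]

theorem charCoeff_charComb (hχ : IsCharacterFamily μ χ) (h : ℕ → ℝ) (j : Fin n) :
    charCoeff μ χ (charComb χ h) j = ⟨h j, h (n + j)⟩ :=
  charCoeff_sum hχ _ j

omit [IsProbabilityMeasure μ] in
theorem norm_charCoeff_le (hχ : IsCharacterFamily μ χ) {g : D → ℂ} (hg : Integrable g μ)
    (j : Fin n) : ‖charCoeff μ χ g j‖ ≤ ∫ x, ‖g x‖ ∂μ := by
  refine norm_integral_le_of_norm_le hg.norm (ae_of_all _ fun x => ?_)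
  rw [norm_mul, RCLike.norm_conj]
  exact mul_le_of_le_one_right (norm_nonneg _) (hχ.norm_le_one j x)

theorem eq_sum_charCoeff (hχ : IsCharacterFamily μ χ) {f : D → ℂ}
    (hf : f ∈ Submodule.span ℂ (Set.range χ)) :
    f = fun x => ∑ j, charCoeff μ χ f j * χ j x := by
  obtain ⟨a, ha⟩ := (Submodule.mem_span_range_iff_exists_fun ℂ).mp hf
  have h : f = fun x => ∑ j, a j * χ j x := by
    rw [← ha]; ext x; simp
  have h' := charCoeff_sum hχ a
  rw [← h] at h'
  simp only [h']
  exact h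

/-- The sum of the mean absolute values of the real and of the imaginary part. -/
noncomputable def combNorm (μ : Measure D) (χ : Fin n → D → ℂ) (h : ℕ → ℝ) : ℝ :=
  (∫ x, |(charComb χ h x).re| ∂μ) + ∫ x, |(charComb χ h x).im| ∂μ

omit [IsProbabilityMeasure μ] in
theorem combNorm_nonneg (h : ℕ → ℝ) : 0 ≤ combNorm μ χ h :=
  add_nonneg (integral_nonneg fun _ => abs_nonneg _) (integral_nonneg fun _ => abs_nonneg _)

theorem integral_norm_charComb_le (hχ : IsCharacterFamily μ χ) (h : ℕ → ℝ) :
    ∫ x, ‖charComb χ h x‖ ∂μ ≤ combNorm μ χ h := by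
  have hi := integrable_charComb hχ h
  have hr : Integrable (fun x => |(charComb χ h x).re|) μ := hi.re.abs
  have hm : Integrable (fun x => |(charComb χ h x).im|) μ := hi.im.abs
  rw [combNorm, ← integral_add hr hm]
  exact integral_mono hi.norm (hr.add hm) fun x => Complex.norm_le_abs_re_add_abs_im _

theorem norm_coeff_le_combNorm (hχ : IsCharacterFamily μ χ) (h : ℕ → ℝ) (j : Fin n) :
    ‖(⟨h j, h (n + j)⟩ : ℂ)‖ ≤ combNorm μ χ h := by
  rw [← charCoeff_charComb hχ h j]
  exact (norm_charCoeff_le hχ (integrable_charComb hχ h) j).trans (integral_norm_charComb_le hχ h)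

theorem abs_le_combNorm (hχ : IsCharacterFamily μ χ) (h : ℕ → ℝ) {l : ℕ} (hl : l < 2 * n) :
    |h l| ≤ combNorm μ χ h := by
  by_cases hln : l < n
  · exact (Complex.abs_re_le_norm ⟨h l, h (n + l)⟩).trans (norm_coeff_le_combNorm hχ h ⟨l, hln⟩)
  · have := (Complex.abs_im_le_norm ⟨h (l - n), h (n + (l - n))⟩).trans
      (norm_coeff_le_combNorm hχ h ⟨l - n, by omega⟩)
    rwa [show n + (l - n) = l by omega] at this

end Characters

/-! ## The samples are robust with high probability -/

namespace RealRAM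

open RobustRegression Finset

section Features

variable {D : Type u} {n : ℕ}

/-- The characters, indexed by all natural numbers. -/
noncomputable def extChar (χ : Fin n → D → ℂ) (x : D) (j : ℕ) : ℂ :=
  if h : j < n then χ ⟨j, h⟩ x else 0

noncomputable def featRe (χ : Fin n → D → ℂ) (l : ℕ) (x : D) : ℝ :=
  if l < n then (extChar χ x l).re else -(extChar χ x (l - n)).im

noncomputable def featIm (χ : Fin n → D → ℂ) (l : ℕ) (x : D) : ℝ :=
  if l < n then (extChar χ x l).im else (extChar χ x (l - n)).re

theorem sampleMatrix_exampleSeq {Ω : Type v} (χ : Fin n → D → ℂ) (x : ℕ → Ω → D) (y : ℕ → Ω → ℂ)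
    (ω : Ω) (N r l : ℕ) : sampleMatrix (exampleSeq χ x y ω) N n r l =
      if r < N then featRe χ l (x r ω) else featIm χ l (x (r - N) ω) := rfl

theorem sum_range_two_mul (n : ℕ) (g : ℕ → ℝ) :
    ∑ l ∈ range (2 * n), g l = ∑ j : Fin n, (g j + g (n + j)) := by
  rw [two_mul, sum_range_add, sum_add_distrib, ← Fin.sum_univ_eq_sum_range,
    ← Fin.sum_univ_eq_sum_range (fun i => g (n + i))]

theorem sum_featRe (χ : Fin n → D → ℂ) (h : ℕ → ℝ) (x : D) :
    ∑ l ∈ range (2 * n), featRe χ l x * h l = (charComb χ h x).re := by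
  rw [sum_range_two_mul, charComb, Complex.re_sum]
  refine sum_congr rfl fun j _ => ?_
  simp [featRe, extChar]
  ring

theorem sum_featIm (χ : Fin n → D → ℂ) (h : ℕ → ℝ) (x : D) :
    ∑ l ∈ range (2 * n), featIm χ l x * h l = (charComb χ h x).im := by
  rw [sum_range_two_mul, charComb, Complex.im_sum]
  refine sum_congr rfl fun j _ => ?_
  simp [featIm, extChar]
  ring

variable [MeasurableSpace D] {μ : Measure D} {χ : Fin n → D → ℂ}

theorem measurable_extChar (hχ : IsCharacterFamily μ χ) (j : ℕ) :
    Measurable fun x => extChar χ x j := by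
  unfold extChar
  split_ifs with h
  · exact hχ.measurable _
  · exact measurable_const

theorem norm_extChar_le (hχ : IsCharacterFamily μ χ) (x : D) (j : ℕ) : ‖extChar χ x j‖ ≤ 1 := by
  unfold extChar
  split_ifs with h
  · exact hχ.norm_le_one _ _
  · simp

theorem measurable_featRe (hχ : IsCharacterFamily μ χ) (l : ℕ) : Measurable (featRe χ l) := by
  unfold featRe
  split_ifs
  · exact Complex.measurable_re.comp (measurable_extChar hχ l)
  · exact (Complex.measurable_im.comp (measurable_extChar hχ _)).neg

theorem measurable_featIm (hχ : IsCharacterFamily μ χ) (l : ℕ) : Measurable (featIm χ l) := by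
  unfold featIm
  split_ifs
  · exact Complex.measurable_im.comp (measurable_extChar hχ l)
  · exact Complex.measurable_re.comp (measurable_extChar hχ _)

theorem abs_featRe_le (hχ : IsCharacterFamily μ χ) (l : ℕ) (x : D) : |featRe χ l x| ≤ 1 := by
  unfold featRe
  split_ifs
  · exact (Complex.abs_re_le_norm _).trans (norm_extChar_le hχ x l)
  · rw [abs_neg]; exact (Complex.abs_im_le_norm _).trans (norm_extChar_le hχ x _)

theorem abs_featIm_le (hχ : IsCharacterFamily μ χ) (l : ℕ) (x : D) : |featIm χ l x| ≤ 1 := by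
  unfold featIm
  split_ifs
  · exact (Complex.abs_im_le_norm _).trans (norm_extChar_le hχ x l)
  · exact (Complex.abs_re_le_norm _).trans (norm_extChar_le hχ x _)

end Features

/-- The sign of a flag: outliers count negatively. -/
noncomputable def flagSign (b : Bool) : ℝ := if b then -1 else 1

section Event

variable {D : Type u} [MeasurableSpace D] {μ : Measure D} [IsProbabilityMeasure μ]
  {Ω : Type v} [MeasurableSpace Ω] {P : Measure Ω} [IsProbabilityMeasure P]

theorem le_integral_flagSign {b : Ω → Bool} (hb : Measurable b) {δ : ℝ} (hδ : δ ≤ 1 / 2)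
    (hP : P {ω | b ω = true} ≤ ENNReal.ofReal (1 / 2 - δ)) :
    2 * δ ≤ ∫ ω, flagSign (b ω) ∂P := by
  have hm : MeasurableSet {ω | b ω = true} := hb (measurableSet_singleton true)
  have h1 : (fun ω => flagSign (b ω)) =
      fun ω => 1 - 2 * Set.indicator {ω | b ω = true} (fun _ => (1 : ℝ)) ω := by
    ext ω
    by_cases h : b ω = true <;> simp [flagSign, h]
    norm_num
  have h2 : P.real {ω | b ω = true} ≤ 1 / 2 - δ :=
    ENNReal.toReal_le_of_le_ofReal (by linarith) hP
  rw [h1, integral_sub (integrable_const _)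
    (((integrable_const (1 : ℝ)).indicator hm).const_mul 2), integral_const_mul,
    integral_indicator_const _ hm]
  simp
  linarith

omit [IsProbabilityMeasure μ] in
theorem le_integral_flagSign_mul {x : Ω → D} {b : Ω → Bool} (hx : Measurable x)
    (hb : Measurable b) (hμ : P.map x = μ) (hind : IndepFun x b P) {δ : ℝ} (hδ : δ ≤ 1 / 2)
    (hP : P {ω | b ω = true} ≤ ENNReal.ofReal (1 / 2 - δ)) {g : D → ℝ} (hg : Measurable g) :
    2 * δ * ∫ z, |g z| ∂μ ≤
      ∫ z, flagSign z.2 * |g z.1| ∂(P.map fun ω => (x ω, b ω)) := by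
  have hs : Measurable flagSign := measurable_of_finite _
  have hm : Measurable fun z : D × Bool => flagSign z.2 * |g z.1| :=
    (hs.comp measurable_snd).mul (hg.comp measurable_fst).abs
  rw [integral_map (hx.prodMk hb).aemeasurable hm.aestronglyMeasurable]
  have h := (hind.comp (φ := fun z => |g z|) (ψ := flagSign) hg.abs
    hs).symm.integral_fun_mul_eq_mul_integral
    (hs.comp hb).aestronglyMeasurable (hg.abs.comp hx).aestronglyMeasurable
  simp only [Function.comp_apply] at h
  rw [h, ← hμ, integral_map hx.aemeasurable hg.abs.aestronglyMeasurable]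
  exact mul_le_mul_of_nonneg_right (le_integral_flagSign hb hδ hP)
    (integral_nonneg fun _ => abs_nonneg _)

variable {n : ℕ} {χ : Fin n → D → ℂ} {x : ℕ → Ω → D} {b : ℕ → Ω → Bool}

/-- No function in the span of the characters deviates much from its expectation on the sample. -/
def UniformAt (P : Measure Ω) (χ : Fin n → D → ℂ) (x : ℕ → Ω → D) (b : ℕ → Ω → Bool)
    (N : ℕ) (t : ℝ) (ω : Ω) : Prop :=
  (∀ c, ∑ i ∈ range N, dev P (fun i ω => (x i ω, b i ω)) (2 * n) (fun l z => featRe χ l z.1)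
    (fun z => flagSign z.2) c i ω ≤ N * t * l1 (2 * n) c) ∧
  ∀ c, ∑ i ∈ range N, dev P (fun i ω => (x i ω, b i ω)) (2 * n) (fun l z => featIm χ l z.1)
    (fun z => flagSign z.2) c i ω ≤ N * t * l1 (2 * n) c

omit [IsProbabilityMeasure μ] in
theorem measure_not_uniformAt_le (hχ : IsCharacterFamily μ χ) (hn : 0 < n)
    (hx : ∀ i, Measurable (x i)) (hb : ∀ i, Measurable (b i))
    (hind : iIndepFun (fun i ω => (x i ω, b i ω)) P) {t : ℝ} (ht : 0 < t) (N : ℕ) :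
    P {ω | ¬ UniformAt P χ x b N t ω} ≤
      ENNReal.ofReal (8 * n * Real.exp (-(N * t ^ 2 / 32))) := by
  have hs : Measurable fun z : D × Bool => flagSign z.2 :=
    (measurable_of_finite flagSign).comp measurable_snd
  have hs1 : ∀ z : D × Bool, flagSign z.2 = 1 ∨ flagSign z.2 = -1 := by
    rintro ⟨z, _ | _⟩ <;> simp [flagSign]
  have hRe : ∀ l, Measurable fun z : D × Bool => featRe χ l z.1 :=
    fun l => (measurable_featRe hχ l).comp measurable_fst
  have hIm : ∀ l, Measurable fun z : D × Bool => featIm χ l z.1 :=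
    fun l => (measurable_featIm hχ l).comp measurable_fst
  have h1 := measure_dev_le hind (fun i => (hx i).prodMk (hb i)) (by omega : 0 < 2 * n)
    (φ := fun l z => featRe χ l z.1) (sg := fun z => flagSign z.2)
    hRe (fun l z => abs_featRe_le hχ l z.1)
    hs hs1 ht N
  have h2 := measure_dev_le hind (fun i => (hx i).prodMk (hb i)) (by omega : 0 < 2 * n)
    (φ := fun l z => featIm χ l z.1) (sg := fun z => flagSign z.2)
    hIm (fun l z => abs_featIm_le hχ l z.1)
    hs hs1 ht N
  refine (measure_mono fun ω hω => ?_).trans ((measure_union_le _ _).trans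
    ((add_le_add h1 h2).trans ?_))
  · exact not_and_or.mp hω
  · rw [← ENNReal.ofReal_add (by positivity) (by positivity)]
    refine ENNReal.ofReal_le_ofReal (le_of_eq ?_)
    push_cast
    ring

theorem robust_of_uniformAt (hχ : IsCharacterFamily μ χ)
    (hx : ∀ i, Measurable (x i)) (hμ : ∀ i, P.map (x i) = μ) (hb : ∀ i, Measurable (b i))
    (hind : ∀ i, IndepFun (x i) (b i) P) {δ : ℝ} (hδ : δ ≤ 1 / 2)
    (hP : ∀ i, P {ω | b i ω = true} ≤ ENNReal.ofReal (1 / 2 - δ)) {N : ℕ} (hN : 0 < N)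
    {t : ℝ} {ω : Ω} (h : UniformAt P χ x b N t ω) (y : ℕ → Ω → ℂ) :
    Robust (2 * N) (2 * n) N (sampleMatrix (exampleSeq χ x y ω) N n) δ (2 * t)
      (fun r => b (if r < N then r else r - N) ω = false) (combNorm μ χ) (fun _ => True) := by
  refine ⟨combNorm_nonneg, fun c _ => ?_, fun c _ l hl => abs_le_combNorm hχ c hl⟩
  have key : ∀ (φ : ℕ → D → ℝ) (g : D → ℝ), Measurable g →
      (∀ z, ∑ l ∈ range (2 * n), φ l z * c l = g z) →
      ∑ i ∈ range N, dev P (fun i ω => (x i ω, b i ω)) (2 * n) (fun l z => φ l z.1)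
        (fun z => flagSign z.2) c i ω ≤ N * t * l1 (2 * n) c →
      N * (2 * δ * ∫ z, |g z| ∂μ) - N * t * l1 (2 * n) c ≤
        ∑ i ∈ range N, flagSign (b i ω) * |g (x i ω)| := by
    intro φ g hg hφ hdev
    simp only [dev, feat, hφ, sum_sub_distrib] at hdev
    have h1 := sum_le_sum fun i (_ : i ∈ range N) =>
      le_integral_flagSign_mul (hx i) (hb i) (hμ i) (hind i) hδ (hP i) hg
    rw [sum_const, card_range, nsmul_eq_mul] at h1
    linarith
  have hm := measurable_charComb hχ c
  have h1 := key (featRe χ) (fun z => (charComb χ c z).re) (Complex.measurable_re.comp hm)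
    (sum_featRe χ c) (h.1 c)
  have h2 := key (featIm χ) (fun z => (charComb χ c z).im) (Complex.measurable_im.comp hm)
    (sum_featIm χ c) (h.2 c)
  have hrow : ∑ r ∈ range (2 * N), (if b (if r < N then r else r - N) ω = false then
      |rowVal (2 * n) (sampleMatrix (exampleSeq χ x y ω) N n) c r| else
      -|rowVal (2 * n) (sampleMatrix (exampleSeq χ x y ω) N n) c r|) =
      ∑ i ∈ range N, flagSign (b i ω) * |(charComb χ c (x i ω)).re| +
      ∑ i ∈ range N, flagSign (b i ω) * |(charComb χ c (x i ω)).im| := by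
    rw [two_mul, sum_range_add]
    congr 1
    · refine sum_congr rfl fun i hi => ?_
      have hi' := mem_range.mp hi
      simp only [rowVal, sampleMatrix_exampleSeq, hi', if_true, sum_featRe]
      cases b i ω <;> simp [flagSign]
    · refine sum_congr rfl fun i _ => ?_
      have hi' : ¬ N + i < N := by omega
      simp only [rowVal, sampleMatrix_exampleSeq, hi', if_false, Nat.add_sub_cancel_left,
        sum_featIm]
      cases b i ω <;> simp [flagSign]
  have hN' : (0 : ℝ) < N := by exact_mod_cast hN
  rw [hrow, le_div_iff₀ hN', combNorm]
  nlinarith [h1, h2]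

end Event

end RealRAM

namespace RealRAM

open RobustRegression Finset

/-! ## The coefficients found by the algorithm -/

section Found

variable {o : ℕ → Example} {n k q N : ℕ} {δ ε η : ℝ} {good : ℕ → Prop} [DecidablePred good]
  {nu : (ℕ → ℝ) → ℝ} {f : ℕ → ℝ}

open Classical in
/-- The coordinates of the characters with a nonzero coefficient. -/
noncomputable def coordSupport (n : ℕ) (f : ℕ → ℝ) : Finset ℕ :=
  (range (2 * n)).filter fun l => ¬ (f (l % n) = 0 ∧ f (n + l % n) = 0)

theorem eq_zero_of_notMem_coordSupport (hf : ∀ l, 2 * n ≤ l → f l = 0) {l : ℕ}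
    (hl : l ∉ coordSupport n f) : f l = 0 := by
  by_cases h : l < 2 * n
  · have h' : f (l % n) = 0 ∧ f (n + l % n) = 0 := by
      by_contra h'
      exact hl (mem_filter.mpr ⟨mem_range.mpr h, h'⟩)
    by_cases hln : l < n
    · simpa [Nat.mod_eq_of_lt hln] using h'.1
    · have : l % n = l - n := by
        rw [Nat.mod_eq_sub_mod (by omega), Nat.mod_eq_of_lt (by omega)]
      have h2 := h'.2
      rwa [this, show n + (l - n) = l by omega] at h2
  · exact hf l (by omega)

theorem maskOf_eq (hη : 0 < η)
    (hlarge : ∀ j < n, (f j = 0 ∧ f (n + j) = 0) ∨ η ^ 2 ≤ f j ^ 2 + f (n + j) ^ 2)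
    {b : ℕ → ℝ} (hb : ∀ l < 2 * n, |b l - f l| ≤ 3 / 16 * η) (l : ℕ) :
    maskOf n η b l = if l ∈ coordSupport n f then 1 else 0 := by
  unfold maskOf
  refine if_congr ?_ rfl rfl
  rw [coordSupport, mem_filter, mem_range]
  refine and_congr_right fun hl => not_congr ?_
  have hj : l % n < n := Nat.mod_lt _ (by omega)
  have h1 := abs_le.mp (hb (l % n) (by omega))
  have h2 := abs_le.mp (hb (n + l % n) (by omega))
  set u := b (l % n)
  set v := b (n + l % n)
  set a := f (l % n)
  set c := f (n + l % n)
  constructor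
  · intro h
    refine (hlarge _ hj).resolve_right fun h' => ?_
    have e1 : (u - a) ^ 2 ≤ (3 / 16 * η) ^ 2 := sq_le_sq' h1.1 h1.2
    have e2 : (v - c) ^ 2 ≤ (3 / 16 * η) ^ 2 := sq_le_sq' h2.1 h2.2
    change η ^ 2 ≤ a ^ 2 + c ^ 2 at h'
    nlinarith [sq_nonneg (2 * u - a), sq_nonneg (2 * v - c), sq_nonneg (3 * u - a),
      sq_nonneg (3 * v - c), sq_pos_of_pos hη, sq_nonneg (5 * u - 2 * a),
      sq_nonneg (5 * v - 2 * c)]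
  · rintro ⟨ha, hc⟩
    rw [ha, sub_zero] at h1
    rw [hc, sub_zero] at h2
    have e1 : u ^ 2 ≤ (3 / 16 * η) ^ 2 := sq_le_sq' h1.1 h1.2
    have e2 : v ^ 2 ≤ (3 / 16 * η) ^ 2 := sq_le_sq' h2.1 h2.2
    nlinarith [sq_pos_of_pos hη]

theorem foundCoeff_spec
    (R : Robust (2 * N) (2 * n) N (sampleMatrix o N n) δ (lamOf k q) good nu fun _ => True)
    (hN : 0 < N) (hk : 0 < k) (hn : 0 < n) (hδ : 0 < δ) (hδ' : δ ≤ 1 / 2) (hq : 1 / δ ≤ q)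
    (hA : ∀ r < 2 * N, ∀ l < 2 * n, |sampleMatrix o N n r l| ≤ 1)
    (hcard : (coordSupport n f).card ≤ 2 * k) (hf : ∀ l, 2 * n ≤ l → f l = 0) (hε : 0 ≤ ε)
    (hη : 0 < η) (hεη : ε ≤ 1 / 64 * η * δ)
    (hlarge : ∀ j < n, (f j = 0 ∧ f (n + j) = 0) ∨ η ^ 2 ≤ f j ^ 2 + f (n + j) ^ 2)
    (hgood : ∀ r < 2 * N, good r →
      |rowVal (2 * n) (sampleMatrix o N n) f r - sampleObs o N r| ≤ ε) :
    (∀ l, l ∉ coordSupport n f → foundCoeff o n k q N η l = 0) ∧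
      nu (fun l => foundCoeff o n k q N η l - f l) ≤ 8 * (ε / δ) := by
  set S := coordSupport n f with hS
  have hSd : S ⊆ range (2 * n) := filter_subset _ _
  have hfS : ∀ l, l ∉ S → f l = 0 := fun l hl => eq_zero_of_notMem_coordSupport hf hl
  have h1 := coarse_spec R hN rfl hSd hcard hk (by omega) hδ hδ' hq hA hfS hε hη hεη hgood
    (Nat.le_ceil _)
  have hmask := maskOf_eq hη hlarge h1
  set mask := maskOf n η (coarse (2 * N) (2 * n) N k q η
    ⌈(∑ r ∈ range (2 * N), |sampleObs o N r|) / N / η⌉₊ (sampleMatrix o N n)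
    (sampleObs o N)).best with hmaskdef
  have hrow : ∀ (h : ℕ → ℝ), (∀ l, l ∉ S → h l = 0) → ∀ r,
      rowVal (2 * n) (fun r l => sampleMatrix o N n r l * mask l) h r =
      rowVal (2 * n) (sampleMatrix o N n) h r := by
    intro h hh r
    refine rowVal_congr fun l _ => ?_
    by_cases hl : l ∈ S
    · simp [hmask, ← hS, hl]
    · simp [hh l hl]
  have R' : Robust (2 * N) (2 * n) N (fun r l => sampleMatrix o N n r l * mask l) δ (lamOf k q)
      good nu (· ∈ S) := by
    refine ⟨R.nonneg, fun h hh => ?_, fun h _ => R.coord h fun l hl => absurd trivial hl⟩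
    simp only [hrow h hh]
    exact R.main h fun l hl => absurd trivial hl
  refine phases_spec R' hN rfl hSd hcard hk (by omega) hδ hq (fun r hr l hl => ?_)
    (fun r l hl => by simp [hmask, ← hS, hl]) hfS hε
    (fun r hr hg => by rw [hrow f hfS]; exact hgood r hr hg) hmask
  rw [abs_mul]
  refine mul_le_one₀ (hA r hr l hl) (abs_nonneg _) ?_
  rw [hmask]
  split_ifs <;> simp

end Found

/-! ## Bounds on the number of queries and on the running time -/

theorem exp_neg_lgOf_le {X : ℝ} (hX : 0 ≤ X) : X * Real.exp (-(lgOf X : ℝ)) ≤ 1 := by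
  have h1 : X ≤ 2 ^ lgOf X := not_lt.mp ((pow_lt_iff_lt_lgOf hX _).not.mpr (lt_irrefl _))
  have h2 : (2 : ℝ) ≤ Real.exp 1 := by linarith [Real.add_one_le_exp (1 : ℝ)]
  have h3 : (2 : ℝ) ^ lgOf X ≤ Real.exp (lgOf X) := by
    rw [← Real.exp_one_pow]
    exact pow_le_pow_left₀ (by norm_num) h2 _
  rw [Real.exp_neg, ← div_eq_mul_inv, div_le_one (Real.exp_pos _)]
  exact h1.trans h3

theorem sampleCount_mul_sq {k q : ℕ} (hk : 0 < k) (hq : 0 < q) (L : ℕ) :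
    (sampleCount k q L : ℝ) * (lamOf k q / 2) ^ 2 / 32 = L := by
  have hk' : (k : ℝ) ≠ 0 := by exact_mod_cast hk.ne'
  have hq' : (q : ℝ) ≠ 0 := by exact_mod_cast hq.ne'
  unfold sampleCount lamOf
  push_cast
  field_simp
  ring

section Bounds

variable {n k : ℕ} {γ δ η B : ℝ}

theorem lgOf_le (hn : 0 < n) (hγ : 0 < γ) (hγ' : γ < 1) :
    (lgOf (8 * n / γ) : ℝ) ≤ 4 + (Real.log n + Real.log (1 / γ)) / Real.log 2 := by
  have hn' : (1 : ℝ) ≤ n := by exact_mod_cast hn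
  have h2 : 0 < Real.log 2 := Real.log_pos (by norm_num)
  have h1 : Real.logb 2 (8 * n / γ) = 3 + (Real.log n + Real.log (1 / γ)) / Real.log 2 := by
    rw [Real.logb, show 8 * n / γ = 2 ^ 3 * (n * (1 / γ)) by ring,
      Real.log_mul (by norm_num) (by positivity), Real.log_mul (by positivity) (by positivity),
      Real.log_pow]
    field_simp
    push_cast
    ring
  have h3 : 0 ≤ Real.log (1 / γ) := Real.log_nonneg (by rw [le_div_iff₀ hγ]; linarith)
  have h4 := Nat.ceil_lt_add_one (a := Real.logb 2 (8 * n / γ))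
    (by rw [h1]; have := Real.log_nonneg hn'; positivity)
  rw [h1] at h4
  unfold lgOf
  rw [h1]
  linarith

theorem ceil_inv_le (hδ : 0 < δ) (hδ' : δ ≤ 1 / 2) : ((⌈1 / δ⌉₊ : ℕ) : ℝ) ≤ 2 / δ := by
  have h1 := Nat.ceil_lt_add_one (a := 1 / δ) (by positivity)
  have h2 : 1 ≤ 1 / δ := by rw [le_div_iff₀ hδ]; linarith
  have h3 : 2 / δ = 1 / δ + 1 / δ := by ring
  linarith

theorem log_two_ge_half : 1 / 2 ≤ Real.log 2 := by linarith [Real.log_two_gt_d9]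

theorem queryScale_nonneg (hγ : 0 < γ) (hγ' : γ < 1) (n k : ℕ) (δ : ℝ) :
    0 ≤ queryScale n k γ δ := by
  unfold queryScale
  have h1 : 0 ≤ Real.log ((n : ℝ) + 1) := Real.log_nonneg (by linarith [n.cast_nonneg (α := ℝ)])
  have h2 : 0 ≤ Real.log (2 / γ) := Real.log_nonneg (by rw [le_div_iff₀ hγ]; linarith)
  positivity

theorem sampleCount_le_queryScale (hγ : 0 < γ) (hγ' : γ < 1) (hδ : 0 < δ) (hδ' : δ ≤ 1 / 2) :
    (sampleCount (min k n) ⌈1 / δ⌉₊ (lgOf (8 * n / γ)) : ℝ) ≤ 196608 * queryScale n k γ δ := by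
  have hQ := queryScale_nonneg hγ hγ' n k δ
  rcases Nat.eq_zero_or_pos n with rfl | hn
  · simp [sampleCount]
    exact hQ
  have hn' : (1 : ℝ) ≤ n := by exact_mod_cast hn
  have h2 := log_two_ge_half
  set u := Real.log ((n : ℝ) + 1) with hu
  set v := Real.log (2 / γ) with hv
  have hu2 : Real.log 2 ≤ u := Real.log_le_log (by norm_num) (by linarith)
  have hv2 : Real.log 2 ≤ v :=
    Real.log_le_log (by norm_num) (by rw [le_div_iff₀ hγ]; linarith)
  have hnu : Real.log n ≤ u := Real.log_le_log (by positivity) (by linarith)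
  have hγv : Real.log (1 / γ) ≤ v :=
    Real.log_le_log (by positivity) (div_le_div_of_nonneg_right (by norm_num) hγ.le)
  have hL : (lgOf (8 * n / γ) : ℝ) ≤ 24 * (u * v) := by
    refine (lgOf_le hn hγ hγ').trans ?_
    have h3 : (Real.log n + Real.log (1 / γ)) / Real.log 2 ≤ 2 * (u + v) := by
      rw [div_le_iff₀ (by linarith)]
      nlinarith
    nlinarith
  have hq := ceil_inv_le hδ hδ'
  have hk : ((min k n : ℕ) : ℝ) ≤ k := by exact_mod_cast min_le_left k n
  have hq2 : ((⌈1 / δ⌉₊ : ℕ) : ℝ) * ⌈1 / δ⌉₊ ≤ 4 / δ ^ 2 := by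
    calc ((⌈1 / δ⌉₊ : ℕ) : ℝ) * ⌈1 / δ⌉₊ ≤ 2 / δ * (2 / δ) := by gcongr
      _ = 4 / δ ^ 2 := by field_simp; norm_num
  unfold sampleCount
  generalize min k n = k' at hk
  generalize ⌈1 / δ⌉₊ = q at hq2
  generalize lgOf (8 * n / γ) = L at hL
  push_cast
  calc (2048 : ℝ) * (k' * k') * (q * q) * L
      ≤ 2048 * ((k : ℝ) * k) * (4 / δ ^ 2) * (24 * (u * v)) := by gcongr
    _ = 196608 * queryScale n k γ δ := by
        unfold queryScale
        rw [← hu, ← hv]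
        ring

/-- A bound on the number of iterations of each loop. -/
def loopBound (n k q L R : ℕ) : ℕ :=
  L + q + (2 * n + 1) + (2 * sampleCount k q L + 1) + R +
    1152 * k * (2 * n) * ((R + 1) * (R + 1)) * (q * q * q * q) +
    294912 * (k * k * k) * (2 * n) * (2 * sampleCount k q L * (2 * sampleCount k q L)) *
      (q * q * q * q)

theorem loopBound_le {n k q L R : ℕ} {X : ℝ} (hX : 2 ≤ X) (hn : (n : ℝ) ≤ X) (hk : (k : ℝ) ≤ X)
    (hq : (q : ℝ) ≤ 2 * X) (hL : (L : ℝ) ≤ 4 * X) (hR : (R : ℝ) ≤ 3 * X ^ 2) :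
    (loopBound n k q L R : ℝ) ≤ 10 ^ 17 * X ^ 18 := by
  have hp : ∀ {i : ℕ}, i ≤ 18 → X ^ i ≤ X ^ 18 := fun h =>
    pow_le_pow_right₀ (by linarith) h
  have h0 : 1 ≤ X ^ 18 := one_le_pow₀ (by linarith)
  have h1 : X ≤ X ^ 18 := by simpa using hp (i := 1) (by norm_num)
  have h2 := hp (i := 2) (by norm_num)
  have h5 := hp (i := 5) (by norm_num)
  have h10 := hp (i := 10) (by norm_num)
  have hN : (sampleCount k q L : ℝ) ≤ 32768 * X ^ 5 := by
    unfold sampleCount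
    push_cast
    calc (2048 : ℝ) * (k * k) * (q * q) * L ≤ 2048 * (X * X) * (2 * X * (2 * X)) * (4 * X) := by
          gcongr
      _ = 32768 * X ^ 5 := by ring
  have hR1 : (R : ℝ) + 1 ≤ 4 * X ^ 2 := by nlinarith
  have h6 : (1152 : ℝ) * k * (2 * n) * ((R + 1) * (R + 1)) * (q * q * q * q) ≤
      589824 * X ^ 18 := by
    calc (1152 : ℝ) * k * (2 * n) * ((R + 1) * (R + 1)) * (q * q * q * q)
        ≤ 1152 * X * (2 * X) * (4 * X ^ 2 * (4 * X ^ 2)) *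
          (2 * X * (2 * X) * (2 * X) * (2 * X)) := by gcongr
      _ = 589824 * X ^ 10 := by ring
      _ ≤ 589824 * X ^ 18 := by linarith
  have h7 : (294912 : ℝ) * (k * k * k) * (2 * n) *
      (2 * sampleCount k q L * (2 * sampleCount k q L)) * (q * q * q * q) ≤
      9 * 10 ^ 16 * X ^ 18 := by
    calc (294912 : ℝ) * (k * k * k) * (2 * n) *
          (2 * sampleCount k q L * (2 * sampleCount k q L)) * (q * q * q * q)
        ≤ 294912 * (X * X * X) * (2 * X) * (2 * (32768 * X ^ 5) * (2 * (32768 * X ^ 5))) *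
          (2 * X * (2 * X) * (2 * X) * (2 * X)) := by gcongr
      _ = 294912 * 2 * 4 * 32768 ^ 2 * 16 * X ^ 18 := by ring
      _ ≤ 9 * 10 ^ 16 * X ^ 18 := by
        refine mul_le_mul_of_nonneg_right ?_ (by linarith)
        norm_num
  unfold loopBound
  push_cast
  linarith

end Bounds

theorem runs_learnProg_bounds {o : ℕ → Example} {n k : ℕ} {γ δ η B : ℝ} (hγ : 0 < γ)
    (hγ' : γ < 1) (hδ : 0 < δ) (hδ' : δ ≤ 1 / 2) (hη : 0 < η) (hB : ∀ i, ‖(o i).obs‖ ≤ B)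
    {q N : ℕ} (hq : q = ⌈1 / δ⌉₊) (hN : N = sampleCount (min k n) q (lgOf (8 * n / γ))) :
    ∃ (t : ℕ) (s : State), Exec o learnProg (initState n k γ δ η) t s ∧ s.queries = N ∧
      (t : ℝ) ≤ learnProg.coeff * (10 ^ 17) ^ learnProg.deg *
        (n + 1 / δ + 1 / η + Real.log (1 / γ) + B) ^ (18 * learnProg.deg) ∧
      ∀ j < n, s.outCoeff j = if 0 < min k n then
        ⟨foundCoeff o n (min k n) q N η j, foundCoeff o n (min k n) q N η (n + j)⟩ else 0 := by
  set X : ℝ := n + 1 / δ + 1 / η + Real.log (1 / γ) + B with hX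
  set L := lgOf (8 * n / γ) with hL
  set R := ⌈(∑ r ∈ range (2 * N), |sampleObs o N r|) / N / η⌉₊ with hR
  have hB0 : 0 ≤ B := (norm_nonneg _).trans (hB 0)
  have hlog : 0 ≤ Real.log (1 / γ) := Real.log_nonneg (by rw [le_div_iff₀ hγ]; linarith)
  have hδ2 : 2 ≤ 1 / δ := by rw [le_div_iff₀ hδ]; linarith
  have hη0 : 0 < 1 / η := by positivity
  have hn0 : (0 : ℝ) ≤ n := n.cast_nonneg
  have hX2 : 2 ≤ X := by linarith
  have hq2 : (q : ℝ) ≤ 2 * X := by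
    have := ceil_inv_le hδ hδ'
    rw [← hq, show 2 / δ = 2 * (1 / δ) by ring] at this
    linarith
  have hL4 : (L : ℝ) ≤ 4 * X := by
    rcases Nat.eq_zero_or_pos n with rfl | hn
    · have : L = 0 := by simp [hL, lgOf]
      rw [this, Nat.cast_zero]
      linarith
    · refine (lgOf_le hn hγ hγ').trans ?_
      have h2 := log_two_ge_half
      have h3 : (Real.log n + Real.log (1 / γ)) / Real.log 2 ≤ 2 * (n + Real.log (1 / γ)) := by
        rw [div_le_iff₀ (by linarith)]
        have := Real.log_le_self hn0
        nlinarith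
      linarith
  have hR3 : (R : ℝ) ≤ 3 * X ^ 2 := by
    have h1 : ∑ r ∈ range (2 * N), |sampleObs o N r| ≤ 2 * N * B := by
      refine (sum_le_card_nsmul _ _ B fun r _ => ?_).trans (by simp)
      unfold sampleObs
      split_ifs
      · exact (Complex.abs_re_le_norm _).trans (hB _)
      · exact (Complex.abs_im_le_norm _).trans (hB _)
    have h2 : (∑ r ∈ range (2 * N), |sampleObs o N r|) / N ≤ 2 * B := by
      refine div_le_of_le_mul₀ (Nat.cast_nonneg _) (by positivity) (h1.trans (by linarith))
    have h3 : (∑ r ∈ range (2 * N), |sampleObs o N r|) / N / η ≤ 2 * B * (1 / η) := by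
      rw [div_eq_mul_one_div _ η]
      gcongr
    have h4 := Nat.ceil_lt_add_one (a := (∑ r ∈ range (2 * N), |sampleObs o N r|) / N / η)
      (by positivity)
    rw [← hR] at h4
    nlinarith [mul_le_mul (by linarith : B ≤ X) (by linarith : 1 / η ≤ X) hη0.le (by linarith)]
  have hY := loopBound_le hX2 (by linarith : (n : ℝ) ≤ X)
    (le_trans (by exact_mod_cast min_le_right k n) (by linarith : (n : ℝ) ≤ X)) hq2 hL4 hR3
  have hYdef : loopBound n (min k n) q L R = L + q + (2 * n + 1) + (2 * N + 1) + R +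
    1152 * min k n * (2 * n) * ((R + 1) * (R + 1)) * (q * q * q * q) +
    294912 * (min k n * min k n * min k n) * (2 * n) * (2 * N * (2 * N)) *
      (q * q * q * q) := by rw [hN]; rfl
  obtain ⟨s, ⟨t, ht, htY⟩, hs⟩ := exists_runs_learnProg (o := o) (Y := loopBound n (min k n) q L R)
    (k := k) (δ := δ) (η := η) hγ hq hN hR (by omega) (by omega) (by omega) (by omega) (by omega)
    (by omega) (by omega)
  refine ⟨t, s, ht, hs.1, ?_, hs.2⟩
  calc (t : ℝ) ≤ learnProg.coeff * (loopBound n (min k n) q L R : ℝ) ^ learnProg.deg := by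
        exact_mod_cast htY
    _ ≤ learnProg.coeff * (10 ^ 17 * X ^ 18) ^ learnProg.deg := by gcongr
    _ = _ := by rw [mul_pow _ (X ^ 18), ← pow_mul X, ← mul_assoc]

end RealRAM

namespace RealRAM

open RobustRegression Finset

/-! ## Correctness -/

section Coordinates

variable {n : ℕ}

/-- Real coordinates of a vector of coefficients. -/
noncomputable def coordVec (a : Fin n → ℂ) (l : ℕ) : ℝ :=
  if h : l < n then (a ⟨l, h⟩).re else if h : l - n < n then (a ⟨l - n, h⟩).im else 0

theorem coordVec_fin (a : Fin n → ℂ) (j : Fin n) :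
    (⟨coordVec a j, coordVec a (n + j)⟩ : ℂ) = a j := by
  simp [coordVec]

theorem coordVec_eq_zero (a : Fin n → ℂ) {l : ℕ} (hl : 2 * n ≤ l) : coordVec a l = 0 := by
  rw [coordVec, dif_neg (by omega), dif_neg (by omega)]

theorem charComb_coordVec {D : Type u} (χ : Fin n → D → ℂ) (a : Fin n → ℂ) :
    charComb χ (coordVec a) = fun x => ∑ j, a j * χ j x := by
  ext x
  simp only [charComb, coordVec_fin]

theorem coordVec_pair_eq_zero (a : Fin n → ℂ) (j : Fin n) :
    coordVec a j = 0 ∧ coordVec a (n + j) = 0 ↔ a j = 0 := by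
  conv_rhs => rw [← coordVec_fin a j, Complex.ext_iff]
  rfl

theorem card_coordSupport_le (a : Fin n → ℂ) {k : ℕ} (hk : {j | a j ≠ 0}.ncard ≤ k) :
    (coordSupport n (coordVec a)).card ≤ 2 * min k n := by
  classical
  set T : Finset (Fin n) := univ.filter fun j => a j ≠ 0 with hT
  have hTk : T.card ≤ min k n := by
    refine le_min ?_ ((card_le_univ T).trans (by simp))
    rwa [← Set.ncard_coe_finset, hT, coe_filter_univ]
  have hsub : coordSupport n (coordVec a) ⊆
      T.image (fun j : Fin n => (j : ℕ)) ∪ T.image (fun j : Fin n => n + (j : ℕ)) := by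
    intro l hl
    obtain ⟨h1, h2⟩ := mem_filter.mp hl
    have h1 := mem_range.mp h1
    have hj : l % n < n := Nat.mod_lt _ (by omega)
    have h3 : (⟨l % n, hj⟩ : Fin n) ∈ T := by
      rw [hT, mem_filter]
      exact ⟨mem_univ _, fun h => h2 ((coordVec_pair_eq_zero a ⟨l % n, hj⟩).mpr h)⟩
    rw [mem_union, mem_image, mem_image]
    by_cases hln : l < n
    · exact Or.inl ⟨_, h3, Nat.mod_eq_of_lt hln⟩
    · refine Or.inr ⟨_, h3, ?_⟩
      change n + l % n = l
      rw [Nat.mod_eq_sub_mod (by omega), Nat.mod_eq_of_lt (by omega)]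
      omega
  refine (card_le_card hsub).trans ((card_union_le _ _).trans ?_)
  have h1 := card_image_le (s := T) (f := fun j : Fin n => (j : ℕ))
  have h2 := card_image_le (s := T) (f := fun j : Fin n => n + (j : ℕ))
  omega

theorem notMem_coordSupport (a : Fin n → ℂ) {j : Fin n} (hj : a j = 0) :
    (j : ℕ) ∉ coordSupport n (coordVec a) ∧ n + (j : ℕ) ∉ coordSupport n (coordVec a) := by
  have h := (coordVec_pair_eq_zero a j).mpr hj
  simp [coordSupport, Nat.mod_eq_of_lt j.isLt, h]

end Coordinates

section Correct

variable {D : Type u} [MeasurableSpace D] {μ : Measure D} [IsProbabilityMeasure μ] {n k : ℕ}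
  {χ : Fin n → D → ℂ} {δ η ε : ℝ} {f : D → ℂ}
  {Ω : Type v} [MeasurableSpace Ω] {P : Measure Ω} [IsProbabilityMeasure P]
  {x : ℕ → Ω → D} {y : ℕ → Ω → ℂ} {outlier : ℕ → Ω → Bool}

theorem recovery_of_combNorm_le (hχ : IsCharacterFamily μ χ) (hδ : 0 < δ) (hη : 0 < η)
    (hεη : ε ≤ 1 / 64 * η * δ) (hf : f ∈ Submodule.span ℂ (Set.range χ))
    (hlarge : ∀ j ∈ charSupport μ χ f, η ≤ ‖charCoeff μ χ f j‖) {b : ℕ → ℝ}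
    (hb : ∀ l, l ∉ coordSupport n (coordVec (charCoeff μ χ f)) → b l = 0)
    (hclose : combNorm μ χ (fun l => b l - coordVec (charCoeff μ χ f) l) ≤ 8 * (ε / δ)) :
    charSupport μ χ (charComb χ b) = charSupport μ χ f ∧
      ∫ z, ‖charComb χ b z - f z‖ ∂μ ≤ 8 * (ε / δ) ∧
      ∀ j, ‖charCoeff μ χ (charComb χ b) j - charCoeff μ χ f j‖ ≤ 8 * (ε / δ) := by
  set v := coordVec (charCoeff μ χ f) with hv
  have hfv : f = charComb χ v := by rw [hv, charComb_coordVec]; exact eq_sum_charCoeff hχ hf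
  have hdiff : ∀ z, charComb χ b z - f z = charComb χ (fun l => b l - v l) z := by
    intro z
    rw [charComb_sub, ← hfv]
  have hcoef : ∀ j, ‖charCoeff μ χ (charComb χ b) j - charCoeff μ χ f j‖ ≤ 8 * (ε / δ) := by
    intro j
    rw [charCoeff_charComb hχ, ← coordVec_fin (charCoeff μ χ f) j, ← hv]
    exact (norm_coeff_le_combNorm hχ (fun l => b l - v l) j).trans hclose
  refine ⟨Set.ext fun j => ?_, ?_, hcoef⟩
  · constructor
    · intro hj hj'
      obtain ⟨h1, h2⟩ := notMem_coordSupport _ hj'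
      refine hj ?_
      rw [charCoeff_charComb hχ, hb _ h1, hb _ h2]
      rfl
    · intro hj hj'
      have h1 := hlarge j hj
      have h2 := hcoef j
      rw [hj', zero_sub, norm_neg] at h2
      have h3 : ε / δ ≤ 1 / 64 * η := by rwa [div_le_iff₀ hδ]
      linarith
  · simp only [hdiff]
    exact (integral_norm_charComb_le hχ _).trans hclose

theorem foundCoeff_correct (hχ : IsCharacterFamily μ χ) (hδ : 0 < δ) (hδ' : δ ≤ 1 / 2)
    (hη : 0 < η) (hε : 0 ≤ ε) (hεη : ε ≤ 1 / 64 * η * δ)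
    (hf : f ∈ Submodule.span ℂ (Set.range χ)) (hcard : (charSupport μ χ f).ncard ≤ k)
    (hlarge : ∀ j ∈ charSupport μ χ f, η ≤ ‖charCoeff μ χ f j‖)
    (hx : ∀ i, Measurable (x i)) (hμ : ∀ i, P.map (x i) = μ)
    (hb : ∀ i, Measurable (outlier i))
    (hP : ∀ i, P {ω | outlier i ω = true} ≤ ENNReal.ofReal (1 / 2 - δ))
    (hind : ∀ i, IndepFun (x i) (outlier i) P) {ω : Ω}
    (hgood : ∀ i, outlier i ω = false → ‖y i ω - f (x i ω)‖ ≤ ε)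
    {q N : ℕ} (hq : 1 / δ ≤ q) (hN : 0 < N) (hkn : 0 < min k n)
    (h : UniformAt P χ x outlier N (lamOf (min k n) q / 2) ω) :
    (∀ l, l ∉ coordSupport n (coordVec (charCoeff μ χ f)) →
      foundCoeff (exampleSeq χ x y ω) n (min k n) q N η l = 0) ∧
    combNorm μ χ (fun l => foundCoeff (exampleSeq χ x y ω) n (min k n) q N η l -
      coordVec (charCoeff μ χ f) l) ≤ 8 * (ε / δ) := by
  have R := robust_of_uniformAt hχ hx hμ hb hind hδ' hP hN h y
  rw [mul_div_cancel₀ _ (two_ne_zero)] at R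
  have hfv : f = charComb χ (coordVec (charCoeff μ χ f)) := by
    rw [charComb_coordVec]; exact eq_sum_charCoeff hχ hf
  refine foundCoeff_spec R hN hkn (by omega) hδ hδ' hq (fun r _ l _ => ?_)
    (card_coordSupport_le _ hcard) (fun l hl => coordVec_eq_zero _ hl) hε hη hεη
    (fun j hj => ?_) (fun r _ hg => ?_)
  · rw [sampleMatrix_exampleSeq]
    split_ifs
    · exact abs_featRe_le hχ _ _
    · exact abs_featIm_le hχ _ _
  · by_cases h0 : charCoeff μ χ f ⟨j, hj⟩ = 0
    · exact Or.inl ((coordVec_pair_eq_zero (charCoeff μ χ f) ⟨j, hj⟩).mpr h0)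
    · right
      have h1 := hlarge ⟨j, hj⟩ h0
      rw [← coordVec_fin (charCoeff μ χ f) ⟨j, hj⟩] at h1
      have h2 := pow_le_pow_left₀ hη.le h1 2
      rw [Complex.sq_norm, Complex.normSq_apply] at h2
      simp only at h2
      linarith
  · have h1 := hgood _ hg
    by_cases hrN : r < N
    · rw [if_pos hrN] at h1
      simp only [rowVal, sampleMatrix_exampleSeq, if_pos hrN, sum_featRe, sampleObs, exampleSeq]
      rw [← hfv, abs_sub_comm]
      exact (Complex.abs_re_le_norm _).trans h1
    · rw [if_neg hrN] at h1
      simp only [rowVal, sampleMatrix_exampleSeq, if_neg hrN, sum_featIm, sampleObs, exampleSeq]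
      rw [← hfv, abs_sub_comm]
      exact (Complex.abs_im_le_norm _).trans h1

omit [IsProbabilityMeasure μ] in
/-- The trivial case: the function vanishes. -/
theorem coordVec_charCoeff_eq_zero (hcard : (charSupport μ χ f).ncard ≤ k) (hkn : ¬ 0 < min k n) :
    coordVec (charCoeff μ χ f) = fun _ => 0 := by
  have h0 : ∀ j, charCoeff μ χ f j = 0 := by
    intro j
    have hk : k = 0 := by have := j.isLt; omega
    rw [hk, Nat.le_zero, Set.ncard_eq_zero (Set.toFinite _)] at hcard
    by_contra hj
    exact Set.eq_empty_iff_forall_notMem.mp hcard j hj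
  ext l
  simp [coordVec, h0]

end Correct

end RealRAM

open RealRAM RobustRegression in
theorem mainTheorem3 :
    ∃ (prog : RealRAM.Prog) (c K : ℝ) (a b : ℕ), 0 < c ∧ 0 < K ∧
      ∀ (D : Type u) [MeasurableSpace D] (μ : Measure D) [IsProbabilityMeasure μ]
        (n k : ℕ) (χ : Fin n → D → ℂ), IsCharacterFamily μ χ →
      ∀ (γ δ η ε B : ℝ), 0 < γ → γ < 1 → 0 < δ → δ ≤ 1 / 2 → 0 < η → 0 ≤ ε → ε ≤ c * η * δ →
      ∀ f : D → ℂ, f ∈ Submodule.span ℂ (Set.range χ) →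
        (charSupport μ χ f).ncard ≤ k →
        (∀ j ∈ charSupport μ χ f, η ≤ ‖charCoeff μ χ f j‖) →
      ∀ (Ω : Type v) [MeasurableSpace Ω] (P : Measure Ω) [IsProbabilityMeasure P]
        (x : ℕ → Ω → D) (y : ℕ → Ω → ℂ),
        IsRandomOutlierOracle μ P f (1 / 2 - δ) ε x y →
        (∀ i ω, ‖y i ω‖ ≤ B) →
        (∀ ω, ∃ (t : ℕ) (s : RealRAM.State),
          RealRAM.Exec (exampleSeq χ x y ω) prog (RealRAM.initState n k γ δ η) t s ∧
          (s.queries : ℝ) ≤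
            K * queryScale n k γ δ * Real.log (2 + queryScale n k γ δ) ^ a ∧
          (t : ℝ) ≤ K * (n + 1 / δ + 1 / η + Real.log (1 / γ) + B) ^ b) ∧
        P {ω | ¬ ∃ (t : ℕ) (s : RealRAM.State),
          RealRAM.Exec (exampleSeq χ x y ω) prog (RealRAM.initState n k γ δ η) t s ∧
          charSupport μ χ (outputFun χ s) = charSupport μ χ f ∧
          ∫ z, ‖outputFun χ s z - f z‖ ∂μ ≤ K * (ε / δ) ∧
          ∀ j, ‖charCoeff μ χ (outputFun χ s) j - charCoeff μ χ f j‖ ≤ K * (ε / δ)} ≤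
          ENNReal.ofReal γ := by
  obtain ⟨C, hC⟩ : ∃ C : ℝ, C = learnProg.coeff * (10 ^ 17) ^ learnProg.deg := ⟨_, rfl⟩
  have hC0 : 0 ≤ C := by rw [hC]; exact mul_nonneg (Nat.cast_nonneg _) (by positivity)
  refine ⟨learnProg, 1 / 64, 196608 + C, 0, 18 * learnProg.deg, by norm_num, by linarith, ?_⟩
  intro D _ μ _ n k χ hχ γ δ η ε B hγ hγ' hδ hδ' hη hε hεη f hf hcard hlarge Ω _ P _ x y
    ⟨hx, hμ, outlier, hb, hP, hxb, hind, hgood⟩ hB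
  have hruns := fun ω => runs_learnProg_bounds (o := exampleSeq χ x y ω) (n := n) (k := k) hγ hγ'
    hδ hδ' hη (fun i => hB i ω) rfl rfl
  rw [← hC] at hruns
  set q := ⌈1 / δ⌉₊ with hq
  set N := sampleCount (min k n) q (lgOf (8 * n / γ)) with hN
  have hQ := queryScale_nonneg hγ hγ' n k δ
  have hNQ : (N : ℝ) ≤ 196608 * queryScale n k γ δ := sampleCount_le_queryScale hγ hγ' hδ hδ'
  refine ⟨fun ω => ?_, ?_⟩
  · obtain ⟨t, s, hs, hsN, ht, -⟩ := hruns ω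
    have hB0 : 0 ≤ B := (norm_nonneg _).trans (hB 0 ω)
    have hlog : 0 ≤ Real.log (1 / γ) := Real.log_nonneg (by rw [le_div_iff₀ hγ]; linarith)
    refine ⟨t, s, hs, ?_, ht.trans ?_⟩
    · rw [hsN, pow_zero, mul_one]
      exact hNQ.trans (mul_le_mul_of_nonneg_right (by linarith) hQ)
    · refine mul_le_mul_of_nonneg_right (by linarith) (pow_nonneg ?_ _)
      positivity
  have hεδ : 8 * (ε / δ) ≤ (196608 + C) * (ε / δ) :=
    mul_le_mul_of_nonneg_right (by linarith) (by positivity)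
  suffices main : ∀ Good : Ω → Prop, (∀ ω (b : ℕ → ℝ), (0 < min k n →
        b = foundCoeff (exampleSeq χ x y ω) n (min k n) q N η) → (¬ 0 < min k n → b = fun _ => 0) →
      (∀ l, l ∉ coordSupport n (coordVec (charCoeff μ χ f)) → b l = 0) →
      combNorm μ χ (fun l => b l - coordVec (charCoeff μ χ f) l) ≤ 8 * (ε / δ) → Good ω) →
      P {ω | ¬ Good ω} ≤ ENNReal.ofReal γ by
    refine main _ ?_
    intro ω b h1 h2 h3 h4
    obtain ⟨t, s, hs, -, -, hcoef⟩ := hruns ω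
    have hsb : outputFun χ s = charComb χ b := by
      ext z
      refine Finset.sum_congr rfl fun j _ => ?_
      rw [hcoef j j.isLt]
      split_ifs with hkn
      · rw [h1 hkn]
      · rw [h2 hkn]; rfl
    obtain ⟨a1, a2, a3⟩ := recovery_of_combNorm_le hχ hδ hη hεη hf hlarge h3 h4
    refine ⟨t, s, hs, ?_⟩
    rw [hsb]
    exact ⟨a1, a2.trans hεδ, fun j => (a3 j).trans hεδ⟩
  intro Good hout
  by_cases hkn : 0 < min k n
  · have hn : 0 < n := hkn.trans_le (min_le_right _ _)
    have hn' : (1 : ℝ) ≤ n := by exact_mod_cast hn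
    have hq0 : 0 < q := Nat.ceil_pos.mpr (by positivity)
    have hL : 0 < lgOf (8 * n / γ) := Nat.ceil_pos.mpr (Real.logb_pos (by norm_num) (by
      rw [lt_div_iff₀ hγ]; linarith))
    have hN0 : 0 < N := by rw [hN, sampleCount]; positivity
    have hlam : 0 < lamOf (min k n) q := by
      have h1 : (0 : ℝ) < (min k n : ℕ) := by exact_mod_cast hkn
      have h2 : (0 : ℝ) < q := by exact_mod_cast hq0
      unfold lamOf
      positivity
    refine (measure_mono (μ := P) (s := {ω | ¬ Good ω}) (t := {ω | ¬ UniformAt P χ x outlier N (lamOf (min k n) q / 2) ω})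
      fun ω (hω : ¬ Good ω) hU => hω ?_).trans ((measure_not_uniformAt_le hχ hn hx hb hind (half_pos hlam) N).trans ?_)
    · obtain ⟨h3, h4⟩ := foundCoeff_correct hχ hδ hδ' hη hε hεη hf hcard hlarge hx hμ hb hP hxb
        (fun i => hgood i ω) (Nat.le_ceil (1 / δ)) hN0 hkn hU
      exact hout ω _ (fun _ => rfl) (fun h => absurd hkn h) h3 h4
    · refine ENNReal.ofReal_le_ofReal ?_
      rw [hN, sampleCount_mul_sq hkn hq0]
      have h := exp_neg_lgOf_le (X := 8 * n / γ) (by positivity)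
      rwa [div_mul_eq_mul_div, div_le_one hγ] at h
  · rw [show {ω | ¬ Good ω} = (∅ : Set Ω) from Set.eq_empty_iff_forall_notMem.mpr fun ω hω => hω ?_]
    · simp
    · refine hout ω (fun _ => 0) (fun h => absurd h hkn) (fun _ => rfl) (fun _ _ => rfl) ?_
      rw [coordVec_charCoeff_eq_zero hcard hkn]
      have h0 : ∀ z, charComb χ (fun _ => (0 : ℝ) - 0) z = 0 := by
        intro z
        refine Finset.sum_eq_zero fun j _ => ?_
        rw [sub_zero, show (⟨0, 0⟩ : ℂ) = 0 from rfl, zero_mul]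
      simp only [combNorm, h0]
      simp
      positivity
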